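/- **Setting.** Fix $K\ge 2$, $d\ge 0$ and $\mathcal W=[0,1]^d$. Contexts $W_1,W_2,\dots\in\mathcal W$ are i.i.d. with law $P_W$. At time $t\ge1$ the learner observes $W_t$, draws an action $A_t\in[K]$ from a design $g_t(\cdot\mid W_t)$ that is determined by $O_1,\dots,O_{t-1}$, where $O_\tau=(W_\tau,A_\tau,Y_\tau)$, and receives $Y_t\in\{0,1\}$ with conditional mean $\eta(A_t,W_t)$ given the past, $W_t$ and $A_t$. A policy is a measurable $f:[K]\times\mathcal W\to\mathbb R_+$ with $\sum_a f(a,w)=1$ for all $w$. Put $$\mathcal V(f)=\int\sum_a\eta(a,w)f(a,w)\,dP_W(w),\qquad R(f)=\int\frac1K\sum_a f(a,w)(1-\eta(a,w))\,dP_W(w),$$ so that $R(f)=E[f(A,W)(1-Y)]$ when $A$ is uniform on $[K]$ given $W$; let $g_{\rm ref}\equiv 1/K$. Let $\mathcal F$ be a class of policies and let $f^*\in\mathcal F$ minimize $R$ over $\mathcal F$. Let $c>0$ and $p>0$ with $p\ne1$, $p\neq 2$, and assume that $\log N(r,\mathcal F,\|\cdot\|_\infty)\le c\,r^{-p}$ for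 all $r>0$, where $N$ is the covering number in uniform norm. **Tuning.** For $\epsilon>0$ and $\tau\ge1$ let $L_\tau=\log(\tau(\tau+1)/\epsilon)$, $\delta_\tau=\tau^{-(\frac12\wedge\frac1{2p})}$, $$c_1=\begin{cases}\frac{127\sqrt c}{1-p}&p<1\\1+\frac{127\sqrt c\,2^{(p-1)/2}}{p-1}&p>1\end{cases}\qquad c_1'=\begin{cases}\frac{64\sqrt c}{1-p/2}&p<2\\1+\frac{64\cdot2^{p/2-1}\sqrt c}{p/2-1}&p>2\end{cases}$$ $$v_\tau=2K+\delta_\tau^{-1}\Big\{\frac{c_1'}{\tau^{\frac12\wedge\frac1p}}+\frac{32}{\sqrt\tau}\sqrt{L_\tau}+\frac{16\log2}{\tau}+\frac{16}{\tau}L_\tau\Big\},$$ $$a_\tau=\sqrt{v_\tau}\Big\{\frac{c_1}{\tau^{\frac12\wedge\frac1{2p}}}+\frac{37}{\sqrt\tau}\sqrt{L_\tau}+\frac{3\log2+3L_\tau}{\delta_\tau\tau}\Big\},\qquad b_\tau=2\sqrt{\frac{v_\tau}{\tau}L_\tau}+\frac{2}{\delta_\tau\tau}L_\tau,\qquad x_\tau(\epsilon)=2(a_\tau+b_\tau).$$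 **Generalized Policy Elimination.** Set $\mathcal F_1=\mathcal F$. At each time $t\ge1$, choose (as a function of $O_1,\dots,O_{t-1}$) any $\tilde g_t\in\mathcal F_t$ such that, with $g_t=\delta_tg_{\rm ref}+(1-\delta_t)\tilde g_t$, $$\frac1{t-1}\sum_{\tau=1}^{t-1}\sum_{a\in[K]}\frac{f(a,W_\tau)}{g_t(a,W_\tau)}\le2K\quad\text{for all }f\in\mathcal F_t$$ (no condition if $t=1$); play the design $g_t$; with $\widehat R_t(f)=\frac1t\sum_{\tau=1}^t\frac{g_{\rm ref}(A_\tau,W_\tau)}{g_\tau(A_\tau,W_\tau)}f(A_\tau,W_\tau)(1-Y_\tau)$, set $\mathcal F_{t+1}=\{f\in\mathcal F_t:\widehat R_t(f)\le\inf_{h\in\mathcal F_t}\widehat R_t(h)+x_t(\epsilon)\}$. **Theorem (high probability regret bound for policy elimination).** For every $\epsilon>0$ and every run of the algorithm, with probability at least $1-7\epsilon$, simultaneously for all $t\ge1$, $$\sum_{\tau=1}^t\big(\mathcal V(f^*)-Y_\tau\big)\le B_t(\epsilon):=\sqrt{t\log(1/\epsilon)}+2K\sum_{\tau=1}^tx_\tau(\epsilon)+\sum_{\tau=1}^t\delta_\tau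 .$$ Moreover there is a constant $C$ depending only on $(c,p,K)$ such that, for all $\epsilon\in(0,1/2]$ and all $t\ge1$, $$B_t(\epsilon)\le C\sqrt t\,\big(\log\tfrac t\epsilon\big)^{3/2}\ \text{ if }p\in(0,1),\qquad B_t(\epsilon)\le C\,t^{\frac{p-1/2}{p}}\big(\log\tfrac t\epsilon\big)^{3/2}\ \text{ if }p>1.$$ -/

import Mathlib

open MeasureTheory ProbabilityTheory

noncomputable section

namespace GPE

/-- The context space `[0,1]^d`. -/
abbrev Context (d : ℕ) : Type := Fin d → Set.Icc (0 : ℝ) 1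

/-- Real functions of an action and a context; `f a w` is the number written `f(a, w)` or `f(a | w)`. -/
abbrev ActionFn (d K : ℕ) : Type := Fin K → Context d → ℝ

/-- A policy: a (measurable) map from contexts to probability vectors on the `K` actions. -/
structure IsPolicy {d K : ℕ} (f : ActionFn d K) : Prop where
  measurable : ∀ a, Measurable (f a)
  nonneg : ∀ a w, 0 ≤ f a w
  sum_eq_one : ∀ w, ∑ a, f a w = 1

/-! ### Covering entropy in the uniform norm -/

/-- `s` is a set of centres of closed balls of radius `r` in uniform norm that cover `F`. -/
def IsSupCover {d K : ℕ} (r : ℝ) (F : Set (ActionFn d K)) (s : Finset (ActionFn d K)) : Prop :=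
  ∀ f ∈ F, ∃ h ∈ s, ∀ a w, |f a w - h a w| ≤ r

/-- The covering number `N(r, F, ‖·‖_∞)` (`⊤` if no finite cover exists). -/
def supCoveringNumber {d K : ℕ} (r : ℝ) (F : Set (ActionFn d K)) : ℕ∞ :=
  ⨅ (s : Finset (ActionFn d K)) (_ : IsSupCover r F s), (s.card : ℕ∞)

/-- The entropy condition: `log N(r, F, ‖·‖_∞) ≤ c r^{-p}` for all `r > 0`. -/
def EntropyCondition {d K : ℕ} (c p : ℝ) (F : Set (ActionFn d K)) : Prop :=
  ∀ r : ℝ, 0 < r → supCoveringNumber r F ≠ ⊤ ∧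
    Real.log ((supCoveringNumber r F).toNat : ℝ) ≤ c * r ^ (-p)

/-! ### Value and risk

`PW` is the law of the contexts and `η a w = E[Y | A = a, W = w]`. -/

/-- The value `E[∑_a E[Y | A = a, W] f(a, W)]` of a policy. -/
def value {d K : ℕ} (PW : Measure (Context d)) (η f : ActionFn d K) : ℝ :=
  ∫ w, ∑ a, η a w * f a w ∂PW

/-- The risk `E[f(A, W) (1 - Y)]` of a policy when the action is uniform on the `K` actions
given the context. -/
def risk {d K : ℕ} (PW : Measure (Context d)) (η f : ActionFn d K) : ℝ :=
  ∫ w, ∑ a, (1 / (K : ℝ)) * (f a w * (1 - η a w)) ∂PW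

/-! ### Tuning sequences -/

/-- `δ_τ = τ^{-(1/2 ∧ 1/(2p))}`. -/
def delta (p : ℝ) (τ : ℕ) : ℝ := (τ : ℝ) ^ (-(min (1 / 2) (1 / (2 * p))))

/-- `log (τ (τ + 1) / ε)`. -/
def logTerm (ε : ℝ) (τ : ℕ) : ℝ := Real.log ((τ : ℝ) * ((τ : ℝ) + 1) / ε)

/-- The constant `c₁(c, p)`, for `p ≠ 1`. -/
def c₁ (c p : ℝ) : ℝ :=
  if p < 1 then 127 * √c / (1 - p) else 1 + 127 * √c * 2 ^ ((p - 1) / 2) / (p - 1)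

/-- The constant `c₁'(c, p)`, for `p ≠ 2`. -/
def c₁' (c p : ℝ) : ℝ :=
  if p < 2 then 64 * √c / (1 - p / 2) else 1 + 64 * 2 ^ (p / 2 - 1) * √c / (p / 2 - 1)

/-- `a_τ(ε, δ, v, p)`. -/
def aTerm (c p ε δ v : ℝ) (τ : ℕ) : ℝ :=
  √v * (c₁ c p / (τ : ℝ) ^ (min (1 / 2) (1 / (2 * p)))
    + 37 / √(τ : ℝ) * √(logTerm ε τ)
    + 1 / (δ * (τ : ℝ)) * (3 * Real.log 2 + 3 * logTerm ε τ))

/-- `b_τ(ε, δ, v)`. -/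
def bTerm (ε δ v : ℝ) (τ : ℕ) : ℝ :=
  2 * √(v / (τ : ℝ) * logTerm ε τ) + 2 / (δ * (τ : ℝ)) * logTerm ε τ

/-- `v_τ(ε, δ)`. -/
def vTerm (K : ℕ) (c p ε δ : ℝ) (τ : ℕ) : ℝ :=
  2 * (K : ℝ) + δ⁻¹ * (c₁' c p / (τ : ℝ) ^ (min (1 / 2) (1 / p))
    + 32 / √(τ : ℝ) * √(logTerm ε τ)
    + 16 * Real.log 2 / (τ : ℝ)
    + 16 / (τ : ℝ) * logTerm ε τ)

/-- The elimination threshold `x_τ(ε) = 2 (a_τ + b_τ)`, evaluated at `δ = δ_τ`,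
`v = v_τ(ε, δ_τ)`. -/
def xThreshold (K : ℕ) (c p ε : ℝ) (τ : ℕ) : ℝ :=
  2 * (aTerm c p ε (delta p τ) (vTerm K c p ε (delta p τ) τ) τ
    + bTerm ε (delta p τ) (vTerm K c p ε (delta p τ) τ) τ)

/-- The regret bound
`√(t log (1/ε)) + 2 K ∑_{τ ≤ t} x_τ(ε) + ∑_{τ ≤ t} δ_τ`. -/
def regretBound (K : ℕ) (c p ε : ℝ) (t : ℕ) : ℝ :=
  √((t : ℝ) * Real.log (1 / ε)) + 2 * (K : ℝ) * ∑ τ ∈ Finset.Icc 1 t, xThreshold K c p ε τ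
    + ∑ τ ∈ Finset.Icc 1 t, delta p τ

/-! ### The algorithm

Times are `1, 2, 3, …`; nothing is required of the processes at index `0`. -/

/-- The mixture `δ g_ref + (1 - δ) g̃`, where `g_ref(a, w) = 1 / K`. -/
def mix {d K : ℕ} (δ : ℝ) (gt : ActionFn d K) : ActionFn d K :=
  fun a w => δ * (1 / (K : ℝ)) + (1 - δ) * gt a w

/-- The importance-sampling weighted loss `(g_ref / g)(a, w) f(a, w) (1 - y)`. -/
def isLoss {d K : ℕ} (g f : ActionFn d K) (w : Context d) (a : Fin K) (y : ℝ) : ℝ :=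
  (1 / (K : ℝ)) / g a w * f a w * (1 - y)

/-- The empirical risk `t⁻¹ ∑_{τ ≤ t} ℓ_τ(f)(O_τ)` along the data sequence
`O_τ = (w τ, a τ, y τ)` collected with the designs `g τ`. -/
def empRisk {d K : ℕ} (g : ℕ → ActionFn d K) (w : ℕ → Context d) (a : ℕ → Fin K) (y : ℕ → ℝ)
    (t : ℕ) (f : ActionFn d K) : ℝ :=
  (t : ℝ)⁻¹ * ∑ τ ∈ Finset.Icc 1 t, isLoss (g τ) f (w τ) (a τ) (y τ)

/-- The candidate sets: `F_1 = F`, and `F_{t+1}` is the set of the `f ∈ F_t` whose empirical risk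
`Rhat t f` is at most the minimum of `Rhat t` over `F_t` plus `x t`. (The value at `0` is not
used.) -/
def candidates {d K : ℕ} (F : Set (ActionFn d K)) (x : ℕ → ℝ) (Rhat : ℕ → ActionFn d K → ℝ) :
    ℕ → Set (ActionFn d K)
  | 0 => F
  | 1 => F
  | t + 2 => {f | f ∈ candidates F x Rhat (t + 1) ∧
      ∀ h ∈ candidates F x Rhat (t + 1), Rhat (t + 1) f ≤ Rhat (t + 1) h + x (t + 1)}

/-- The σ-algebra generated by `O_1, …, O_t`, with `O_τ = (W_τ, A_τ, Y_τ)`. -/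
@[reducible] def history {d K : ℕ} {Ω : Type*} (W : ℕ → Ω → Context d) (A : ℕ → Ω → Fin K) (Y : ℕ → Ω → ℝ)
    (t : ℕ) : MeasurableSpace Ω :=
  ⨆ τ ∈ Finset.Icc 1 t, MeasurableSpace.comap (fun ω => (W τ ω, A τ ω, Y τ ω)) inferInstance

/-- The contextual bandit model in which the learner carries out the (random, history-dependent)
design `g t ω` at time `t`: contexts are i.i.d. with law `PW`, the action is drawn from
`g_t(· | W_t)`, and the reward is in `{0, 1}` with conditional mean `η(A_t, W_t)` given the past,
the context and the action. -/
structure IsBandit {d K : ℕ} {Ω : Type*} [MeasurableSpace Ω] (μ : Measure Ω)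
    (PW : Measure (Context d)) (η : ActionFn d K) (g : ℕ → Ω → ActionFn d K)
    (W : ℕ → Ω → Context d) (A : ℕ → Ω → Fin K) (Y : ℕ → Ω → ℝ) : Prop where
  measurable_W : ∀ t, 1 ≤ t → Measurable (W t)
  measurable_A : ∀ t, 1 ≤ t → Measurable (A t)
  measurable_Y : ∀ t, 1 ≤ t → Measurable (Y t)
  binary_Y : ∀ t, 1 ≤ t → ∀ ω, Y t ω = 0 ∨ Y t ω = 1
  law_W : ∀ t, 1 ≤ t → μ.map (W t) = PW
  indep_W : ∀ t, 1 ≤ t →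
    Indep (MeasurableSpace.comap (W t) inferInstance) (history W A Y (t - 1)) μ
  law_A : ∀ t, 1 ≤ t → ∀ a,
    μ[Set.indicator {ω | A t ω = a} (fun _ => (1 : ℝ)) |
        history W A Y (t - 1) ⊔ MeasurableSpace.comap (W t) inferInstance]
      =ᵐ[μ] fun ω => g t ω a (W t ω)
  law_Y : ∀ t, 1 ≤ t →
    μ[Y t | history W A Y (t - 1) ⊔
        MeasurableSpace.comap (fun ω => (W t ω, A t ω)) inferInstance]
      =ᵐ[μ] fun ω => η (A t ω) (W t ω)

/-- A run of Generalized Policy Elimination with inputs `F`, `(δ_t)` and `(x_t)`. At each time `t`,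
`gt t ω` (that is, `g̃_t`) is a member of the candidate set `F_t`, chosen as a function of
`O_1, …, O_{t-1}`, such that `(t-1)⁻¹ ∑_{τ < t} ∑_a f(a, W_τ) / g_t(a, W_τ) ≤ 2 K` for all
`f ∈ F_t`; the design carried out is `g_t = δ_t g_ref + (1 - δ_t) g̃_t`. -/
structure IsGPERun {d K : ℕ} {Ω : Type*} [MeasurableSpace Ω] (μ : Measure Ω)
    (PW : Measure (Context d)) (η : ActionFn d K) (F : Set (ActionFn d K)) (δ x : ℕ → ℝ)
    (gt : ℕ → Ω → ActionFn d K)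
    (W : ℕ → Ω → Context d) (A : ℕ → Ω → Fin K) (Y : ℕ → Ω → ℝ) : Prop where
  bandit : IsBandit μ PW η (fun t ω => mix (δ t) (gt t ω)) W A Y
  measurable_gt : ∀ t, 1 ≤ t → ∀ a,
    Measurable[(history W A Y (t - 1)).prod inferInstance]
      (fun z : Ω × Context d => gt t z.1 a z.2)
  search : ∀ t, 1 ≤ t → ∀ᵐ ω ∂μ,
    let Ft := candidates F x
      (empRisk (fun τ => mix (δ τ) (gt τ ω)) (fun τ => W τ ω) (fun τ => A τ ω)
        (fun τ => Y τ ω)) t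
    gt t ω ∈ Ft ∧ ∀ f ∈ Ft,
      ((t : ℝ) - 1)⁻¹ * ∑ τ ∈ Finset.Icc 1 (t - 1),
        ∑ a, f a (W τ ω) / mix (δ t) (gt t ω) a (W τ ω) ≤ 2 * (K : ℝ)

end GPE

end

open scoped ENNReal

-- Write u = 1/δ_n and L = L_n. The proof combines a uniform bound on the conditional variances, a
-- one-sided uniform deviation bound for the risks, and a deterministic elimination argument.
--
-- Every random fluctuation is handled by one Bernstein inequality, `IsBandit.bernstein`. It comes
-- from an exponential supermartingale whose one-step bound rests on the law of one round,
-- `IsBandit.lintegral_step`.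
--
-- Variance. The search constraint bounds only an empirical mean, over past contexts, of the inverse
-- propensity weight of f under the design. `IsBandit.uniform_invWeight_delta` transfers it to the
-- law of the contexts, simultaneously for all f and all designs built from F. A policy that
-- survives until time n satisfied the constraint at all earlier times, so averaging over the rounds
-- bounds its mean conditional variance by a multiple of `varBound`.
--
-- Deviation. `IsBandit.chaining` bounds n R(f) minus the empirical sum, uniformly in f, along nets
-- that approximate f from below by nonnegative functions. Lowering f to a net point and truncating
-- the importance weights at b only decrease the observed loss, so both cost merely a bias, r₀ + v/b
-- per round. Moreover two net points below f differ by at most f in absolute value, so the variance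
-- of a link is at most its radius times the inverse propensity weight of f, which is exactly the
-- quantity under control. With the best b, and after adding the deviation of the single policy f*,
-- the total stays below (3/2) a_n (`exists_chain_bound`). For p > 1 this also uses the trivial
-- bound R ≤ 1/K whenever a_n is too large for the chain to be useful.
--
-- Elimination. Since (3/2) a_n ≤ (3/4) x_n, the minimizer f* is never eliminated, and every
-- survivor of round n has excess risk at most (7/4) x_n. As V = 1 - K R, round n+1 loses at most
-- δ_{n+1} + (7/4) K x_n in value; round 1 loses at most δ_1 = 1. The gap between 7/4 and the factor
-- 2 of the regret bound pays for the fluctuations of the rewards. The exceptional events at time n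
-- cost 5 exp(-L_n), which sums to at most 5ε over all times.
--
-- Growth. The terms of v_n are O(log(n/ε)), hence x_n = O(δ_n log(n/ε)^{3/2}), and the sum of the
-- δ_t is at most 2 n δ_n, which is the announced power of n.

namespace GPE

/-! ### Conditioning, independence and the law of one round -/

/-- A nonnegative integrable variable may be replaced by its conditional expectation under
a Lebesgue integral against a nonnegative measurable weight. -/
theorem lintegral_mul_ofReal_of_condExp {Ω : Type*} {m m0 : MeasurableSpace Ω} (hm : m ≤ m0)
    {μ : Measure[m0] Ω} [IsFiniteMeasure μ] {X Z : Ω → ℝ} (hX : Integrable X μ)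
    (hX0 : 0 ≤ᵐ[μ] X) (hXZ : μ[X | m] =ᵐ[μ] Z) {ψ : Ω → ℝ≥0∞} (hψ : Measurable[m] ψ) :
    ∫⁻ ω, ENNReal.ofReal (X ω) * ψ ω ∂μ = ∫⁻ ω, ENNReal.ofReal (Z ω) * ψ ω ∂μ := by
  have hZ : ∫⁻ ω, ENNReal.ofReal (Z ω) * ψ ω ∂μ
      = ∫⁻ ω, ENNReal.ofReal ((μ[X | m]) ω) * ψ ω ∂μ :=
    lintegral_congr_ae (by filter_upwards [hXZ] with ω h; rw [h])
  rw [hZ]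
  set C : Ω → ℝ := μ[X | m] with hC
  have hCi : Integrable C μ := integrable_condExp
  have hC0 : 0 ≤ᵐ[μ] C := condExp_nonneg hX0
  -- The densities X and E[X | m] define the same measure on `m`; this is the defining property of
  -- conditional expectation, and it lets ψ be integrated without any integrability of the product.
  have hν : (μ.withDensity fun ω => ENNReal.ofReal (X ω)).trim hm
      = (μ.withDensity fun ω => ENNReal.ofReal (C ω)).trim hm := by
    refine @Measure.ext _ m _ _ fun s hs => ?_
    rw [trim_measurableSet_eq hm hs, trim_measurableSet_eq hm hs, withDensity_apply _ (hm s hs),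
      withDensity_apply _ (hm s hs),
      ← ofReal_integral_eq_lintegral_ofReal hX.integrableOn (ae_restrict_of_ae hX0),
      ← ofReal_integral_eq_lintegral_ofReal hCi.integrableOn (ae_restrict_of_ae hC0),
      hC, setIntegral_condExp hm hX hs]
  have key : ∀ V : Ω → ℝ, Integrable V μ → ∫⁻ ω, ENNReal.ofReal (V ω) * ψ ω ∂μ
      = ∫⁻ ω, ψ ω ∂((μ.withDensity fun ω => ENNReal.ofReal (V ω)).trim hm) := by
    intro V hV
    rw [lintegral_trim hm hψ,
      lintegral_withDensity_eq_lintegral_mul₀ hV.aemeasurable.ennreal_ofReal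
        (hψ.mono hm le_rfl).aemeasurable]
    rfl
  rw [key X hX, key C hCi, hν]

/-- Fubini's theorem for independent random variables. -/
theorem lintegral_comp_prodMk_of_indepFun {Ω E F : Type*} {mΩ : MeasurableSpace Ω}
    {mE : MeasurableSpace E} {mF : MeasurableSpace F} {μ : Measure Ω} [IsFiniteMeasure μ]
    {X : Ω → E} {V : Ω → F} (hX : Measurable X) (hV : Measurable V) (h : IndepFun X V μ)
    {Ψ : E × F → ℝ≥0∞} (hΨ : Measurable Ψ) :
    ∫⁻ ω, Ψ (X ω, V ω) ∂μ = ∫⁻ ω, ∫⁻ v, Ψ (X ω, v) ∂(μ.map V) ∂μ := by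
  have h1 : μ.map (fun ω => (X ω, V ω)) = (μ.map X).prod (μ.map V) :=
    (indepFun_iff_map_prod_eq_prod_map_map hX.aemeasurable hV.aemeasurable).1 h
  calc ∫⁻ ω, Ψ (X ω, V ω) ∂μ = ∫⁻ z, Ψ z ∂(μ.map (fun ω => (X ω, V ω))) :=
        (lintegral_map hΨ (hX.prodMk hV)).symm
    _ = ∫⁻ x, ∫⁻ v, Ψ (x, v) ∂(μ.map V) ∂(μ.map X) := by
        rw [h1, lintegral_prod _ hΨ.aemeasurable]
    _ = _ := lintegral_map (hΨ.lintegral_prod_right') hX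

/-- The past is represented by the identity map from Ω to Ω equipped with the smaller σ-algebra `m`.
Independence of V from `m` then becomes independence of two random variables, and Fubini freezes the
past while V is integrated out. -/
theorem lintegral_comp_of_indep {Ω F : Type*} {m m0 : MeasurableSpace Ω}
    {mF : MeasurableSpace F} (hm : m ≤ m0) {μ : Measure[m0] Ω} [IsFiniteMeasure μ]
    {V : Ω → F} (hV : Measurable[m0] V)
    (h : Indep (MeasurableSpace.comap V mF) m μ)
    {Ψ : Ω × F → ℝ≥0∞} (hΨ : Measurable[m.prod mF] Ψ) :
    ∫⁻ ω, Ψ (ω, V ω) ∂μ = ∫⁻ ω, ∫⁻ v, Ψ (ω, v) ∂(μ.map V) ∂μ := by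
  refine @lintegral_comp_prodMk_of_indepFun Ω Ω F m0 m mF μ _ id V (measurable_id'' hm) hV ?_ Ψ hΨ
  refine (@IndepFun_iff_Indep Ω Ω F m0 m mF id V μ).2 ?_
  have : MeasurableSpace.comap (id : Ω → Ω) m = m := MeasurableSpace.comap_id
  rw [this]
  exact h.symm

section History

variable {d K : ℕ} {Ω : Type*} {W : ℕ → Ω → Context d} {A : ℕ → Ω → Fin K} {Y : ℕ → Ω → ℝ}

theorem history_mono {s t : ℕ} (h : s ≤ t) : history W A Y s ≤ history W A Y t :=
  biSup_mono fun τ hτ => by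
    simp only [Finset.mem_Icc] at hτ ⊢
    omega

theorem measurable_obs_history {τ t : ℕ} (h1 : 1 ≤ τ) (h2 : τ ≤ t) :
    Measurable[history W A Y t] fun ω => (W τ ω, A τ ω, Y τ ω) := by
  have h : MeasurableSpace.comap (fun ω => (W τ ω, A τ ω, Y τ ω)) inferInstance
      ≤ history W A Y t :=
    le_biSup (fun τ => MeasurableSpace.comap (fun ω => (W τ ω, A τ ω, Y τ ω)) inferInstance)
      (Finset.mem_Icc.2 ⟨h1, h2⟩)
  exact (comap_measurable _).mono h le_rfl

/-- The σ-algebra generated by `O_1, …, O_{t-1}` and `W_t`. -/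
@[reducible] def historyContext (W : ℕ → Ω → Context d) (A : ℕ → Ω → Fin K) (Y : ℕ → Ω → ℝ)
    (t : ℕ) : MeasurableSpace Ω :=
  history W A Y (t - 1) ⊔ MeasurableSpace.comap (W t) inferInstance

/-- The σ-algebra generated by `O_1, …, O_{t-1}`, `W_t` and `A_t`. -/
@[reducible] def historyAction (W : ℕ → Ω → Context d) (A : ℕ → Ω → Fin K) (Y : ℕ → Ω → ℝ)
    (t : ℕ) : MeasurableSpace Ω :=
  history W A Y (t - 1) ⊔ MeasurableSpace.comap (fun ω => (W t ω, A t ω)) inferInstance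

variable [mΩ : MeasurableSpace Ω] {μ : Measure Ω} {PW : Measure (Context d)}
  {η : ActionFn d K} {g : ℕ → Ω → ActionFn d K}

theorem IsBandit.history_le (hB : IsBandit μ PW η g W A Y) (t : ℕ) : history W A Y t ≤ mΩ := by
  refine iSup₂_le fun τ hτ => ?_
  have h1 := (Finset.mem_Icc.1 hτ).1
  exact ((hB.measurable_W τ h1).prodMk ((hB.measurable_A τ h1).prodMk
    (hB.measurable_Y τ h1))).comap_le

/-- The law of `(O_1, …, O_{t-1}, W_t, A_t, Y_t)`, tested on nonnegative functions. -/
theorem IsBandit.lintegral_step [IsProbabilityMeasure μ] (hB : IsBandit μ PW η g W A Y)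
    (hη : ∀ a, Measurable (η a)) {t : ℕ} (ht : 1 ≤ t)
    (hg : ∀ a, Measurable[(history W A Y (t - 1)).prod inferInstance]
      (fun z : Ω × Context d => g t z.1 a z.2))
    {Φ : Fin K → ℝ → Ω × Context d → ℝ≥0∞}
    (hΦ : ∀ a y, Measurable[(history W A Y (t - 1)).prod inferInstance] (Φ a y)) :
    ∫⁻ ω, Φ (A t ω) (Y t ω) (ω, W t ω) ∂μ
      = ∫⁻ ω, ∫⁻ w, ∑ a, ENNReal.ofReal (g t ω a w) * (ENNReal.ofReal (η a w) * Φ a 1 (ω, w)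
          + ENNReal.ofReal (1 - η a w) * Φ a 0 (ω, w)) ∂PW ∂μ := by
  classical
  have hHle : history W A Y (t - 1) ≤ mΩ := hB.history_le _
  have hW := hB.measurable_W t ht
  have hA := hB.measurable_A t ht
  have hY := hB.measurable_Y t ht
  have hm1le : (historyContext W A Y t) ≤ mΩ := sup_le hHle hW.comap_le
  have hm2le : (historyAction W A Y t) ≤ mΩ := sup_le hHle (hW.prodMk hA).comap_le
  have hWA2 : Measurable[historyAction W A Y t] fun ω => (W t ω, A t ω) :=
    (comap_measurable _).mono le_sup_right le_rfl
  have hW1 : Measurable[(historyContext W A Y t)] (W t) := (comap_measurable _).mono le_sup_right le_rfl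
  have hpair1 : Measurable[(historyContext W A Y t), (history W A Y (t - 1)).prod inferInstance] fun ω => (ω, W t ω) :=
    @Measurable.prodMk _ (historyContext W A Y t) _ _ (history W A Y (t - 1)) _ _ _ (measurable_id'' le_sup_left) hW1
  have hpair2 : Measurable[(historyAction W A Y t), (history W A Y (t - 1)).prod inferInstance] fun ω => (ω, W t ω) :=
    @Measurable.prodMk _ (historyAction W A Y t) _ _ (history W A Y (t - 1)) _ _ _ (measurable_id'' le_sup_left)
      (measurable_fst.comp hWA2)
  have hA2 : ∀ a, MeasurableSet[(historyAction W A Y t)] {ω | A t ω = a} := fun a =>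
    (measurable_snd.comp hWA2) (measurableSet_singleton a)
  have hAm : ∀ a, MeasurableSet {ω | A t ω = a} := fun a => hm2le _ (hA2 a)
  have hYint : Integrable (Y t) μ := by
    refine Integrable.of_bound hY.aestronglyMeasurable 1 (Filter.Eventually.of_forall fun ω => ?_)
    rcases hB.binary_Y t ht ω with h | h <;> simp [h]
  -- expansion over the values of the action and the reward
  have e1 : ∀ ω, Φ (A t ω) (Y t ω) (ω, W t ω)
      = ∑ a, (ENNReal.ofReal (Y t ω) * ({ω | A t ω = a}.indicator (fun ω => Φ a 1 (ω, W t ω)) ω)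
        + ENNReal.ofReal (1 - Y t ω)
          * ({ω | A t ω = a}.indicator (fun ω => Φ a 0 (ω, W t ω)) ω)) := by
    intro ω
    rw [Finset.sum_eq_single (A t ω)]
    · rcases hB.binary_Y t ht ω with h | h <;> simp [h]
    · intro b _ hb
      simp [Ne.symm hb]
    · simp
  have hmeas : ∀ a y, Measurable[historyAction W A Y t] ({ω | A t ω = a}.indicator (fun ω => Φ a y (ω, W t ω))) :=
    fun a y => Measurable.indicator ((hΦ a y).comp hpair2) (hA2 a)
  -- integrating out the reward
  have e2 : ∀ a, ∫⁻ ω, ENNReal.ofReal (Y t ω)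
        * ({ω | A t ω = a}.indicator (fun ω => Φ a 1 (ω, W t ω)) ω) ∂μ
      = ∫⁻ ω, ENNReal.ofReal ({ω | A t ω = a}.indicator (fun _ => (1 : ℝ)) ω)
        * (ENNReal.ofReal (η a (W t ω)) * Φ a 1 (ω, W t ω)) ∂μ := by
    intro a
    rw [lintegral_mul_ofReal_of_condExp hm2le hYint (Filter.Eventually.of_forall fun ω => by
      rcases hB.binary_Y t ht ω with h | h <;> simp [h]) (hB.law_Y t ht) (hmeas a 1)]
    refine lintegral_congr fun ω => ?_
    by_cases h : A t ω = a <;> simp [h]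
  have hlaw0 : μ[fun ω => 1 - Y t ω | (historyAction W A Y t)] =ᵐ[μ] fun ω => 1 - η (A t ω) (W t ω) := by
    have h1 : μ[fun ω => 1 - Y t ω | (historyAction W A Y t)] =ᵐ[μ] μ[fun _ => (1 : ℝ) | (historyAction W A Y t)] - μ[Y t | (historyAction W A Y t)] :=
      condExp_sub (integrable_const _) hYint (historyAction W A Y t)
    rw [condExp_const hm2le] at h1
    filter_upwards [h1, hB.law_Y t ht] with ω h1 h2
    rw [h1, Pi.sub_apply, h2]
  have e3 : ∀ a, ∫⁻ ω, ENNReal.ofReal (1 - Y t ω)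
        * ({ω | A t ω = a}.indicator (fun ω => Φ a 0 (ω, W t ω)) ω) ∂μ
      = ∫⁻ ω, ENNReal.ofReal ({ω | A t ω = a}.indicator (fun _ => (1 : ℝ)) ω)
        * (ENNReal.ofReal (1 - η a (W t ω)) * Φ a 0 (ω, W t ω)) ∂μ := by
    intro a
    rw [lintegral_mul_ofReal_of_condExp hm2le (X := fun ω => 1 - Y t ω)
      ((integrable_const _).sub hYint) (Filter.Eventually.of_forall fun ω => by
        rcases hB.binary_Y t ht ω with h | h <;> simp [h]) hlaw0 (hmeas a 0)]
    refine lintegral_congr fun ω => ?_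
    by_cases h : A t ω = a <;> simp [h]
  -- integrating out the action
  have hΨm : ∀ a y, Measurable[(history W A Y (t - 1)).prod inferInstance] fun z : Ω × Context d =>
      ENNReal.ofReal (y * η a z.2 + (1 - y) * (1 - η a z.2)) * Φ a y z := by
    intro a y
    refine Measurable.mul ?_ (hΦ a y)
    have : Measurable fun w : Context d => ENNReal.ofReal (y * η a w + (1 - y) * (1 - η a w)) :=
      (((hη a).const_mul y).add ((measurable_const.sub (hη a)).const_mul (1 - y))).ennreal_ofReal
    exact this.comp (@measurable_snd Ω (Context d) (history W A Y (t - 1)) _)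
  have hΨ1 : ∀ a, Measurable[(history W A Y (t - 1)).prod inferInstance] fun z : Ω × Context d =>
      ENNReal.ofReal (η a z.2) * Φ a 1 z := by
    intro a; simpa using hΨm a 1
  have hΨ0 : ∀ a, Measurable[(history W A Y (t - 1)).prod inferInstance] fun z : Ω × Context d =>
      ENNReal.ofReal (1 - η a z.2) * Φ a 0 z := by
    intro a; simpa using hΨm a 0
  have e4 : ∀ a (Ψ : Ω × Context d → ℝ≥0∞), Measurable[(history W A Y (t - 1)).prod inferInstance] Ψ →
      ∫⁻ ω, ENNReal.ofReal ({ω | A t ω = a}.indicator (fun _ => (1 : ℝ)) ω) * Ψ (ω, W t ω) ∂μ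
      = ∫⁻ ω, ENNReal.ofReal (g t ω a (W t ω)) * Ψ (ω, W t ω) ∂μ := by
    intro a Ψ hΨ
    exact lintegral_mul_ofReal_of_condExp hm1le ((integrable_const _).indicator (hAm a))
      (Filter.Eventually.of_forall fun ω => Set.indicator_nonneg (fun _ _ => zero_le_one) ω)
      (hB.law_A t ht a) (hΨ.comp hpair1)
  have hle2 : ∀ {β : Type _} [MeasurableSpace β] {f : Ω → β}, Measurable[historyAction W A Y t] f → Measurable f :=
    fun h => h.mono hm2le le_rfl
  have hle1 : ∀ {Ψ : Ω × Context d → ℝ≥0∞}, Measurable[(history W A Y (t - 1)).prod inferInstance] Ψ →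
      Measurable fun ω => Ψ (ω, W t ω) := fun h => (h.comp hpair1).mono hm1le le_rfl
  have hgΨ : ∀ a (Ψ : Ω × Context d → ℝ≥0∞), Measurable[(history W A Y (t - 1)).prod inferInstance] Ψ →
      Measurable[(history W A Y (t - 1)).prod inferInstance] fun z => ENNReal.ofReal (g t z.1 a z.2) * Ψ z :=
    fun a Ψ hΨ => (hg a).ennreal_ofReal.mul hΨ
  have e5 : ∫⁻ ω, Φ (A t ω) (Y t ω) (ω, W t ω) ∂μ
      = ∫⁻ ω, ∑ a, ENNReal.ofReal (g t ω a (W t ω))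
          * (ENNReal.ofReal (η a (W t ω)) * Φ a 1 (ω, W t ω)
          + ENNReal.ofReal (1 - η a (W t ω)) * Φ a 0 (ω, W t ω)) ∂μ := by
    simp_rw [e1]
    have hmY : ∀ a, Measurable fun ω => ENNReal.ofReal (Y t ω)
        * ({ω | A t ω = a}.indicator (fun ω => Φ a 1 (ω, W t ω)) ω) :=
      fun a => hY.ennreal_ofReal.mul (hle2 (hmeas a 1))
    have hmY0 : ∀ a, Measurable fun ω => ENNReal.ofReal (1 - Y t ω)
        * ({ω | A t ω = a}.indicator (fun ω => Φ a 0 (ω, W t ω)) ω) :=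
      fun a => (measurable_const.sub hY).ennreal_ofReal.mul (hle2 (hmeas a 0))
    have hmS : ∀ a, Measurable fun ω => ENNReal.ofReal (g t ω a (W t ω))
        * (ENNReal.ofReal (η a (W t ω)) * Φ a 1 (ω, W t ω)
          + ENNReal.ofReal (1 - η a (W t ω)) * Φ a 0 (ω, W t ω)) :=
      fun a => hle1 (hgΨ a _ ((hΨ1 a).add (hΨ0 a)))
    rw [lintegral_finsetSum, lintegral_finsetSum _ fun a _ => hmS a]
    swap
    · exact fun a _ => (hmY a).add (hmY0 a)
    refine Finset.sum_congr rfl fun a _ => ?_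
    rw [lintegral_add_left (hmY a), e2, e3, e4 a _ (hΨ1 a), e4 a _ (hΨ0 a),
      ← lintegral_add_left (hle1 (hgΨ a _ (hΨ1 a)))]
    simp_rw [mul_add]
  rw [e5]
  have := lintegral_comp_of_indep hHle hW (hB.indep_W t ht)
    (Ψ := fun z => ∑ a, ENNReal.ofReal (g t z.1 a z.2)
          * (ENNReal.ofReal (η a z.2) * Φ a 1 z
          + ENNReal.ofReal (1 - η a z.2) * Φ a 0 z))
    (Finset.measurable_sum _ fun a _ => hgΨ a _ ((hΨ1 a).add (hΨ0 a)))
  rw [hB.law_W t ht] at this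
  exact this

end History

/-- The mean of `φ(A, Y, W)` when `W ∼ PW`, `A ∼ g(· | W)` and `Y` is binary with mean
`η(A, W)`. -/
noncomputable def obsMean {d K : ℕ} (PW : Measure (Context d)) (η g : ActionFn d K)
    (φ : Fin K → ℝ → Context d → ℝ) : ℝ :=
  ∫ w, ∑ a, g a w * (η a w * φ a 1 w + (1 - η a w) * φ a 0 w) ∂PW

/-! ### One-step means and the one-step exponential inequality -/

section ObsMean

variable {d K : ℕ} {PW : Measure (Context d)} {η g : ActionFn d K}
  {φ ψ : Fin K → ℝ → Context d → ℝ} {C D : ℝ}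

theorem IsPolicy.abs_sum_le {f : ActionFn d K} (hf : IsPolicy f) {w : Context d} {h : Fin K → ℝ}
    (h1 : ∀ a, |h a| ≤ C) : |∑ a, f a w * h a| ≤ C := by
  calc |∑ a, f a w * h a| ≤ ∑ a, |f a w * h a| := Finset.abs_sum_le_sum_abs _ _
    _ ≤ ∑ a, f a w * C := Finset.sum_le_sum fun a _ => by
        rw [abs_mul, abs_of_nonneg (hf.nonneg a w)]
        exact mul_le_mul_of_nonneg_left (h1 a) (hf.nonneg a w)
    _ = C := by rw [← Finset.sum_mul, hf.sum_eq_one, one_mul]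

theorem abs_reward_mean_le {e x y : ℝ} (he : 0 ≤ e ∧ e ≤ 1) (hx : |x| ≤ C) (hy : |y| ≤ C) :
    |e * x + (1 - e) * y| ≤ C := by
  rw [abs_le] at *
  constructor <;> nlinarith [he.1, he.2, hx.1, hx.2, hy.1, hy.2]

theorem measurable_obsMean_integrand (hη : ∀ a, Measurable (η a)) (hg : ∀ a, Measurable (g a))
    (hφ : ∀ a y, Measurable (φ a y)) :
    Measurable fun w => ∑ a, g a w * (η a w * φ a 1 w + (1 - η a w) * φ a 0 w) :=
  Finset.measurable_sum _ fun a _ => (hg a).mul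
    (((hη a).mul (hφ a 1)).add ((measurable_const.sub (hη a)).mul (hφ a 0)))

theorem integrable_obsMean [IsFiniteMeasure PW] (hη : ∀ a, Measurable (η a))
    (hη01 : ∀ a w, 0 ≤ η a w ∧ η a w ≤ 1) (hg : IsPolicy g)
    (hφ : ∀ a y, Measurable (φ a y)) (hC : ∀ a y w, y = 0 ∨ y = 1 → |φ a y w| ≤ C) :
    Integrable (fun w => ∑ a, g a w * (η a w * φ a 1 w + (1 - η a w) * φ a 0 w)) PW :=
  Integrable.of_bound
    (measurable_obsMean_integrand hη hg.measurable hφ).aestronglyMeasurable C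
    (Filter.Eventually.of_forall fun w => hg.abs_sum_le fun a =>
      abs_reward_mean_le (hη01 a w) (hC a 1 w (Or.inr rfl)) (hC a 0 w (Or.inl rfl)))

/-- Integrating the quadratic bound on exp(-lφ) gives E exp(-lφ) ≤ 1 - l m + κ l² q ≤ exp(-(l m - κ
l² q)), with m and q the means of φ and φ². The constant κ is left free because 1/2 suffices when φ
≥ 0, whereas 1 serves for signed φ with |lφ| ≤ 1. -/
theorem lintegral_exp_obs_le_one [IsProbabilityMeasure PW] (hη : ∀ a, Measurable (η a))
    (hη01 : ∀ a w, 0 ≤ η a w ∧ η a w ≤ 1) (hg : IsPolicy g)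
    (hφ : ∀ a y, Measurable (φ a y)) (hC : ∀ a y w, y = 0 ∨ y = 1 → |φ a y w| ≤ C) {l κ : ℝ}
    (hexp : ∀ a y w, y = 0 ∨ y = 1 →
      Real.exp (-(l * φ a y w)) ≤ 1 - l * φ a y w + κ * l ^ 2 * φ a y w ^ 2) :
    ∫⁻ w, ∑ a, ENNReal.ofReal (g a w) * (ENNReal.ofReal (η a w) * ENNReal.ofReal
        (Real.exp (l * (obsMean PW η g φ - φ a 1 w)
          - κ * l ^ 2 * obsMean PW η g (fun a y w => φ a y w ^ 2)))
      + ENNReal.ofReal (1 - η a w) * ENNReal.ofReal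
        (Real.exp (l * (obsMean PW η g φ - φ a 0 w)
          - κ * l ^ 2 * obsMean PW η g (fun a y w => φ a y w ^ 2)))) ∂PW ≤ 1 := by
  set m := obsMean PW η g φ with hm
  set q := obsMean PW η g (fun a y w => φ a y w ^ 2) with hq
  set E := Real.exp (l * m - κ * l ^ 2 * q) with hE
  have hEpos : 0 < E := Real.exp_pos _
  have hφ2 : ∀ a y, Measurable (fun w => φ a y w ^ 2) := fun a y => (hφ a y).pow_const 2
  have hC2 : ∀ a y w, y = 0 ∨ y = 1 → |φ a y w ^ 2| ≤ C ^ 2 := fun a y w hy => by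
    rw [abs_pow]
    exact pow_le_pow_left₀ (abs_nonneg _) (hC a y w hy) 2
  have hi1 := integrable_obsMean (PW := PW) hη hη01 hg hφ hC
  have hi2 := integrable_obsMean (PW := PW) (φ := fun a y w => φ a y w ^ 2) hη hη01 hg hφ2 hC2
  set F : Context d → ℝ := fun w =>
    E * (1 - l * (∑ a, g a w * (η a w * φ a 1 w + (1 - η a w) * φ a 0 w))
      + κ * l ^ 2 * ∑ a, g a w * (η a w * φ a 1 w ^ 2 + (1 - η a w) * φ a 0 w ^ 2)) with hF
  have hFi : Integrable F PW :=
    (((integrable_const (1 : ℝ)).sub (hi1.const_mul l)).add (hi2.const_mul _)).const_mul E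
  have hsplit : ∀ x, Real.exp (l * (m - x) - κ * l ^ 2 * q) = E * Real.exp (-(l * x)) := by
    intro x
    rw [hE, ← Real.exp_add]
    ring_nf
  have hpt : ∀ w, ∑ a, ENNReal.ofReal (g a w) * (ENNReal.ofReal (η a w) * ENNReal.ofReal
        (Real.exp (l * (m - φ a 1 w) - κ * l ^ 2 * q))
      + ENNReal.ofReal (1 - η a w) * ENNReal.ofReal
        (Real.exp (l * (m - φ a 0 w) - κ * l ^ 2 * q)))
      = ENNReal.ofReal (∑ a, g a w * (η a w * (E * Real.exp (-(l * φ a 1 w)))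
        + (1 - η a w) * (E * Real.exp (-(l * φ a 0 w))))) := by
    intro w
    have h1 : ∀ a, 0 ≤ η a w * (E * Real.exp (-(l * φ a 1 w))) := fun a =>
      mul_nonneg (hη01 a w).1 (by positivity)
    have h0 : ∀ a, 0 ≤ (1 - η a w) * (E * Real.exp (-(l * φ a 0 w))) := fun a =>
      mul_nonneg (sub_nonneg.2 (hη01 a w).2) (by positivity)
    rw [ENNReal.ofReal_sum_of_nonneg fun a _ =>
      mul_nonneg (hg.nonneg a w) (add_nonneg (h1 a) (h0 a))]
    refine Finset.sum_congr rfl fun a _ => ?_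
    rw [ENNReal.ofReal_mul (hg.nonneg a w), ENNReal.ofReal_add (h1 a) (h0 a),
      ENNReal.ofReal_mul (hη01 a w).1, ENNReal.ofReal_mul (sub_nonneg.2 (hη01 a w).2),
      hsplit, hsplit]
  have hle : ∀ w, ∑ a, g a w * (η a w * (E * Real.exp (-(l * φ a 1 w)))
        + (1 - η a w) * (E * Real.exp (-(l * φ a 0 w)))) ≤ F w := by
    intro w
    have : F w = ∑ a, g a w * (η a w * (E * (1 - l * φ a 1 w + κ * l ^ 2 * φ a 1 w ^ 2))
        + (1 - η a w) * (E * (1 - l * φ a 0 w + κ * l ^ 2 * φ a 0 w ^ 2))) := by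
      have hone : (1 : ℝ) = ∑ a, g a w := (hg.sum_eq_one w).symm
      simp only [hF]
      rw [show (1 : ℝ) - l * (∑ a, g a w * (η a w * φ a 1 w + (1 - η a w) * φ a 0 w))
        = (∑ a, g a w) - l * (∑ a, g a w * (η a w * φ a 1 w + (1 - η a w) * φ a 0 w)) by
          rw [← hone], Finset.mul_sum, Finset.mul_sum, ← Finset.sum_sub_distrib,
        ← Finset.sum_add_distrib, Finset.mul_sum]
      exact Finset.sum_congr rfl fun a _ => by ring
    rw [this]
    refine Finset.sum_le_sum fun a _ => mul_le_mul_of_nonneg_left ?_ (hg.nonneg a w)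
    exact add_le_add
      (mul_le_mul_of_nonneg_left (mul_le_mul_of_nonneg_left (hexp a 1 w (Or.inr rfl)) hEpos.le)
        (hη01 a w).1)
      (mul_le_mul_of_nonneg_left (mul_le_mul_of_nonneg_left (hexp a 0 w (Or.inl rfl)) hEpos.le)
        (sub_nonneg.2 (hη01 a w).2))
  have hF0 : ∀ w, 0 ≤ F w := fun w => le_trans (Finset.sum_nonneg fun a _ =>
    mul_nonneg (hg.nonneg a w) (add_nonneg (mul_nonneg (hη01 a w).1 (by positivity))
      (mul_nonneg (sub_nonneg.2 (hη01 a w).2) (by positivity)))) (hle w)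
  calc _ = ∫⁻ w, ENNReal.ofReal (∑ a, g a w * (η a w * (E * Real.exp (-(l * φ a 1 w)))
        + (1 - η a w) * (E * Real.exp (-(l * φ a 0 w))))) ∂PW := lintegral_congr hpt
    _ ≤ ∫⁻ w, ENNReal.ofReal (F w) ∂PW :=
        lintegral_mono fun w => ENNReal.ofReal_le_ofReal (hle w)
    _ = ENNReal.ofReal (∫ w, F w ∂PW) :=
        (ofReal_integral_eq_lintegral_ofReal hFi (Filter.Eventually.of_forall hF0)).symm
    _ ≤ 1 := by
        rw [ENNReal.ofReal_le_one]
        have : ∫ w, F w ∂PW = E * (1 - l * m + κ * l ^ 2 * q) := by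
          simp only [hF]
          rw [integral_const_mul, integral_add, integral_sub, integral_const_mul,
            integral_const_mul]
          · simp [hm, hq, obsMean]
          · exact integrable_const _
          · exact hi1.const_mul l
          · exact (integrable_const _).sub (hi1.const_mul l)
          · exact hi2.const_mul _
        rw [this]
        have h1 := Real.add_one_le_exp (-(l * m - κ * l ^ 2 * q))
        calc E * (1 - l * m + κ * l ^ 2 * q) ≤ E * Real.exp (-(l * m - κ * l ^ 2 * q)) :=
              mul_le_mul_of_nonneg_left (by linarith) hEpos.le
          _ = 1 := by rw [hE, ← Real.exp_add]; simp

end ObsMean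

/-! ### Exponential supermartingales and Bernstein's inequality along a run -/

section Bernstein

variable {d K : ℕ} {Ω : Type*} {W : ℕ → Ω → Context d} {A : ℕ → Ω → Fin K} {Y : ℕ → Ω → ℝ}

theorem measurable_obsMean {m : MeasurableSpace Ω} {PW : Measure (Context d)} [SFinite PW]
    {η : ActionFn d K} (hη : ∀ a, Measurable (η a)) {g : Ω → ActionFn d K}
    (hg : ∀ a, Measurable fun z : Ω × Context d => g z.1 a z.2)
    {φ : Ω → Fin K → ℝ → Context d → ℝ}
    (hφ : ∀ a y, Measurable fun z : Ω × Context d => φ z.1 a y z.2) :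
    Measurable fun ω => obsMean PW η (g ω) (φ ω) := by
  have hη' : ∀ a, Measurable fun z : Ω × Context d => η a z.2 :=
    fun a => (hη a).comp measurable_snd
  have : Measurable fun z : Ω × Context d =>
      ∑ a, g z.1 a z.2 * (η a z.2 * φ z.1 a 1 z.2 + (1 - η a z.2) * φ z.1 a 0 z.2) :=
    Finset.measurable_sum _ fun a _ => (hg a).mul
      (((hη' a).mul (hφ a 1)).add ((measurable_const.sub (hη' a)).mul (hφ a 0)))
  exact this.stronglyMeasurable.integral_prod_right'.measurable

/-- Joint measurability is assumed only for each fixed action and reward; since both take finitely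
many values, the composite is a finite sum over them. -/
theorem measurable_apply_obs {m : MeasurableSpace Ω} {V : Ω → Context d} {B : Ω → Fin K}
    {Z : Ω → ℝ} (hV : Measurable V) (hB : Measurable B) (hZ : Measurable Z)
    (hZ01 : ∀ ω, Z ω = 0 ∨ Z ω = 1) {φ : Ω → Fin K → ℝ → Context d → ℝ}
    (hφ : ∀ a y, Measurable fun z : Ω × Context d => φ z.1 a y z.2) :
    Measurable fun ω => φ ω (B ω) (Z ω) (V ω) := by
  classical
  have h : (fun ω => φ ω (B ω) (Z ω) (V ω)) = fun ω =>
      ∑ a, {ω | B ω = a}.indicator (fun ω => Z ω * φ ω a 1 (V ω) + (1 - Z ω) * φ ω a 0 (V ω)) ω := by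
    funext ω
    rw [Finset.sum_eq_single (B ω)]
    · rcases hZ01 ω with h | h <;> simp [h]
    · intro b _ hb
      simp [Ne.symm hb]
    · simp
  rw [h]
  have h2 : ∀ a y, Measurable fun ω => φ ω a y (V ω) :=
    fun a y => (hφ a y).comp (measurable_id.prodMk hV)
  exact Finset.measurable_sum _ fun a _ => ((hZ.mul (h2 a 1)).add
    ((measurable_const.sub hZ).mul (h2 a 0))).indicator (hB (measurableSet_singleton a))

variable [mΩ : MeasurableSpace Ω] {μ : Measure Ω} {PW : Measure (Context d)}
  {η : ActionFn d K} {g : ℕ → Ω → ActionFn d K}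

/-- This is the expectation bound for a nonnegative supermartingale started at 1. The
supermartingale property is expressed by testing against past-measurable weights ψ, here the product
of the earlier factors, so no conditional expectation is needed. -/
theorem lintegral_prod_le_one_of_step [IsProbabilityMeasure μ]
    {D : ℕ → Ω → ℝ≥0∞} {n : ℕ}
    (hD : ∀ t, 1 ≤ t → t ≤ n → Measurable[history W A Y t] (D t))
    (hstep : ∀ t, 1 ≤ t → t ≤ n → ∀ ψ : Ω → ℝ≥0∞, Measurable[history W A Y (t - 1)] ψ →
      ∫⁻ ω, ψ ω * D t ω ∂μ ≤ ∫⁻ ω, ψ ω ∂μ) :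
    ∫⁻ ω, ∏ τ ∈ Finset.Icc 1 n, D τ ω ∂μ ≤ 1 := by
  have key : ∀ t, t ≤ n → Measurable[history W A Y t] (fun ω => ∏ τ ∈ Finset.Icc 1 t, D τ ω) ∧
      ∫⁻ ω, ∏ τ ∈ Finset.Icc 1 t, D τ ω ∂μ ≤ 1 := by
    intro t
    induction t with
    | zero => intro _; simp
    | succ t ih =>
      intro ht
      obtain ⟨h1, h2⟩ := ih (by omega)
      have h3 : ∀ ω, ∏ τ ∈ Finset.Icc 1 (t + 1), D τ ω
          = (∏ τ ∈ Finset.Icc 1 t, D τ ω) * D (t + 1) ω := fun ω =>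
        Finset.prod_Icc_succ_top (by omega) _
      simp_rw [h3]
      refine ⟨(h1.mono (history_mono (Nat.le_succ t)) le_rfl).mul (hD _ (by omega) ht), ?_⟩
      exact (hstep (t + 1) (by omega) ht _ (by simpa using h1)).trans h2
  exact (key n le_rfl).2

/-- Bernstein's inequality for sums along a bandit run. -/
theorem IsBandit.bernstein [IsProbabilityMeasure μ] [IsProbabilityMeasure PW]
    (hB : IsBandit μ PW η g W A Y)
    (hη : ∀ a, Measurable (η a)) (hη01 : ∀ a w, 0 ≤ η a w ∧ η a w ≤ 1)
    (hg : ∀ t, 1 ≤ t → ∀ a, Measurable[(history W A Y (t - 1)).prod inferInstance]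
      (fun z : Ω × Context d => g t z.1 a z.2))
    (hgp : ∀ t, 1 ≤ t → ∀ᵐ ω ∂μ, IsPolicy (g t ω)) (n : ℕ)
    {φ : ℕ → Ω → Fin K → ℝ → Context d → ℝ}
    (hφ : ∀ t, 1 ≤ t → ∀ a y, Measurable[(history W A Y (t - 1)).prod inferInstance]
      fun z : Ω × Context d => φ t z.1 a y z.2)
    {C l κ : ℝ} (hl : 0 < l)
    (hC : ∀ t, 1 ≤ t → t ≤ n → ∀ᵐ ω ∂μ, ∀ a y w, y = 0 ∨ y = 1 → |φ t ω a y w| ≤ C)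
    (hexp : ∀ t, 1 ≤ t → t ≤ n → ∀ᵐ ω ∂μ, ∀ a y w, y = 0 ∨ y = 1 →
      Real.exp (-(l * φ t ω a y w)) ≤ 1 - l * φ t ω a y w + κ * l ^ 2 * φ t ω a y w ^ 2)
    (s : ℝ) :
    μ {ω | κ * l * ∑ t ∈ Finset.Icc 1 n, obsMean PW η (g t ω) (fun a y w => φ t ω a y w ^ 2) + s / l
      < ∑ t ∈ Finset.Icc 1 n, (obsMean PW η (g t ω) (φ t ω) - φ t ω (A t ω) (Y t ω) (W t ω))}
      ≤ ENNReal.ofReal (Real.exp (-s)) := by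
  set m : ℕ → Ω → ℝ := fun t ω => obsMean PW η (g t ω) (φ t ω) with hm
  set q : ℕ → Ω → ℝ := fun t ω => obsMean PW η (g t ω) (fun a y w => φ t ω a y w ^ 2) with hq
  set D : ℕ → Ω → ℝ≥0∞ := fun t ω => ENNReal.ofReal
    (Real.exp (l * (m t ω - φ t ω (A t ω) (Y t ω) (W t ω)) - κ * l ^ 2 * q t ω)) with hD
  have hmm : ∀ t, 1 ≤ t → Measurable[history W A Y (t - 1)] (m t) := fun t ht =>
    @measurable_obsMean _ _ _ (history W A Y (t - 1)) PW _ η hη _ (hg t ht) _ (hφ t ht)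
  have hqm : ∀ t, 1 ≤ t → Measurable[history W A Y (t - 1)] (q t) := fun t ht =>
    @measurable_obsMean _ _ _ (history W A Y (t - 1)) PW _ η hη _ (hg t ht) _
      (fun a y => (hφ t ht a y).pow_const 2)
  have hDm : ∀ t, 1 ≤ t → Measurable[history W A Y t] (D t) := by
    intro t ht
    have hle : history W A Y (t - 1) ≤ history W A Y t := history_mono (Nat.sub_le t 1)
    have hO := measurable_obs_history (W := W) (A := A) (Y := Y) ht (le_refl t)
    have hφO : Measurable[history W A Y t] fun ω => φ t ω (A t ω) (Y t ω) (W t ω) :=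
      @measurable_apply_obs _ _ _ (history W A Y t) _ _ _ (measurable_fst.comp hO)
        ((measurable_fst.comp measurable_snd).comp hO)
        ((measurable_snd.comp measurable_snd).comp hO) (hB.binary_Y t ht) _
        (fun a y => (hφ t ht a y).mono
          (sup_le_sup (MeasurableSpace.comap_mono hle) le_rfl) le_rfl)
    exact (((((hmm t ht).mono hle le_rfl).sub hφO).const_mul l).sub
      (((hqm t ht).mono hle le_rfl).const_mul _)).exp.ennreal_ofReal
  have hstep : ∀ t, 1 ≤ t → t ≤ n → ∀ ψ : Ω → ℝ≥0∞, Measurable[history W A Y (t - 1)] ψ →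
      ∫⁻ ω, ψ ω * D t ω ∂μ ≤ ∫⁻ ω, ψ ω ∂μ := by
    intro t ht htn ψ hψ
    have hfst : ∀ {β : Type} [MeasurableSpace β] {f : Ω → β},
        Measurable[history W A Y (t - 1)] f →
        Measurable[(history W A Y (t - 1)).prod inferInstance] fun z : Ω × Context d => f z.1 :=
      fun hf => hf.comp (@measurable_fst Ω (Context d) (history W A Y (t - 1)) _)
    have := hB.lintegral_step hη ht (hg t ht) (Φ := fun a y z => ψ z.1 * ENNReal.ofReal
      (Real.exp (l * (m t z.1 - φ t z.1 a y z.2) - κ * l ^ 2 * q t z.1))) (fun a y =>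
        (hψ.comp (@measurable_fst Ω (Context d) (history W A Y (t - 1)) _)).mul
          ((((hfst (hmm t ht)).sub (hφ t ht a y)).const_mul l).sub
            ((hfst (hqm t ht)).const_mul _)).exp.ennreal_ofReal)
    rw [this]
    refine lintegral_mono_ae ?_
    filter_upwards [hgp t ht, hC t ht htn, hexp t ht htn] with ω h1 h2 h3
    have h4 : ∀ a y, Measurable (φ t ω a y) := fun a y =>
      (hφ t ht a y).comp (@measurable_prodMk_left Ω (Context d) (history W A Y (t - 1)) _ ω)
    have h5 := lintegral_exp_obs_le_one (PW := PW) hη hη01 h1 h4 h2 h3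
    have h6 : ∀ w, ∑ a, ENNReal.ofReal (g t ω a w) * (ENNReal.ofReal (η a w) * (ψ ω *
        ENNReal.ofReal (Real.exp (l * (m t ω - φ t ω a 1 w) - κ * l ^ 2 * q t ω)))
        + ENNReal.ofReal (1 - η a w) * (ψ ω * ENNReal.ofReal
          (Real.exp (l * (m t ω - φ t ω a 0 w) - κ * l ^ 2 * q t ω))))
        = ψ ω * ∑ a, ENNReal.ofReal (g t ω a w) * (ENNReal.ofReal (η a w) *
        ENNReal.ofReal (Real.exp (l * (m t ω - φ t ω a 1 w) - κ * l ^ 2 * q t ω))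
        + ENNReal.ofReal (1 - η a w) * ENNReal.ofReal
          (Real.exp (l * (m t ω - φ t ω a 0 w) - κ * l ^ 2 * q t ω))) := by
      intro w
      rw [Finset.mul_sum]
      exact Finset.sum_congr rfl fun a _ => by ring
    simp only [h6]
    rw [lintegral_const_mul]
    · exact mul_le_of_le_one_right' h5
    · refine Finset.measurable_sum _ fun a _ => (h1.measurable a).ennreal_ofReal.mul
        (((hη a).ennreal_ofReal.mul ?_).add
          ((measurable_const.sub (hη a)).ennreal_ofReal.mul ?_))
      · exact (((measurable_const.sub (h4 a 1)).const_mul l).sub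
          measurable_const).exp.ennreal_ofReal
      · exact (((measurable_const.sub (h4 a 0)).const_mul l).sub
          measurable_const).exp.ennreal_ofReal
  have hint := lintegral_prod_le_one_of_step (fun t ht _ => hDm t ht) hstep
  have hprod : ∀ ω, ∏ τ ∈ Finset.Icc 1 n, D τ ω = ENNReal.ofReal (Real.exp
      (∑ t ∈ Finset.Icc 1 n, (l * (m t ω - φ t ω (A t ω) (Y t ω) (W t ω))
        - κ * l ^ 2 * q t ω))) := by
    intro ω
    rw [Real.exp_sum, ENNReal.ofReal_prod_of_nonneg fun _ _ => (Real.exp_pos _).le]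
  have hmeasP : Measurable fun ω => ∏ τ ∈ Finset.Icc 1 n, D τ ω :=
    Finset.measurable_prod _ fun t ht =>
      (hDm t (Finset.mem_Icc.1 ht).1).mono (hB.history_le t) le_rfl
  -- Multiplied by l, the deviation event says that the exponent of the product exceeds s; Markov's
  -- inequality then finishes.
  have hsub : {ω | κ * l * ∑ t ∈ Finset.Icc 1 n, q t ω + s / l
      < ∑ t ∈ Finset.Icc 1 n, (m t ω - φ t ω (A t ω) (Y t ω) (W t ω))}
      ⊆ {ω | ENNReal.ofReal (Real.exp s) ≤ ∏ τ ∈ Finset.Icc 1 n, D τ ω} := by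
    intro ω hω
    simp only [Set.mem_ofPred_eq] at hω ⊢
    rw [hprod]
    refine ENNReal.ofReal_le_ofReal (Real.exp_le_exp.2 ?_)
    rw [Finset.sum_sub_distrib, ← Finset.mul_sum, ← Finset.mul_sum]
    have := mul_lt_mul_of_pos_left hω hl
    have e : l * (s / l) = s := by field_simp
    nlinarith
  refine (measure_mono hsub).trans ?_
  have hmk := mul_meas_ge_le_lintegral (μ := μ) hmeasP (ENNReal.ofReal (Real.exp s))
  have hpos : ENNReal.ofReal (Real.exp s) ≠ 0 := by simp [Real.exp_pos]
  rw [Real.exp_neg, ENNReal.ofReal_inv_of_pos (Real.exp_pos s), ENNReal.le_inv_iff_mul_le, mul_comm]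
  exact hmk.trans hint

end Bernstein

/-! ### Nets that approximate from below -/

/-- Measurable maps from contexts to sub-probability vectors on the actions. -/
structure IsSubPolicy {d K : ℕ} (f : ActionFn d K) : Prop where
  measurable : ∀ a, Measurable (f a)
  nonneg : ∀ a w, 0 ≤ f a w
  sum_le_one : ∀ w, ∑ a, f a w ≤ 1

section Nets

variable {d K : ℕ} {F : Set (ActionFn d K)} {c p : ℝ}

theorem IsPolicy.isSubPolicy {f : ActionFn d K} (hf : IsPolicy f) : IsSubPolicy f :=
  ⟨hf.measurable, hf.nonneg, fun w => (hf.sum_eq_one w).le⟩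

theorem IsSubPolicy.le_one {f : ActionFn d K} (hf : IsSubPolicy f) (a : Fin K) (w : Context d) :
    f a w ≤ 1 :=
  (Finset.single_le_sum (fun b _ => hf.nonneg b w) (Finset.mem_univ a)).trans (hf.sum_le_one w)

/-- `T` is a set of sub-policies that approximates every member of `F` from below, up to `ρ`. -/
structure IsLowerNet (ρ : ℝ) (F : Set (ActionFn d K)) (T : Finset (ActionFn d K)) : Prop where
  isSubPolicy : ∀ f ∈ T, IsSubPolicy f
  approx : ∀ f ∈ F, ∃ h ∈ T, ∀ a w, h a w ≤ f a w ∧ f a w ≤ h a w + ρ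

theorem EntropyCondition.exists_isSupCover (hF : EntropyCondition c p F) {r : ℝ} (hr : 0 < r) :
    ∃ s : Finset (ActionFn d K), IsSupCover r F s ∧ (s.card : ℝ) ≤ Real.exp (c * r ^ (-p)) := by
  obtain ⟨h1, h2⟩ := hF r hr
  obtain ⟨N, hN⟩ := ENat.ne_top_iff_exists.1 h1
  have hlt : supCoveringNumber r F < ((N + 1 : ℕ) : ℕ∞) := by
    rw [← hN]
    exact_mod_cast Nat.lt_succ_self N
  obtain ⟨s, hs⟩ := iInf_lt_iff.1 hlt
  obtain ⟨hs1, hs2⟩ := iInf_lt_iff.1 hs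
  refine ⟨s, hs1, ?_⟩
  have h3 : s.card ≤ N := Nat.lt_succ_iff.1 (by exact_mod_cast hs2)
  have h4 : (supCoveringNumber r F).toNat = N := by rw [← hN]; rfl
  rw [h4] at h2
  have h5 : (s.card : ℝ) ≤ N := by exact_mod_cast h3
  refine h5.trans ?_
  -- A zero covering number has `Real.log 0 = 0`, from which nothing can be read off, so it is
  -- treated apart.
  rcases Nat.eq_zero_or_pos N with h | h
  · rw [h]; simp [Real.exp_nonneg]
  · exact (Real.log_le_iff_le_exp (by exact_mod_cast h)).1 h2

/-- Centres of a sup-norm cover need be neither measurable nor below the functions they approximate.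
Each useful centre of a cover of radius ρ/4 is replaced by a member of F in its ball, lowered by ρ/2
and cut off at 0. Two members of one ball differ by at most ρ/2, so the result lies below each of
them, with a gap of at most ρ. -/
theorem EntropyCondition.exists_isLowerNet (hF : EntropyCondition c p F)
    (hpol : ∀ f ∈ F, IsPolicy f) {ρ : ℝ} (hρ : 0 < ρ) :
    ∃ T : Finset (ActionFn d K), IsLowerNet ρ F T ∧
      (T.card : ℝ) ≤ Real.exp (c * (4 / ρ) ^ p) := by
  classical
  obtain ⟨s, hs, hcard⟩ := hF.exists_isSupCover (r := ρ / 4) (by positivity)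
  let P : ActionFn d K → ActionFn d K → Prop := fun h f => f ∈ F ∧ ∀ a w, |f a w - h a w| ≤ ρ / 4
  let G : ActionFn d K → ActionFn d K := fun h =>
    if H : ∃ f, P h f then fun a w => max (H.choose a w - ρ / 2) 0 else fun _ _ => 0
  refine ⟨s.image G, ⟨?_, ?_⟩, ?_⟩
  · intro f hf
    obtain ⟨h, _, rfl⟩ := Finset.mem_image.1 hf
    by_cases H : ∃ f, P h f
    · have hp := hpol _ H.choose_spec.1
      have hG : G h = fun a w => max (H.choose a w - ρ / 2) 0 := dif_pos H
      rw [hG]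
      refine ⟨fun a => ((hp.measurable a).sub_const _).max measurable_const,
        fun a w => le_max_right _ _, fun w => ?_⟩
      rw [← hp.sum_eq_one w]
      exact Finset.sum_le_sum fun a _ => max_le (by linarith) (hp.nonneg a w)
    · have hG : G h = fun _ _ => 0 := dif_neg H
      rw [hG]
      exact ⟨fun _ => measurable_const, fun _ _ => le_rfl, fun _ => by simp⟩
  · intro f hf
    obtain ⟨h, hhs, hh⟩ := hs f hf
    have H : ∃ f, P h f := ⟨f, hf, hh⟩
    have hG : G h = fun a w => max (H.choose a w - ρ / 2) 0 := dif_pos H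
    refine ⟨G h, Finset.mem_image_of_mem G hhs, fun a w => ?_⟩
    rw [hG]
    have h1 := abs_le.1 (hh a w)
    have h2 := abs_le.1 (H.choose_spec.2 a w)
    refine ⟨max_le (by linarith) ((hpol f hf).nonneg a w), ?_⟩
    have := le_max_left (H.choose a w - ρ / 2) 0
    linarith
  · have h1 : ((s.image G).card : ℝ) ≤ s.card := by exact_mod_cast Finset.card_image_le
    refine (h1.trans hcard).trans_eq ?_
    rw [Real.rpow_neg (by positivity), ← Real.inv_rpow (by positivity), inv_div]

end Nets

/-! ### Smoothed inverse propensity weights and their stability under approximation -/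

/-- The smoothed inverse propensity weight `∑_a f(a, w) / (g_δ(a, w) + γ)`, where `g_δ` is the
mixture of `g` with the uniform design. -/
noncomputable def invWeight {d K : ℕ} (δ γ : ℝ) (f g : ActionFn d K) (w : Context d) : ℝ :=
  ∑ a, f a w / (mix δ g a w + γ)

section Weights

variable {d K : ℕ} {δ γ : ℝ} {f g h : ActionFn d K}

theorem le_mix (hδ1 : δ ≤ 1) (hg : ∀ a w, 0 ≤ g a w) (a : Fin K) (w : Context d) :
    δ / K ≤ mix δ g a w := by
  have := mul_nonneg (sub_nonneg.2 hδ1) (hg a w)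
  simp only [mix]
  rw [mul_one_div]
  linarith

theorem mix_nonneg (hδ : 0 ≤ δ) (hδ1 : δ ≤ 1) (hg : ∀ a w, 0 ≤ g a w) (a : Fin K)
    (w : Context d) : 0 ≤ mix δ g a w :=
  le_trans (by positivity) (le_mix hδ1 hg a w)

theorem IsPolicy.mix (hK : 0 < K) (hδ : 0 ≤ δ) (hδ1 : δ ≤ 1) (hg : IsPolicy g) :
    IsPolicy (mix δ g) where
  measurable a := measurable_const.add ((hg.measurable a).const_mul _)
  nonneg := mix_nonneg hδ hδ1 hg.nonneg
  sum_eq_one w := by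
    have hK' : (K : ℝ) ≠ 0 := by positivity
    simp only [GPE.mix]
    rw [Finset.sum_add_distrib, ← Finset.mul_sum, ← Finset.mul_sum, hg.sum_eq_one]
    simp only [Finset.sum_const, Finset.card_univ, Fintype.card_fin, nsmul_eq_mul]
    field_simp
    ring

theorem measurable_invWeight (hf : ∀ a, Measurable (f a)) (hg : ∀ a, Measurable (g a)) :
    Measurable (invWeight δ γ f g) :=
  Finset.measurable_sum _ fun a _ => (hf a).div
    ((measurable_const.add ((hg a).const_mul _)).add_const γ)

theorem invWeight_nonneg (hγ : 0 ≤ γ) (hδ : 0 ≤ δ) (hδ1 : δ ≤ 1) (hf : ∀ a w, 0 ≤ f a w)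
    (hg : ∀ a w, 0 ≤ g a w) (w : Context d) : 0 ≤ invWeight δ γ f g w :=
  Finset.sum_nonneg fun a _ => div_nonneg (hf a w) (add_nonneg (mix_nonneg hδ hδ1 hg a w) hγ)

theorem invWeight_le (hγ : 0 < γ) (hδ : 0 ≤ δ) (hδ1 : δ ≤ 1) (hf : IsSubPolicy f)
    (hg : ∀ a w, 0 ≤ g a w) (w : Context d) : invWeight δ γ f g w ≤ 1 / γ := by
  calc invWeight δ γ f g w ≤ ∑ a, f a w / γ := Finset.sum_le_sum fun a _ =>
        div_le_div_of_nonneg_left (hf.nonneg a w) hγ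
          (le_add_of_nonneg_left (mix_nonneg hδ hδ1 hg a w))
    _ = (∑ a, f a w) / γ := by rw [Finset.sum_div]
    _ ≤ 1 / γ := div_le_div_of_nonneg_right (hf.sum_le_one w) hγ.le

theorem invWeight_zero_le (hK : 0 < K) (hδ : 0 < δ) (hδ1 : δ ≤ 1) (hf : IsSubPolicy f)
    (hg : ∀ a w, 0 ≤ g a w) (w : Context d) : invWeight δ 0 f g w ≤ K / δ := by
  have hΔ : 0 < δ / K := by positivity
  calc invWeight δ 0 f g w ≤ ∑ a, f a w / (δ / K) := Finset.sum_le_sum fun a _ =>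
        div_le_div_of_nonneg_left (hf.nonneg a w) hΔ (by rw [add_zero]; exact le_mix hδ1 hg a w)
    _ = (∑ a, f a w) / (δ / K) := by rw [Finset.sum_div]
    _ ≤ 1 / (δ / K) := div_le_div_of_nonneg_right (hf.sum_le_one w) hΔ.le
    _ = K / δ := one_div_div _ _

theorem integrable_of_bounds {α : Type*} [MeasurableSpace α] {ν : Measure α} [IsFiniteMeasure ν]
    {ζ : α → ℝ} (hm : Measurable ζ) {C : ℝ} (h0 : ∀ w, 0 ≤ ζ w) (h1 : ∀ w, ζ w ≤ C) :
    Integrable ζ ν :=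
  Integrable.of_bound hm.aestronglyMeasurable C (Filter.Eventually.of_forall fun w => by
    rw [Real.norm_eq_abs, abs_of_nonneg (h0 w)]; exact h1 w)

/-- Raising the floor of the propensities from `δ / K` to `γ` costs a factor `1 + γ K / δ`. -/
theorem invWeight_zero_le_mul (hK : 0 < K) (hδ : 0 < δ) (hδ1 : δ ≤ 1) (hγ : 0 < γ)
    (hf : ∀ a w, 0 ≤ f a w) (hg : ∀ a w, 0 ≤ g a w) (w : Context d) :
    invWeight δ 0 f g w ≤ (1 + γ * K / δ) * invWeight δ γ f g w := by
  unfold invWeight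
  rw [Finset.mul_sum]
  refine Finset.sum_le_sum fun a _ => ?_
  have hΔ : 0 < δ / K := by positivity
  have h1 := le_mix hδ1 hg a w
  have hpos : 0 < mix δ g a w := hΔ.trans_le h1
  rw [add_zero, ← mul_div_assoc, div_le_div_iff₀ hpos (by linarith)]
  have h2 : γ ≤ γ * K / δ * mix δ g a w := by
    calc γ = γ * K / δ * (δ / K) := by field_simp
      _ ≤ _ := mul_le_mul_of_nonneg_left h1 (by positivity)
  have h3 := hf a w
  nlinarith [mul_le_mul_of_nonneg_left h2 h3]

variable {f' g' : ActionFn d K}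

/-- Lowering the design only raises the weight, so only the error r in the numerator has to be paid,
and the denominator is at least γ. Here approximation from below is essential. -/
theorem invWeight_le_add_of_lower (hδ : 0 ≤ δ) (hδ1 : δ ≤ 1) (hγ : 0 < γ)
    (hf : ∀ a w, 0 ≤ f a w) (hg' : ∀ a w, 0 ≤ g' a w) (hgg : ∀ a w, g' a w ≤ g a w)
    {r : ℝ} (hr : 0 ≤ r) (hff : ∀ a w, f a w ≤ f' a w + r) (w : Context d) :
    invWeight δ γ f g w ≤ K * (r / γ) + invWeight δ γ f' g' w := by
  have h1 : ∀ a, f a w / (mix δ g a w + γ) ≤ r / γ + f' a w / (mix δ g' a w + γ) := by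
    intro a
    have hm := mix_nonneg hδ hδ1 hg' a w
    have hmm : mix δ g' a w ≤ mix δ g a w := by
      simp only [mix]
      have := mul_le_mul_of_nonneg_left (hgg a w) (sub_nonneg.2 hδ1)
      linarith
    calc f a w / (mix δ g a w + γ) ≤ f a w / (mix δ g' a w + γ) :=
          div_le_div_of_nonneg_left (hf a w) (by linarith) (by linarith)
      _ ≤ (r + f' a w) / (mix δ g' a w + γ) :=
          div_le_div_of_nonneg_right (by linarith [hff a w]) (by linarith)
      _ = r / (mix δ g' a w + γ) + f' a w / (mix δ g' a w + γ) := add_div _ _ _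
      _ ≤ _ := by
          have : r / (mix δ g' a w + γ) ≤ r / γ :=
            div_le_div_of_nonneg_left hr hγ (by linarith)
          linarith
  calc invWeight δ γ f g w ≤ ∑ a, (r / γ + f' a w / (mix δ g' a w + γ)) :=
        Finset.sum_le_sum fun a _ => h1 a
    _ = _ := by
        rw [Finset.sum_add_distrib]
        simp [invWeight]

/-- The smoothing γ absorbs the error γ/4 of the design: the new denominator is at least 3/4 of the
old one. The comparison costs a constant factor that does not depend on δ. -/
theorem invWeight_lower_le (hδ : 0 < δ) (hδ1 : δ ≤ 1) (hK : 0 < K) (hγ : 0 < γ)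
    (hf : ∀ a w, 0 ≤ f a w) (hg : ∀ a w, 0 ≤ g a w) (hg' : ∀ a w, 0 ≤ g' a w)
    (hff : ∀ a w, f' a w ≤ f a w) (hgg : ∀ a w, g a w ≤ g' a w + γ / 4) (w : Context d) :
    invWeight δ γ f' g' w ≤ 4 / 3 * invWeight δ 0 f g w := by
  unfold invWeight
  rw [Finset.mul_sum]
  refine Finset.sum_le_sum fun a _ => ?_
  have hm := mix_nonneg hδ.le hδ1 hg' a w
  have hΔ : 0 < δ / K := by positivity
  have hpos : 0 < mix δ g a w := hΔ.trans_le (le_mix hδ1 hg a w)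
  have hmm : mix δ g a w ≤ mix δ g' a w + γ / 4 := by
    simp only [mix]
    have := mul_le_mul_of_nonneg_left (hgg a w) (sub_nonneg.2 hδ1)
    nlinarith [mul_nonneg hδ.le hγ.le]
  rw [add_zero]
  calc f' a w / (mix δ g' a w + γ) ≤ f a w / (mix δ g' a w + γ) :=
        div_le_div_of_nonneg_right (hff a w) (by linarith)
    _ ≤ f a w / (3 / 4 * mix δ g a w) :=
        div_le_div_of_nonneg_left (hf a w) (by positivity) (by linarith)
    _ = 4 / 3 * (f a w / mix δ g a w) := by field_simp

end Weights

/-! ### Deviations of empirical means of functions of the contexts -/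

section Deviation

variable {d K : ℕ} {Ω : Type*} {W : ℕ → Ω → Context d} {A : ℕ → Ω → Fin K} {Y : ℕ → Ω → ℝ}
  [mΩ : MeasurableSpace Ω] {μ : Measure Ω} {PW : Measure (Context d)}
  {η : ActionFn d K} {g : ℕ → Ω → ActionFn d K}

theorem obsMean_context {gω : ActionFn d K} (hg : IsPolicy gω) (ζ : Context d → ℝ) :
    obsMean PW η gω (fun _ _ w => ζ w) = ∫ w, ζ w ∂PW := by
  unfold obsMean
  congr 1
  funext w
  calc ∑ a, gω a w * (η a w * ζ w + (1 - η a w) * ζ w) = ∑ a, gω a w * ζ w :=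
        Finset.sum_congr rfl fun a _ => by ring
    _ = ζ w := by rw [← Finset.sum_mul, hg.sum_eq_one, one_mul]

/-- The reason is (1 - x + x²/2)(1 + x + x²/2) = 1 + x⁴/4 ≥ 1, together with the quadratic lower
bound for exp x. -/
theorem exp_neg_le_of_nonneg {x : ℝ} (hx : 0 ≤ x) : Real.exp (-x) ≤ 1 - x + 1 / 2 * x ^ 2 := by
  rcases le_total x 1 with h | h
  · have h1 : Real.exp (-x) * Real.exp x = 1 := by rw [← Real.exp_add]; simp
    have h2 := Real.quadratic_le_exp_of_nonneg hx
    have h3 : 0 < 1 - x + 1 / 2 * x ^ 2 := by nlinarith [sq_nonneg (x - 1)]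
    have h4 : 1 ≤ (1 - x + 1 / 2 * x ^ 2) * (1 + x + x ^ 2 / 2) := by nlinarith [sq_nonneg (x ^ 2)]
    have h5 : 1 ≤ (1 - x + 1 / 2 * x ^ 2) * Real.exp x :=
      h4.trans (mul_le_mul_of_nonneg_left h2 h3.le)
    rw [Real.exp_neg]
    exact (inv_le_iff_one_le_mul₀ (Real.exp_pos x)).2 h5
  · have h1 : 1 + x + x ^ 2 / 2 ≤ Real.exp x := Real.quadratic_le_exp_of_nonneg hx
    have h4 : 1 ≤ (1 - x + 1 / 2 * x ^ 2) * (1 + x + x ^ 2 / 2) := by nlinarith [sq_nonneg (x ^ 2)]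
    have h3 : 0 < 1 - x + 1 / 2 * x ^ 2 := by nlinarith [sq_nonneg (x - 1)]
    rw [Real.exp_neg]
    exact (inv_le_iff_one_le_mul₀ (Real.exp_pos x)).2
      (h4.trans (mul_le_mul_of_nonneg_left h1 h3.le))

/-- Lower deviations of the empirical mean of a bounded nonnegative function of the contexts. -/
theorem IsBandit.context_deviation [IsProbabilityMeasure μ] [IsProbabilityMeasure PW]
    (hB : IsBandit μ PW η g W A Y)
    (hη : ∀ a, Measurable (η a)) (hη01 : ∀ a w, 0 ≤ η a w ∧ η a w ≤ 1)
    (hg : ∀ t, 1 ≤ t → ∀ a, Measurable[(history W A Y (t - 1)).prod inferInstance]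
      (fun z : Ω × Context d => g t z.1 a z.2))
    (hgp : ∀ t, 1 ≤ t → ∀ᵐ ω ∂μ, IsPolicy (g t ω)) (N : ℕ)
    {ζ : Context d → ℝ} (hζ : Measurable ζ) {γ : ℝ} (hγ : 0 < γ) (h0 : ∀ w, 0 ≤ ζ w)
    (h1 : ∀ w, ζ w ≤ 1 / γ) (s : ℝ) :
    μ {ω | ∑ t ∈ Finset.Icc 1 N, ζ (W t ω) + 2 * s / γ < 3 / 4 * (N * ∫ w, ζ w ∂PW)}
      ≤ ENNReal.ofReal (Real.exp (-s)) := by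
  -- Since ζ² ≤ ζ/γ, the choice l = γ/2 makes the variance term at most a quarter of N ∫ ζ. This
  -- leaves the factor 3/4 and the deviation s/l = 2s/γ.
  have hb := hB.bernstein hη hη01 hg hgp N (φ := fun _ _ _ _ w => ζ w)
    (fun t _ _ _ => hζ.comp (@measurable_snd Ω (Context d) (history W A Y (t - 1)) _))
    (C := 1 / γ) (l := γ / 2) (κ := 1 / 2) (by positivity)
    (fun _ _ _ => Filter.Eventually.of_forall fun ω a y w _ => by
      rw [abs_of_nonneg (h0 w)]; exact h1 w)
    (fun _ _ _ => Filter.Eventually.of_forall fun ω a y w _ => by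
      have := exp_neg_le_of_nonneg (x := γ / 2 * ζ w) (mul_nonneg (by positivity) (h0 w))
      nlinarith) s
  refine le_trans (measure_mono_ae ?_) hb
  have hall : ∀ᵐ ω ∂μ, ∀ t, 1 ≤ t → IsPolicy (g t ω) := by
    rw [ae_all_iff]
    intro t
    by_cases ht : 1 ≤ t
    · filter_upwards [hgp t ht] with ω h _ using h
    · exact Filter.Eventually.of_forall fun ω h => absurd h ht
  have hi : Integrable ζ PW := integrable_of_bounds hζ h0 h1
  have hq : ∫ w, ζ w ^ 2 ∂PW ≤ (∫ w, ζ w ∂PW) / γ := by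
    rw [div_eq_mul_one_div, ← integral_mul_const]
    refine integral_mono ?_ (hi.mul_const _) fun w => ?_
    · refine integrable_of_bounds (hζ.pow_const 2) (fun w => sq_nonneg _) (C := (1 / γ) ^ 2)
        fun w => pow_le_pow_left₀ (h0 w) (h1 w) 2
    · change ζ w ^ 2 ≤ ζ w * (1 / γ)
      rw [sq]
      exact mul_le_mul_of_nonneg_left (h1 w) (h0 w)
  filter_upwards [hall] with ω hω
  intro hlt
  change 1 / 2 * (γ / 2) * _ + s / (γ / 2) < _
  change _ < 3 / 4 * (N * ∫ w, ζ w ∂PW) at hlt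
  have e1 : ∑ t ∈ Finset.Icc 1 N, obsMean PW η (g t ω) (fun _ _ w => ζ w ^ 2)
      = N * ∫ w, ζ w ^ 2 ∂PW := by
    rw [Finset.sum_congr rfl fun t ht =>
      obsMean_context (hω t (Finset.mem_Icc.1 ht).1) (fun w => ζ w ^ 2)]
    simp
  have e2 : ∑ t ∈ Finset.Icc 1 N, (obsMean PW η (g t ω) (fun _ _ w => ζ w) - ζ (W t ω))
      = N * (∫ w, ζ w ∂PW) - ∑ t ∈ Finset.Icc 1 N, ζ (W t ω) := by
    rw [Finset.sum_sub_distrib, Finset.sum_congr rfl fun t ht =>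
      obsMean_context (hω t (Finset.mem_Icc.1 ht).1) ζ]
    simp
  rw [e1, e2]
  have e3 : 1 / 2 * (γ / 2) * (N * ∫ w, ζ w ^ 2 ∂PW) ≤ 1 / 4 * (N * ∫ w, ζ w ∂PW) := by
    calc 1 / 2 * (γ / 2) * (N * ∫ w, ζ w ^ 2 ∂PW)
        ≤ 1 / 2 * (γ / 2) * (N * ((∫ w, ζ w ∂PW) / γ)) := by gcongr
      _ = _ := by field_simp; ring
  have e4 : s / (γ / 2) = 2 * s / γ := by field_simp
  rw [e4]
  linarith

end Deviation

/-! ### The scale u = 1/δ_n: u² = n for p ≤ 1, u^(2p) = n for p ≥ 1 -/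

section Delta

variable {p : ℝ} {n : ℕ}

theorem delta_pos (hn : 1 ≤ n) : 0 < delta p n :=
  Real.rpow_pos_of_pos (by exact_mod_cast hn) _

theorem delta_exponent_nonneg (hp : 0 < p) : 0 ≤ min (1 / 2) (1 / (2 * p)) :=
  le_min (by norm_num) (by positivity)

theorem delta_le_one (hp : 0 < p) (hn : 1 ≤ n) : delta p n ≤ 1 :=
  Real.rpow_le_one_of_one_le_of_nonpos (by exact_mod_cast hn)
    (neg_nonpos.2 (delta_exponent_nonneg hp))

theorem inv_delta : (delta p n)⁻¹ = (n : ℝ) ^ (min (1 / 2) (1 / (2 * p))) := by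
  rw [delta, Real.rpow_neg (Nat.cast_nonneg n), inv_inv]

theorem one_le_inv_delta (hp : 0 < p) (hn : 1 ≤ n) : 1 ≤ (delta p n)⁻¹ := by
  rw [inv_delta]
  exact Real.one_le_rpow (by exact_mod_cast hn) (delta_exponent_nonneg hp)

theorem inv_delta_mono (hp : 0 < p) {m : ℕ} (hmn : m ≤ n) :
    (delta p m)⁻¹ ≤ (delta p n)⁻¹ := by
  rw [inv_delta, inv_delta]
  exact Real.rpow_le_rpow (Nat.cast_nonneg m) (by exact_mod_cast hmn) (delta_exponent_nonneg hp)

theorem inv_delta_sq_le (hn : 1 ≤ n) : (delta p n)⁻¹ ^ 2 ≤ n := by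
  have hn' : (1 : ℝ) ≤ n := by exact_mod_cast hn
  rw [inv_delta, ← Real.rpow_natCast, ← Real.rpow_mul (Nat.cast_nonneg n)]
  calc (n : ℝ) ^ (min (1 / 2) (1 / (2 * p)) * (2 : ℕ)) ≤ (n : ℝ) ^ (1 : ℝ) := by
        refine Real.rpow_le_rpow_of_exponent_le hn' ?_
        have := min_le_left (1 / 2 : ℝ) (1 / (2 * p))
        push_cast
        linarith
    _ = n := Real.rpow_one _

theorem inv_delta_le_sqrt (hn : 1 ≤ n) : (delta p n)⁻¹ ≤ √(n : ℝ) :=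
  Real.le_sqrt_of_sq_le (inv_delta_sq_le hn)

theorem inv_delta_sq_of_lt_one (hp : 0 < p) (hp1 : p ≤ 1) : (delta p n)⁻¹ ^ 2 = n := by
  have h : (1 / 2 : ℝ) ≤ 1 / (2 * p) := one_div_le_one_div_of_le (by positivity) (by linarith)
  rw [inv_delta, min_eq_left h, ← Real.sqrt_eq_rpow, Real.sq_sqrt (Nat.cast_nonneg n)]

theorem inv_delta_of_one_le (hp1 : 1 ≤ p) : (delta p n)⁻¹ = (n : ℝ) ^ (1 / (2 * p)) := by
  have h : 1 / (2 * p) ≤ (1 / 2 : ℝ) := one_div_le_one_div_of_le (by norm_num) (by linarith)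
  rw [inv_delta, min_eq_right h]

theorem inv_delta_rpow_of_one_le (hp1 : 1 ≤ p) : (delta p n)⁻¹ ^ (2 * p) = n := by
  rw [inv_delta_of_one_le hp1, ← Real.rpow_mul (Nat.cast_nonneg n), one_div,
    inv_mul_cancel₀ (by linarith), Real.rpow_one]

/-- At smoothing level γ = β/u the left side is (16/γ)^p u/n, the entropy contribution (up to
constants) to the transfer of weights from sample to population. The exponent in δ_n keeps it
bounded: for p ≤ 1 because n = u², for p ≥ 1 because n = u^(2p). -/
theorem entropy_inv_delta_le (hp : 0 < p) (hn : 1 ≤ n) {β : ℝ} (hβ : 4 ≤ β)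
    (hu : β ≤ (delta p n)⁻¹) :
    (16 * (delta p n)⁻¹ / β) ^ p * (delta p n)⁻¹ / n ≤ 16 / β := by
  set u := (delta p n)⁻¹ with hu'
  have hβ0 : 0 < β := by linarith
  have hu0 : 0 < u := hβ0.trans_le hu
  have hn0 : (0 : ℝ) < n := by exact_mod_cast hn
  rw [div_le_div_iff₀ hn0 hβ0]
  rcases le_total p 1 with h | h
  · have hnu : (n : ℝ) = u ^ 2 := (inv_delta_sq_of_lt_one hp h).symm
    rw [hnu]
    have h1 : 16 * u / β ≤ 16 * (u / β) := by rw [mul_div_assoc]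
    have h2 : 1 ≤ u / β := (one_le_div hβ0).2 hu
    have h3 : (16 * u / β) ^ p ≤ 16 * (u / β) := by
      calc (16 * u / β) ^ p ≤ (16 * u / β) ^ (1 : ℝ) :=
            Real.rpow_le_rpow_of_exponent_le (by rw [mul_div_assoc]; linarith) h
        _ = 16 * (u / β) := by rw [Real.rpow_one, mul_div_assoc]
    calc (16 * u / β) ^ p * u * β ≤ 16 * (u / β) * u * β := by gcongr
      _ = 16 * u ^ 2 := by field_simp
  · have hnu : (n : ℝ) = u ^ p * u ^ p := by
      rw [← Real.rpow_add hu0, ← two_mul]; exact (inv_delta_rpow_of_one_le h).symm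
    have h1 : (16 * u / β) ^ p = (16 / β) ^ p * u ^ p := by
      rw [← Real.mul_rpow (by positivity) hu0.le]; ring_nf
    have h2 : (16 / β ^ 2) ^ p ≤ 16 / β ^ 2 := by
      calc (16 / β ^ 2) ^ p ≤ (16 / β ^ 2) ^ (1 : ℝ) := by
            refine Real.rpow_le_rpow_of_exponent_ge (by positivity) ?_ h
            rw [div_le_one (by positivity)]
            nlinarith
        _ = _ := Real.rpow_one _
    have h3 : (16 / β) ^ p = (16 / β ^ 2) ^ p * β ^ p := by
      rw [← Real.mul_rpow (by positivity) hβ0.le]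
      congr 1
      field_simp
    have h4 : β ^ p * u ≤ u ^ p * β := by
      have h5 : (β / u) ^ p ≤ (β / u) ^ (1 : ℝ) :=
        Real.rpow_le_rpow_of_exponent_ge (by positivity) ((div_le_one hu0).2 hu) h
      rw [Real.rpow_one, Real.div_rpow hβ0.le hu0.le,
        div_le_div_iff₀ (by positivity) hu0] at h5
      linarith
    rw [hnu, h1, h3]
    calc (16 / β ^ 2) ^ p * β ^ p * u ^ p * u * β
        = (16 / β ^ 2) ^ p * (β ^ p * u) * u ^ p * β := by ring
      _ ≤ 16 / β ^ 2 * (u ^ p * β) * u ^ p * β := by gcongr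
      _ = 16 * (u ^ p * u ^ p) := by field_simp

end Delta

/-! ### From empirical to mean inverse propensity weights, uniformly in policy and design -/

section UniformWeights

variable {d K : ℕ} {Ω : Type*} {W : ℕ → Ω → Context d} {A : ℕ → Ω → Fin K} {Y : ℕ → Ω → ℝ}
  [mΩ : MeasurableSpace Ω] {μ : Measure Ω} {PW : Measure (Context d)}
  {η : ActionFn d K} {g : ℕ → Ω → ActionFn d K} {F : Set (ActionFn d K)} {c p : ℝ}

/-- The deviation bound is applied to the pairs of points of a lower net of radius γ/4, with level
2H + L to pay for the squared cardinality. The empirical constraint passes from (f, h) to its net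
pair at the cost of a factor 4/3. The resulting mean bound passes back by adding K/4 and then
removing the smoothing, a factor 1 + γK/δ. -/
theorem IsBandit.uniform_invWeight [IsProbabilityMeasure μ] [IsProbabilityMeasure PW]
    (hB : IsBandit μ PW η g W A Y)
    (hη : ∀ a, Measurable (η a)) (hη01 : ∀ a w, 0 ≤ η a w ∧ η a w ≤ 1)
    (hg : ∀ t, 1 ≤ t → ∀ a, Measurable[(history W A Y (t - 1)).prod inferInstance]
      (fun z : Ω × Context d => g t z.1 a z.2))
    (hgp : ∀ t, 1 ≤ t → ∀ᵐ ω ∂μ, IsPolicy (g t ω)) (hK : 0 < K)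
    (hpol : ∀ f ∈ F, IsPolicy f) (hent : EntropyCondition c p F) {N : ℕ} (hN : 1 ≤ N)
    {δ γ : ℝ} (hδ : 0 < δ) (hδ1 : δ ≤ 1) (hγ : 0 < γ) (L : ℝ) :
    ∃ bad : Set Ω, μ bad ≤ ENNReal.ofReal (Real.exp (-L)) ∧ ∀ ω ∉ bad, ∀ f ∈ F, ∀ h ∈ F,
      ∑ t ∈ Finset.Icc 1 N, invWeight δ 0 f h (W t ω) ≤ 2 * K * N →
      ∫ w, invWeight δ 0 f h w ∂PW
        ≤ (1 + γ * K / δ) * (4 * K + 8 / 3 * (2 * (c * (16 / γ) ^ p) + L) / (γ * N)) := by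
  classical
  obtain ⟨T, hT, hcard⟩ := hent.exists_isLowerNet hpol (ρ := γ / 4) (by positivity)
  have h16 : 4 / (γ / 4) = 16 / γ := by field_simp; norm_num
  rw [h16] at hcard
  set H := c * (16 / γ) ^ p with hH
  have hN0 : (0 : ℝ) < N := by exact_mod_cast hN
  let B : ActionFn d K × ActionFn d K → Set Ω := fun q =>
    {ω | ∑ t ∈ Finset.Icc 1 N, invWeight δ γ q.1 q.2 (W t ω) + 2 * (2 * H + L) / γ
      < 3 / 4 * (N * ∫ w, invWeight δ γ q.1 q.2 w ∂PW)}
  have hBq : ∀ q ∈ T ×ˢ T, μ (B q) ≤ ENNReal.ofReal (Real.exp (-(2 * H + L))) := by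
    intro q hq
    have h1 := hT.isSubPolicy _ (Finset.mem_product.1 hq).1
    have h2 := hT.isSubPolicy _ (Finset.mem_product.1 hq).2
    exact hB.context_deviation hη hη01 hg hgp N (measurable_invWeight h1.measurable h2.measurable)
      hγ (invWeight_nonneg hγ.le hδ.le hδ1 h1.nonneg h2.nonneg)
      (invWeight_le hγ hδ.le hδ1 h1 h2.nonneg) _
  refine ⟨⋃ q ∈ T ×ˢ T, B q, ?_, ?_⟩
  · refine (measure_biUnion_finset_le _ _).trans ((Finset.sum_le_sum hBq).trans ?_)
    rw [Finset.sum_const, nsmul_eq_mul, Finset.card_product]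
    rw [← ENNReal.ofReal_natCast, ← ENNReal.ofReal_mul (Nat.cast_nonneg _)]
    refine ENNReal.ofReal_le_ofReal ?_
    push_cast
    calc (T.card : ℝ) * T.card * Real.exp (-(2 * H + L))
        ≤ Real.exp H * Real.exp H * Real.exp (-(2 * H + L)) := by gcongr
      _ = Real.exp (-L) := by rw [← Real.exp_add, ← Real.exp_add]; ring_nf
  · intro ω hω f hf h hh hemp
    obtain ⟨f', hf'T, hf'⟩ := hT.approx f hf
    obtain ⟨h', hh'T, hh'⟩ := hT.approx h hh
    have hfp := hpol f hf
    have hhp := hpol h hh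
    have hf's := hT.isSubPolicy _ hf'T
    have hh's := hT.isSubPolicy _ hh'T
    have hnb : ω ∉ B (f', h') := fun hb =>
      hω (Set.mem_iUnion₂.2 ⟨(f', h'), Finset.mk_mem_product hf'T hh'T, hb⟩)
    have hdev : 3 / 4 * (N * ∫ w, invWeight δ γ f' h' w ∂PW)
        ≤ ∑ t ∈ Finset.Icc 1 N, invWeight δ γ f' h' (W t ω) + 2 * (2 * H + L) / γ := not_lt.1 hnb
    have hemp' : ∑ t ∈ Finset.Icc 1 N, invWeight δ γ f' h' (W t ω) ≤ 4 / 3 * (2 * K * N) :=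
      calc ∑ t ∈ Finset.Icc 1 N, invWeight δ γ f' h' (W t ω)
          ≤ ∑ t ∈ Finset.Icc 1 N, 4 / 3 * invWeight δ 0 f h (W t ω) :=
            Finset.sum_le_sum fun t _ => invWeight_lower_le hδ hδ1 hK hγ hfp.nonneg hhp.nonneg
              hh's.nonneg (fun a w => (hf' a w).1) (fun a w => (hh' a w).2) _
        _ = 4 / 3 * ∑ t ∈ Finset.Icc 1 N, invWeight δ 0 f h (W t ω) := by rw [Finset.mul_sum]
        _ ≤ _ := by gcongr
    have hi : ∀ {γ' : ℝ} {f₁ g₁ : ActionFn d K} {C : ℝ}, 0 ≤ γ' → IsSubPolicy f₁ →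
        IsSubPolicy g₁ → (∀ w, invWeight δ γ' f₁ g₁ w ≤ C) →
        Integrable (invWeight δ γ' f₁ g₁) PW := fun h0 h1 h2 h3 =>
      integrable_of_bounds (measurable_invWeight h1.measurable h2.measurable)
        (invWeight_nonneg h0 hδ.le hδ1 h1.nonneg h2.nonneg) h3
    have hi' := hi hγ.le hf's hh's (invWeight_le hγ hδ.le hδ1 hf's hh's.nonneg)
    have hiγ := hi hγ.le hfp.isSubPolicy hhp.isSubPolicy
      (invWeight_le hγ hδ.le hδ1 hfp.isSubPolicy hhp.nonneg)
    have hi0 := hi le_rfl hfp.isSubPolicy hhp.isSubPolicy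
      (invWeight_zero_le hK hδ hδ1 hfp.isSubPolicy hhp.nonneg)
    have i1 : ∫ w, invWeight δ 0 f h w ∂PW
        ≤ (1 + γ * K / δ) * ∫ w, invWeight δ γ f h w ∂PW := by
      rw [← integral_const_mul]
      exact integral_mono hi0 (hiγ.const_mul _)
        (invWeight_zero_le_mul hK hδ hδ1 hγ hfp.nonneg hhp.nonneg)
    have i2 : ∫ w, invWeight δ γ f h w ∂PW ≤ K * (1 / 4) + ∫ w, invWeight δ γ f' h' w ∂PW := by
      have : ∫ w, (K * (1 / 4) + invWeight δ γ f' h' w) ∂PW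
          = K * (1 / 4) + ∫ w, invWeight δ γ f' h' w ∂PW := by
        rw [integral_add (integrable_const _) hi']; simp
      rw [← this]
      refine integral_mono hiγ ((integrable_const _).add hi') fun w => ?_
      have := invWeight_le_add_of_lower hδ.le hδ1 hγ hfp.nonneg hh's.nonneg
        (fun a w => (hh' a w).1) (r := γ / 4) (by positivity) (fun a w => (hf' a w).2) w
      rwa [show γ / 4 / γ = 1 / 4 by field_simp] at this
    -- The constant 32/9 is (4/3)·(4/3)·2: one factor from passing to the net, one from the 3/4 of
    -- the deviation bound. Adding 1/4 still leaves less than 4.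
    have i3 : ∫ w, invWeight δ γ f' h' w ∂PW
        ≤ 32 / 9 * K + 8 / 3 * (2 * H + L) / (γ * N) := by
      have e1 : (N : ℝ) * (32 / 9 * K + 8 / 3 * (2 * H + L) / (γ * N))
          = 4 / 3 * (4 / 3 * (2 * K * N) + 2 * (2 * H + L) / γ) := by
        field_simp
        ring
      have e2 : (N : ℝ) * ∫ w, invWeight δ γ f' h' w ∂PW
          ≤ N * (32 / 9 * K + 8 / 3 * (2 * H + L) / (γ * N)) := by
        rw [e1]; linarith
      exact le_of_mul_le_mul_left e2 hN0
    refine i1.trans (mul_le_mul_of_nonneg_left ?_ (by positivity))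
    have hK0 : (0 : ℝ) ≤ K := Nat.cast_nonneg K
    linarith

set_option maxHeartbeats 400000 in
/-- With high probability, every policy whose empirical inverse propensity weight is at most `2K`
has a small mean inverse propensity weight, uniformly in the design. -/
theorem IsBandit.uniform_invWeight_delta [IsProbabilityMeasure μ] [IsProbabilityMeasure PW]
    (hB : IsBandit μ PW η g W A Y)
    (hη : ∀ a, Measurable (η a)) (hη01 : ∀ a w, 0 ≤ η a w ∧ η a w ≤ 1)
    (hg : ∀ t, 1 ≤ t → ∀ a, Measurable[(history W A Y (t - 1)).prod inferInstance]
      (fun z : Ω × Context d => g t z.1 a z.2))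
    (hgp : ∀ t, 1 ≤ t → ∀ᵐ ω ∂μ, IsPolicy (g t ω)) (hK : 2 ≤ K) (hc : 0 < c) (hp : 0 < p)
    (hpol : ∀ f ∈ F, IsPolicy f) (hent : EntropyCondition c p F) {n : ℕ} (hn : 1 ≤ n)
    {L : ℝ} (hL : 0 ≤ L) :
    ∃ bad : Set Ω, μ bad ≤ ENNReal.ofReal (Real.exp (-L)) ∧ ∀ ω ∉ bad, ∀ f ∈ F, ∀ h ∈ F,
      ((n : ℝ) - 1)⁻¹ * ∑ t ∈ Finset.Icc 1 (n - 1), invWeight (delta p n) 0 f h (W t ω) ≤ 2 * K →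
      ∫ w, invWeight (delta p n) 0 f h w ∂PW
        ≤ K ^ 2 * (18 + 31 * √c + (delta p n)⁻¹ * √(L / n)) := by
  have hK0 : 0 < K := by omega
  have hK2 : (2 : ℝ) ≤ K := by exact_mod_cast hK
  have hδ : 0 < delta p n := delta_pos hn
  have hδ1 := delta_le_one hp hn
  have hn0 : (0 : ℝ) < n := by exact_mod_cast hn
  set δ := delta p n with hδdef
  set u := δ⁻¹ with hu
  have hu0 : 0 < u := inv_pos.2 hδ
  have hsc : 0 ≤ √c := Real.sqrt_nonneg c
  have hLn : 0 ≤ √(L / n) := Real.sqrt_nonneg _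
  have htriv : ∀ f ∈ F, ∀ h ∈ F, ∫ w, invWeight δ 0 f h w ∂PW ≤ K * u := by
    intro f hf h hh
    have h1 := (hpol f hf).isSubPolicy
    have h2 := (hpol h hh)
    have h3 := invWeight_zero_le hK0 hδ hδ1 h1 h2.nonneg
    calc ∫ w, invWeight δ 0 f h w ∂PW ≤ ∫ _, (K * u : ℝ) ∂PW :=
          integral_mono (integrable_of_bounds (measurable_invWeight h1.measurable h2.measurable)
            (invWeight_nonneg le_rfl hδ.le hδ1 h1.nonneg h2.nonneg) h3) (integrable_const _)
            fun w => by rw [hu, ← div_eq_mul_inv]; exact h3 w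
      _ = K * u := by simp
  -- The smoothing level will be γ = β/u, so that γK/δ = βK does not grow with n. This β brings the
  -- entropy term c·16/β below 4√c, and β ≥ 4 yields n ≥ u² ≥ 16 in the main case.
  set β := 4 * (1 + √c) with hβ
  have hβ4 : 4 ≤ β := by linarith
  -- For small u, in particular for n = 1 where the empirical constraint is void, the trivial bound
  -- K u is already enough.
  rcases le_or_gt u β with hub | hub
  · refine ⟨∅, by simp, fun ω _ f hf h hh _ => (htriv f hf h hh).trans ?_⟩
    calc (K : ℝ) * u ≤ K * β := by gcongr
      _ ≤ K * (K * (18 + 31 * √c + u * √(L / n))) := by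
          refine mul_le_mul_of_nonneg_left ?_ (by positivity)
          have : (2 : ℝ) * (18 + 31 * √c + u * √(L / n)) ≤ K * (18 + 31 * √c + u * √(L / n)) :=
            mul_le_mul_of_nonneg_right hK2 (by positivity)
          have := mul_nonneg hu0.le hLn
          linarith
      _ = _ := by ring
  · have hβ0 : 0 < β := by linarith
    have hn16 : (16 : ℝ) ≤ n := by
      have h1 := inv_delta_sq_le (p := p) hn
      rw [← hδdef, ← hu] at h1
      nlinarith
    have hn16' : 16 ≤ n := by exact_mod_cast hn16
    have hNc : ((n - 1 : ℕ) : ℝ) = (n : ℝ) - 1 := by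
      rw [Nat.cast_sub hn]; simp
    have hNn : 15 / 16 * (n : ℝ) ≤ ((n - 1 : ℕ) : ℝ) := by rw [hNc]; linarith
    set N := n - 1 with hN
    have hN1 : 1 ≤ N := by omega
    have hN0 : (0 : ℝ) < N := by exact_mod_cast hN1
    obtain ⟨bad, hbad, hgood⟩ := hB.uniform_invWeight hη hη01 hg hgp hK0 hpol hent hN1 hδ hδ1
      (γ := β / u) (by positivity) L
    refine ⟨bad, hbad, fun ω hω f hf h hh hemp => ?_⟩
    rw [← hNc, inv_mul_le_iff₀ hN0] at hemp
    have hmain := hgood ω hω f hf h hh (by linarith)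
    have e1 : β / u * K / δ = β * K := by rw [hu]; field_simp
    have e2 : 16 / (β / u) = 16 * u / β := by field_simp
    rw [e1, e2] at hmain
    set H := c * (16 * u / β) ^ p with hH
    have hH0 : 0 ≤ H := by positivity
    have hHn : H * u / n ≤ 4 * √c := by
      have h1 := entropy_inv_delta_le hp hn hβ4 hub.le
      calc H * u / n = c * ((16 * u / β) ^ p * u / n) := by rw [hH]; ring
        _ ≤ c * (16 / β) := by gcongr
        _ ≤ 4 * √c := by
            rw [← mul_div_assoc, div_le_iff₀ hβ0, hβ]
            nlinarith [Real.sq_sqrt hc.le]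
    have e3 : 8 / 3 * (2 * H + L) / (β / u * N) ≤ 128 / 45 * ((2 * H + L) * u / n) / β := by
      rw [show 8 / 3 * (2 * H + L) / (β / u * N) = 8 / 3 * ((2 * H + L) * u) / β / N by
        field_simp]
      rw [show 128 / 45 * ((2 * H + L) * u / n) / β = 8 / 3 * ((2 * H + L) * u) / β
        / (15 / 16 * n) by field_simp; ring]
      exact div_le_div_of_nonneg_left (by positivity) (by positivity) hNn
    have e4 : 1 + β * K ≤ 9 / 8 * (β * K) := by nlinarith
    have e5 : ∫ w, invWeight δ 0 f h w ∂PW ≤ 9 / 8 * (β * K) *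
        (4 * K + 128 / 45 * ((2 * H + L) * u / n) / β) := by
      refine hmain.trans (mul_le_mul e4 (by linarith) ?_ (by positivity))
      have : 0 ≤ 8 / 3 * (2 * H + L) / (β / u * N) := by positivity
      positivity
    have e6 : 9 / 8 * (β * K) * (4 * K + 128 / 45 * ((2 * H + L) * u / n) / β)
        = 9 / 2 * β * K ^ 2 + 16 / 5 * K * (2 * (H * u / n) + L * u / n) := by
      field_simp
      ring
    have e7 : 16 / 5 * K * (2 * (H * u / n) + L * u / n)
        ≤ 8 / 5 * K ^ 2 * (2 * (H * u / n) + L * u / n) := by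
      have : 0 ≤ 2 * (H * u / n) + L * u / n := by positivity
      have : 16 / 5 * (K : ℝ) ≤ 8 / 5 * K ^ 2 := by nlinarith
      gcongr
    -- The deviation contributes a term linear in L/n. It is at most 5/8 of √(L/n) in the first
    -- case; in the second the trivial bound K u is below K² u √(L/n), as K ≥ 2.
    rcases le_or_gt (√(L / n)) (5 / 8) with hs | hs
    · have hsq : L / n ≤ 5 / 8 * √(L / n) := by
        calc L / n = √(L / n) * √(L / n) := (Real.mul_self_sqrt (by positivity)).symm
          _ ≤ _ := by gcongr
      have h8 : L * u / n ≤ 5 / 8 * (u * √(L / n)) := by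
        calc L * u / n = u * (L / n) := by ring
          _ ≤ u * (5 / 8 * √(L / n)) := by gcongr
          _ = _ := by ring
      calc ∫ w, invWeight δ 0 f h w ∂PW
          ≤ 9 / 2 * β * K ^ 2 + 8 / 5 * K ^ 2 * (2 * (H * u / n) + L * u / n) := by linarith
        _ ≤ 9 / 2 * β * K ^ 2 + 8 / 5 * K ^ 2 * (2 * (4 * √c) + 5 / 8 * (u * √(L / n))) := by
            gcongr
        _ ≤ _ := by
            have h10 : 9 / 2 * β * K ^ 2 + 8 / 5 * K ^ 2 * (2 * (4 * √c) + 5 / 8 * (u * √(L / n)))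
                = K ^ 2 * (18 + 154 / 5 * √c + u * √(L / n)) := by rw [hβ]; ring
            rw [h10]
            gcongr
            norm_num
    · refine (htriv f hf h hh).trans ?_
      have h9 : u * (1 / 2) ≤ u * √(L / n) := by gcongr; linarith
      calc (K : ℝ) * u = K * (2 * (u * (1 / 2))) := by ring
        _ ≤ K * (K * (18 + 31 * √c + u * √(L / n))) := by
            refine mul_le_mul_of_nonneg_left ?_ (by positivity)
            exact mul_le_mul hK2 (by linarith) (by positivity) (by positivity)
        _ = _ := by ring

end UniformWeights

/-! ### Truncated importance weighted losses: size, variance and bias -/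

/-- The importance weighted loss, truncated where the importance weight exceeds `b`. -/
noncomputable def truncLoss {d K : ℕ} (b : ℝ) (g h : ActionFn d K) (a : Fin K) (y : ℝ)
    (w : Context d) : ℝ :=
  (if 1 / (K : ℝ) / g a w ≤ b then 1 / (K : ℝ) / g a w else 0) * h a w * (1 - y)

/-- The mean inverse propensity weight of `f` under the design `g`. -/
noncomputable def weightMean {d K : ℕ} (PW : Measure (Context d)) (f g : ActionFn d K) : ℝ :=
  ∫ w, ∑ a, f a w / g a w ∂PW

/-- A policy under which the importance weights of the uniform design are at most `u`. -/
structure IsDesign {d K : ℕ} (u : ℝ) (g : ActionFn d K) : Prop where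
  isPolicy : IsPolicy g
  pos : ∀ a w, 0 < g a w
  weight_le : ∀ a w, 1 / (K : ℝ) / g a w ≤ u

section TruncLoss

variable {d K : ℕ} {PW : Measure (Context d)} {η g f h h' : ActionFn d K} {b b' u r : ℝ}

theorem truncWeight_nonneg (hg : IsDesign u g) (b : ℝ) (a : Fin K) (w : Context d) :
    0 ≤ if 1 / (K : ℝ) / g a w ≤ b then 1 / (K : ℝ) / g a w else 0 := by
  have := (hg.pos a w).le
  split_ifs <;> positivity

/-- The number b' bounds every weight that is at most both u and b. Keeping it abstract covers b' =
u for integrability and b' = min b u in the chain. -/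
theorem truncWeight_le (hg : IsDesign u g) (hb' : ∀ x : ℝ, 0 ≤ x → x ≤ u → x ≤ b → x ≤ b')
    (hb0 : 0 ≤ b') (a : Fin K) (w : Context d) :
    (if 1 / (K : ℝ) / g a w ≤ b then 1 / (K : ℝ) / g a w else 0) ≤ b' := by
  have := (hg.pos a w).le
  split_ifs with h
  · exact hb' _ (by positivity) (hg.weight_le a w) h
  · exact hb0

theorem abs_truncLoss_le (hg : IsDesign u g) (hb' : ∀ x : ℝ, 0 ≤ x → x ≤ u → x ≤ b → x ≤ b')
    (hb0 : 0 ≤ b') (hr : ∀ a w, |h a w| ≤ r) (a : Fin K) (y : ℝ) (w : Context d)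
    (hy : y = 0 ∨ y = 1) : |truncLoss b g h a y w| ≤ b' * r := by
  have h0 := truncWeight_nonneg hg b a w
  have hr0 : 0 ≤ r := (abs_nonneg _).trans (hr a w)
  unfold truncLoss
  rw [abs_mul, abs_mul, abs_of_nonneg h0]
  have hy1 : |1 - y| ≤ 1 := by rcases hy with h | h <;> simp [h]
  calc _ ≤ b' * r * 1 := mul_le_mul (mul_le_mul (truncWeight_le hg hb' hb0 a w) (hr a w)
        (abs_nonneg _) hb0) hy1 (abs_nonneg _) (mul_nonneg hb0 hr0)
    _ = b' * r := mul_one _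

theorem measurable_truncLoss {α : Type*} [MeasurableSpace α] {G : α → ActionFn d K}
    {h : ActionFn d K} {V : α → Context d} {a : Fin K} (hG : Measurable fun z => G z a (V z))
    (hV : Measurable V) (hh : Measurable (h a)) (y : ℝ) :
    Measurable fun z => truncLoss b (G z) h a y (V z) := by
  have h1 : Measurable fun z => 1 / (K : ℝ) / G z a (V z) := measurable_const.div hG
  exact ((Measurable.ite (measurableSet_le h1 measurable_const) h1 measurable_const).mul
    (hh.comp hV)).mul_const _

theorem measurable_truncLoss_apply (hg : IsPolicy g) {a : Fin K} (hh : Measurable (h a)) (y : ℝ) :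
    Measurable (truncLoss b g h a y) :=
  measurable_truncLoss (G := fun _ => g) (V := id) (hg.measurable a) measurable_id hh y

theorem measurable_weight (hf : ∀ a, Measurable (f a)) (hg : ∀ a, Measurable (g a)) :
    Measurable fun w => ∑ a, f a w / g a w :=
  Finset.measurable_sum _ fun a _ => (hf a).div (hg a)

theorem IsDesign.inv_le (hK : 0 < K) (hg : IsDesign u g) (a : Fin K) (w : Context d) :
    (g a w)⁻¹ ≤ K * u := by
  have h1 := hg.weight_le a w
  have hK' : (0 : ℝ) < K := by exact_mod_cast hK
  calc (g a w)⁻¹ = K * (1 / (K : ℝ) / g a w) := by field_simp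
    _ ≤ K * u := by gcongr

theorem integrable_weight [IsFiniteMeasure PW] (hK : 0 < K) (hg : IsDesign u g)
    (hf : IsSubPolicy f) : Integrable (fun w => ∑ a, f a w / g a w) PW := by
  refine integrable_of_bounds (measurable_weight hf.measurable hg.isPolicy.measurable)
    (C := K * u) (fun w => Finset.sum_nonneg fun a _ => div_nonneg (hf.nonneg a w)
      (hg.pos a w).le) fun w => ?_
  have hKu : 0 ≤ K * u := (inv_nonneg.2 (hg.pos ⟨0, hK⟩ w).le).trans (hg.inv_le hK ⟨0, hK⟩ w)
  calc ∑ a, f a w / g a w ≤ ∑ a, f a w * (K * u) := Finset.sum_le_sum fun a _ => by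
        rw [div_eq_mul_inv]
        exact mul_le_mul_of_nonneg_left (hg.inv_le hK a w) (hf.nonneg a w)
    _ = (∑ a, f a w) * (K * u) := by rw [Finset.sum_mul]
    _ ≤ 1 * (K * u) := mul_le_mul_of_nonneg_right (hf.sum_le_one w) hKu
    _ = K * u := one_mul _

theorem obsMean_truncLoss_sub [IsFiniteMeasure PW] (hη : ∀ a, Measurable (η a))
    (hη01 : ∀ a w, 0 ≤ η a w ∧ η a w ≤ 1) (hg : IsDesign u g) (hh : IsSubPolicy h)
    (hh' : IsSubPolicy h') (hu : 0 ≤ u) :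
    obsMean PW η g (truncLoss b g (fun a w => h a w - h' a w))
      = obsMean PW η g (truncLoss b g h) - obsMean PW η g (truncLoss b g h') := by
  have hi : ∀ {h : ActionFn d K}, IsSubPolicy h → Integrable (fun w => ∑ a, g a w *
      (η a w * truncLoss b g h a 1 w + (1 - η a w) * truncLoss b g h a 0 w)) PW := fun hh =>
    integrable_obsMean hη hη01 hg.isPolicy
      (fun a y => measurable_truncLoss_apply hg.isPolicy (hh.measurable a) y)
      (abs_truncLoss_le (b' := u) hg (fun x _ hx _ => hx) hu (r := 1) fun a w => by
        rw [abs_of_nonneg (hh.nonneg a w)]; exact hh.le_one a w)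
  unfold obsMean
  rw [← integral_sub (hi hh) (hi hh')]
  congr 1
  funext w
  rw [← Finset.sum_sub_distrib]
  exact Finset.sum_congr rfl fun a _ => by unfold truncLoss; ring

/-- In h² one factor is bounded by the radius r and the other by f. Hence the variance is small with
r, yet is controlled by the inverse propensity weight of f itself; no bound on the total weight Σ_a
1/g is needed. -/
theorem obsMean_truncLoss_sq_le [IsFiniteMeasure PW] (hK : 0 < K) (hη : ∀ a, Measurable (η a))
    (hη01 : ∀ a w, 0 ≤ η a w ∧ η a w ≤ 1) (hg : IsDesign u g) (hu : 0 ≤ u)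
    (hhm : ∀ a, Measurable (h a)) (hf : IsSubPolicy f) (hhf : ∀ a w, |h a w| ≤ f a w)
    (hr : ∀ a w, |h a w| ≤ r) :
    obsMean PW η g (fun a y w => truncLoss b g h a y w ^ 2)
      ≤ r / (K : ℝ) ^ 2 * weightMean PW f g := by
  unfold obsMean weightMean
  rw [← integral_const_mul]
  refine integral_mono (integrable_obsMean (φ := fun a y w => truncLoss b g h a y w ^ 2)
    (C := (u * r) ^ 2) hη hη01 hg.isPolicy
    (fun a y => (measurable_truncLoss_apply hg.isPolicy (hhm a) y).pow_const 2) ?_)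
    ((integrable_weight hK hg hf).const_mul _) fun w => ?_
  · intro a y w hy
    rw [abs_pow]
    exact pow_le_pow_left₀ (abs_nonneg _)
      (abs_truncLoss_le (b' := u) hg (fun x _ hx _ => hx) hu hr a y w hy) 2
  · change ∑ a, g a w * (η a w * truncLoss b g h a 1 w ^ 2
      + (1 - η a w) * truncLoss b g h a 0 w ^ 2) ≤ r / (K : ℝ) ^ 2 * ∑ a, f a w / g a w
    rw [Finset.mul_sum]
    refine Finset.sum_le_sum fun a _ => ?_
    have hgp := hg.pos a w
    have hK' : (0 : ℝ) < K := by exact_mod_cast hK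
    have e1 : truncLoss b g h a 1 w = 0 := by simp [truncLoss]
    have e2 : truncLoss b g h a 0 w ^ 2 ≤ (1 / (K : ℝ) / g a w) ^ 2 * (r * f a w) := by
      have h0 := truncWeight_nonneg hg b a w
      have h1 : (if 1 / (K : ℝ) / g a w ≤ b then 1 / (K : ℝ) / g a w else 0)
          ≤ 1 / (K : ℝ) / g a w := by
        split_ifs
        · exact le_rfl
        · positivity
      unfold truncLoss
      rw [sub_zero, mul_one, mul_pow]
      refine mul_le_mul (pow_le_pow_left₀ h0 h1 2) ?_ (sq_nonneg _) (sq_nonneg _)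
      rw [← sq_abs, sq]
      exact mul_le_mul (hr a w) (hhf a w) (abs_nonneg _) ((abs_nonneg _).trans (hr a w))
    have e3 : 0 ≤ truncLoss b g h a 0 w ^ 2 := sq_nonneg _
    rw [e1]
    calc g a w * (η a w * 0 ^ 2 + (1 - η a w) * truncLoss b g h a 0 w ^ 2)
        ≤ g a w * ((1 / (K : ℝ) / g a w) ^ 2 * (r * f a w)) := by
          refine mul_le_mul_of_nonneg_left ?_ hgp.le
          nlinarith [(hη01 a w).1, (hη01 a w).2]
      _ = r / (K : ℝ) ^ 2 * (f a w / g a w) := by field_simp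

theorem integrable_risk [IsFiniteMeasure PW] (hη : ∀ a, Measurable (η a))
    (hη01 : ∀ a w, 0 ≤ η a w ∧ η a w ≤ 1) (hf : IsSubPolicy f) :
    Integrable (fun w => ∑ a, (1 / (K : ℝ)) * (f a w * (1 - η a w))) PW := by
  refine integrable_of_bounds (Finset.measurable_sum _ fun a _ =>
    ((hf.measurable a).mul (measurable_const.sub (hη a))).const_mul _) (C := 1 / (K : ℝ))
    (fun w => Finset.sum_nonneg fun a _ => mul_nonneg (by positivity)
      (mul_nonneg (hf.nonneg a w) (sub_nonneg.2 (hη01 a w).2))) fun w => ?_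
  rw [← Finset.mul_sum]
  refine mul_le_of_le_one_right (by positivity) (le_trans ?_ (hf.sum_le_one w))
  refine Finset.sum_le_sum fun a _ => mul_le_of_le_one_right (hf.nonneg a w) ?_
  linarith [(hη01 a w).1]

/-- The bias of the truncated importance weighted loss. -/
theorem risk_le_obsMean_truncLoss_add [IsFiniteMeasure PW] (hK : 0 < K)
    (hη : ∀ a, Measurable (η a))
    (hη01 : ∀ a w, 0 ≤ η a w ∧ η a w ≤ 1) (hg : IsDesign u g) (hu : 0 ≤ u) (hb : 0 < b)
    (hh : IsSubPolicy h) (hf : IsSubPolicy f) (hhf : ∀ a w, h a w ≤ f a w) :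
    risk PW η h ≤ obsMean PW η g (truncLoss b g h)
      + 1 / ((K : ℝ) ^ 2 * b) * weightMean PW f g := by
  unfold risk obsMean weightMean
  have hi := integrable_obsMean (PW := PW) hη hη01 hg.isPolicy
      (fun a y => measurable_truncLoss_apply (b := b) hg.isPolicy (hh.measurable a) y)
      (abs_truncLoss_le (b' := u) hg (fun x _ hx _ => hx) hu (r := 1) fun a w => by
        rw [abs_of_nonneg (hh.nonneg a w)]; exact hh.le_one a w)
  have hw := (integrable_weight (PW := PW) hK hg hf).const_mul (1 / ((K : ℝ) ^ 2 * b))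
  rw [← integral_const_mul, ← integral_add hi hw]
  refine integral_mono (integrable_risk hη hη01 hh) (hi.add hw) fun w => ?_
  change ∑ a, (1 / (K : ℝ)) * (h a w * (1 - η a w)) ≤ ∑ a, g a w *
      (η a w * truncLoss b g h a 1 w + (1 - η a w) * truncLoss b g h a 0 w)
      + 1 / ((K : ℝ) ^ 2 * b) * ∑ a, f a w / g a w
  rw [Finset.mul_sum, ← Finset.sum_add_distrib]
  refine Finset.sum_le_sum fun a _ => ?_
  have hgp := hg.pos a w
  have hK' : (0 : ℝ) < K := by exact_mod_cast hK
  have h1 := hh.nonneg a w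
  have h2 := hf.nonneg a w
  have h3 := hη01 a w
  unfold truncLoss
  by_cases hG : 1 / (K : ℝ) / g a w ≤ b
  · rw [if_pos hG]
    have : 0 ≤ 1 / ((K : ℝ) ^ 2 * b) * (f a w / g a w) := by positivity
    have e : g a w * (η a w * (1 / (K : ℝ) / g a w * h a w * (1 - 1))
        + (1 - η a w) * (1 / (K : ℝ) / g a w * h a w * (1 - 0)))
        = (1 / (K : ℝ)) * (h a w * (1 - η a w)) := by field_simp; ring
    rw [e]
    linarith
  -- Where the loss is discarded the weight exceeds b, so 1 is at most weight/b; this turns the bias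
  -- into the inverse propensity weight divided by b.
  · rw [if_neg hG]
    push Not at hG
    have h4 : 1 ≤ 1 / (K : ℝ) / g a w / b := (one_le_div hb).2 hG.le
    calc (1 / (K : ℝ)) * (h a w * (1 - η a w)) ≤ (1 / (K : ℝ)) * (f a w * 1) := by
          refine mul_le_mul_of_nonneg_left ?_ (by positivity)
          exact mul_le_mul (hhf a w) (by linarith) (by linarith) h2
      _ ≤ (1 / (K : ℝ)) * (f a w * 1) * (1 / (K : ℝ) / g a w / b) :=
          le_mul_of_one_le_right (by positivity) h4
      _ = _ := by field_simp; ring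

theorem risk_le_add_of_le [IsProbabilityMeasure PW] (hK : 0 < K) (hη : ∀ a, Measurable (η a))
    (hη01 : ∀ a w, 0 ≤ η a w ∧ η a w ≤ 1) (hh : IsSubPolicy h) (hf : IsSubPolicy f)
    (hr : ∀ a w, f a w ≤ h a w + r) (hr0 : 0 ≤ r) : risk PW η f ≤ risk PW η h + r := by
  unfold risk
  have hi := integrable_risk (PW := PW) hη hη01 hh
  have : ∫ w, ((∑ a, (1 / (K : ℝ)) * (h a w * (1 - η a w))) + r) ∂PW
      = ∫ w, (∑ a, (1 / (K : ℝ)) * (h a w * (1 - η a w))) ∂PW + r := by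
    rw [integral_add hi (integrable_const _)]; simp
  rw [← this]
  refine integral_mono (integrable_risk hη hη01 hf) (hi.add (integrable_const _)) fun w => ?_
  have hK' : (0 : ℝ) < K := by exact_mod_cast hK
  calc ∑ a, (1 / (K : ℝ)) * (f a w * (1 - η a w))
      ≤ ∑ a, ((1 / (K : ℝ)) * (h a w * (1 - η a w)) + (1 / (K : ℝ)) * r) := by
        refine Finset.sum_le_sum fun a _ => ?_
        rw [← mul_add]
        refine mul_le_mul_of_nonneg_left ?_ (by positivity)
        nlinarith [hr a w, hη01 a w, (hη01 a w).1, (hη01 a w).2]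
    _ = _ := by
        rw [Finset.sum_add_distrib]
        congr 1
        simp
        field_simp

end TruncLoss

/-! ### Bernstein's inequality for one link -/

section Links

variable {d K : ℕ} {Ω : Type*} {W : ℕ → Ω → Context d} {A : ℕ → Ω → Fin K} {Y : ℕ → Ω → ℝ}
  [mΩ : MeasurableSpace Ω] {μ : Measure Ω} {PW : Measure (Context d)}
  {η : ActionFn d K} {g : ℕ → Ω → ActionFn d K}

/-- The compensated sum of the truncated losses of `h`. -/
noncomputable def truncDev (PW : Measure (Context d)) (η : ActionFn d K) (g : ℕ → Ω → ActionFn d K)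
    (W : ℕ → Ω → Context d) (A : ℕ → Ω → Fin K) (Y : ℕ → Ω → ℝ) (b : ℝ) (n : ℕ)
    (h : ActionFn d K) (ω : Ω) : ℝ :=
  ∑ t ∈ Finset.Icc 1 n, (obsMean PW η (g t ω) (truncLoss b (g t ω) h)
    - truncLoss b (g t ω) h (A t ω) (Y t ω) (W t ω))

/-- The exceptional set depends only on the link h, while the variance hypothesis is imposed
afterwards on any f that dominates |h|. Thus a union bound over finitely many links controls all of
F. -/
theorem IsBandit.link [IsProbabilityMeasure μ] [IsProbabilityMeasure PW]
    (hB : IsBandit μ PW η g W A Y)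
    (hη : ∀ a, Measurable (η a)) (hη01 : ∀ a w, 0 ≤ η a w ∧ η a w ≤ 1)
    (hg : ∀ t, 1 ≤ t → ∀ a, Measurable[(history W A Y (t - 1)).prod inferInstance]
      (fun z : Ω × Context d => g t z.1 a z.2))
    (hgp : ∀ t, 1 ≤ t → ∀ᵐ ω ∂μ, IsPolicy (g t ω)) (hK : 0 < K) {n : ℕ} (hn : 1 ≤ n)
    {u b b' v r s : ℝ} (hu : 0 ≤ u) (hb0 : 0 < b')
    (hb' : ∀ x : ℝ, 0 ≤ x → x ≤ u → x ≤ b → x ≤ b')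
    (hgd : ∀ᵐ ω ∂μ, ∀ t, 1 ≤ t → t ≤ n → IsDesign u (g t ω)) (hv : 0 < v) (hr0 : 0 < r)
    (hs : 0 < s) {h : ActionFn d K} (hh : ∀ a, Measurable (h a)) (hr : ∀ a w, |h a w| ≤ r) :
    ∃ bad : Set Ω, μ bad ≤ ENNReal.ofReal (Real.exp (-s)) ∧ ∀ ω ∉ bad, ∀ f, IsSubPolicy f →
      (∀ a w, |h a w| ≤ f a w) →
      ∑ t ∈ Finset.Icc 1 n, weightMean PW f (g t ω) ≤ n * (K ^ 2 * v) →
      truncDev PW η g W A Y b n h ω ≤ 2 * √(n * r * v * s) + s * r * b' := by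
  have hn0 : (0 : ℝ) < n := by exact_mod_cast hn
  have hK0 : (0 : ℝ) < K := by exact_mod_cast hK
  -- The choice l = 1/(r b' + z) satisfies l·(r b') ≤ 1, as the quadratic bound on exp requires. It
  -- makes the variance term at most s z and s/l = s r b' + s z, where s z = √(n r v s).
  set z := √(n * r * v / s) with hz
  have hz0 : 0 < z := Real.sqrt_pos.2 (by positivity)
  set l := 1 / (r * b' + z) with hl
  have hl0 : 0 < l := by positivity
  have hlrb : l * (b' * r) ≤ 1 := by
    rw [hl, one_div, inv_mul_le_iff₀ (by positivity)]
    linarith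
  have hsub : ∀ t, 1 ≤ t → t ≤ n → ∀ᵐ ω ∂μ, IsDesign u (g t ω) := fun t h1 h2 => by
    filter_upwards [hgd] with ω hω using hω t h1 h2
  have hb := hB.bernstein hη hη01 hg hgp n
    (φ := fun t ω => truncLoss b (g t ω) h)
    (fun t ht a y => @measurable_truncLoss _ _ _ _ ((history W A Y (t - 1)).prod inferInstance)
      (fun z => g t z.1) h (fun z => z.2) a (hg t ht a)
      (@measurable_snd Ω (Context d) (history W A Y (t - 1)) _) (hh a) y)
    (C := b' * r) (l := l) (κ := 1) hl0
    (fun t h1 h2 => by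
      filter_upwards [hsub t h1 h2] with ω hω a y w hy
      exact abs_truncLoss_le hω hb' hb0.le hr a y w hy)
    (fun t h1 h2 => by
      filter_upwards [hsub t h1 h2] with ω hω a y w hy
      have h3 := abs_truncLoss_le hω hb' hb0.le hr a y w hy
      have h4 : |-(l * truncLoss b (g t ω) h a y w)| ≤ 1 := by
        rw [abs_neg, abs_mul, abs_of_pos hl0]
        exact (mul_le_mul_of_nonneg_left h3 hl0.le).trans hlrb
      have h5 := (abs_le.1 (Real.abs_exp_sub_one_sub_id_le h4)).2
      nlinarith) s
  obtain ⟨N, hN1, hN2⟩ : ∃ N : Set Ω, μ N = 0 ∧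
      ∀ ω ∉ N, ∀ t, 1 ≤ t → t ≤ n → IsDesign u (g t ω) :=
    ⟨_, ae_iff.1 hgd, fun ω hω => not_not.1 hω⟩
  have hle := (measure_union_le _ N).trans (add_le_add hb hN1.le)
  refine ⟨_, hle.trans_eq (add_zero _), ?_⟩
  intro ω hω f hf hhf hw
  rw [Set.mem_union, not_or] at hω
  have h1 := hω.1
  rw [Set.mem_ofPred_eq, not_lt] at h1
  have hdes := hN2 ω hω.2
  refine h1.trans ?_
  have h2 : ∑ t ∈ Finset.Icc 1 n,
      obsMean PW η (g t ω) (fun a y w => truncLoss b (g t ω) h a y w ^ 2) ≤ n * (r * v) := by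
    calc _ ≤ ∑ t ∈ Finset.Icc 1 n, r / (K : ℝ) ^ 2 * weightMean PW f (g t ω) :=
          Finset.sum_le_sum fun t ht => by
            obtain ⟨ht1, ht2⟩ := Finset.mem_Icc.1 ht
            exact obsMean_truncLoss_sq_le hK hη hη01 (hdes t ht1 ht2) hu hh hf hhf hr
      _ = r / (K : ℝ) ^ 2 * ∑ t ∈ Finset.Icc 1 n, weightMean PW f (g t ω) := by
          rw [Finset.mul_sum]
      _ ≤ r / (K : ℝ) ^ 2 * (n * (K ^ 2 * v)) := by gcongr
      _ = _ := by field_simp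
  have hzs : s * z = √(n * r * v * s) := by
    rw [hz, show (n : ℝ) * r * v * s = s ^ 2 * (n * r * v / s) by field_simp,
      Real.sqrt_mul (sq_nonneg s), Real.sqrt_sq hs.le]
  have h3 : l * (n * (r * v)) ≤ s * z := by
    have hz2 : z * z = n * r * v / s := Real.mul_self_sqrt (by positivity)
    have : (n : ℝ) * (r * v) = s * z * z := by
      rw [mul_assoc, hz2]; field_simp
    rw [this, hl, one_div, inv_mul_le_iff₀ (by positivity)]
    have : 0 ≤ s * z * (r * b') := by positivity
    nlinarith
  have h4 : s / l = s * r * b' + s * z := by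
    rw [hl]; field_simp
  calc 1 * l * ∑ t ∈ Finset.Icc 1 n,
      obsMean PW η (g t ω) (fun a y w => truncLoss b (g t ω) h a y w ^ 2) + s / l
      ≤ 1 * l * (n * (r * v)) + s / l := by gcongr
    _ ≤ _ := by rw [h4, ← hzs]; linarith

end Links

/-! ### Chaining from below, and deviations for a single policy and for the rewards -/

/-- The deviation level of the `i`-th of the links `0, …, J` of a chain of radii `r₀ 4^i`. -/
noncomputable def chainLevel (c p r₀ L : ℝ) (J i : ℕ) : ℝ :=
  2 * (c * (4 / (r₀ * 4 ^ i)) ^ p) + (((J - i : ℕ) : ℝ) + 1) * L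

/-- The uniform bound of the `i`-th link of a chain of radii `r₀ 4^i`. -/
noncomputable def chainWidth (r₀ : ℝ) (i : ℕ) : ℝ := 4 * (r₀ * 4 ^ i)

/-- The coarsest link i = J receives confidence L and each finer link L more, so the failure
probabilities are dominated by a geometric series of ratio 1/2. -/
theorem sum_exp_neg_levels_le {L : ℝ} (hL : Real.exp (-L) ≤ 1 / 2) (J : ℕ) :
    ∑ i ∈ Finset.range (J + 1), Real.exp (-((((J - i : ℕ) : ℝ) + 1) * L))
      ≤ 2 * Real.exp (-L) := by
  have h1 : ∀ k : ℕ, Real.exp (-(((k : ℝ) + 1) * L)) ≤ Real.exp (-L) * (1 / 2) ^ k := by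
    intro k
    have : Real.exp (-(((k : ℝ) + 1) * L)) = Real.exp (-L) * Real.exp (-L) ^ k := by
      rw [← Real.exp_nat_mul, ← Real.exp_add]; ring_nf
    rw [this]
    gcongr
  rw [← Finset.sum_range_reflect]
  calc ∑ i ∈ Finset.range (J + 1), Real.exp (-((((J - (J + 1 - 1 - i) : ℕ) : ℝ) + 1) * L))
      ≤ ∑ k ∈ Finset.range (J + 1), Real.exp (-L) * (1 / 2) ^ k := by
        refine Finset.sum_le_sum fun i hi => ?_
        have : J - (J + 1 - 1 - i) = i := by
          have := Finset.mem_range.1 hi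
          omega
        rw [this]
        exact h1 i
    _ = Real.exp (-L) * ∑ k ∈ Finset.range (J + 1), (1 / 2 : ℝ) ^ k := by rw [Finset.mul_sum]
    _ ≤ Real.exp (-L) * 2 := by
        gcongr
        exact sum_geometric_two_le _
    _ = _ := mul_comm _ _

section Chain

variable {d K : ℕ} {Ω : Type*} {W : ℕ → Ω → Context d} {A : ℕ → Ω → Fin K} {Y : ℕ → Ω → ℝ}
  {PW : Measure (Context d)} {η : ActionFn d K} {g : ℕ → Ω → ActionFn d K}

theorem truncDev_sub [IsFiniteMeasure PW] (hη : ∀ a, Measurable (η a))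
    (hη01 : ∀ a w, 0 ≤ η a w ∧ η a w ≤ 1) {u b : ℝ} (hu : 0 ≤ u) {n : ℕ} {ω : Ω}
    (hd : ∀ t, 1 ≤ t → t ≤ n → IsDesign u (g t ω)) {h h' : ActionFn d K} (hh : IsSubPolicy h)
    (hh' : IsSubPolicy h') :
    truncDev PW η g W A Y b n (fun a w => h a w - h' a w) ω
      = truncDev PW η g W A Y b n h ω - truncDev PW η g W A Y b n h' ω := by
  unfold truncDev
  rw [← Finset.sum_sub_distrib]
  refine Finset.sum_congr rfl fun t ht => ?_
  obtain ⟨h1, h2⟩ := Finset.mem_Icc.1 ht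
  rw [obsMean_truncLoss_sub hη hη01 (hd t h1 h2) hh hh' hu]
  unfold truncLoss
  ring

theorem isSubPolicy_zero : IsSubPolicy (fun _ _ => 0 : ActionFn d K) :=
  ⟨fun _ => measurable_const, fun _ _ => le_rfl, fun _ => by simp⟩

theorem truncDev_zero (b : ℝ) (n : ℕ) (ω : Ω) :
    truncDev PW η g W A Y b n (fun _ _ => 0) ω = 0 := by
  simp [truncDev, truncLoss, obsMean]

variable [mΩ : MeasurableSpace Ω] {μ : Measure Ω} {F : Set (ActionFn d K)} {c p : ℝ}

/-- Truncation and approximation from below can only decrease an observed loss. This monotonicity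
suffices for the one-sided bound and avoids any control of the discarded large weights along the
sample. -/
theorem truncLoss_le_isLoss {u b y : ℝ} {gω h f : ActionFn d K} (hg : IsDesign u gω)
    (hf : ∀ a w, 0 ≤ f a w) (hhf : ∀ a w, h a w ≤ f a w) (hy : y = 0 ∨ y = 1) (a : Fin K)
    (w : Context d) : truncLoss b gω h a y w ≤ isLoss gω f w a y := by
  have hgp := hg.pos a w
  have hy1 : 0 ≤ 1 - y := by rcases hy with h | h <;> simp [h]
  have hfa := hf a w
  unfold truncLoss isLoss
  split_ifs with hG
  · have := hhf a w
    gcongr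
  · have : 0 ≤ 1 / (K : ℝ) / gω a w * f a w * (1 - y) := by positivity
    simpa using this

/-- A lower deviation bound for the importance weighted empirical risk, uniform over `F`. -/
theorem IsBandit.chaining [IsProbabilityMeasure μ] [IsProbabilityMeasure PW]
    (hB : IsBandit μ PW η g W A Y)
    (hη : ∀ a, Measurable (η a)) (hη01 : ∀ a w, 0 ≤ η a w ∧ η a w ≤ 1)
    (hg : ∀ t, 1 ≤ t → ∀ a, Measurable[(history W A Y (t - 1)).prod inferInstance]
      (fun z : Ω × Context d => g t z.1 a z.2))
    (hgp : ∀ t, 1 ≤ t → ∀ᵐ ω ∂μ, IsPolicy (g t ω)) (hK : 0 < K) (hc : 0 < c) (hp : 0 < p)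
    (hpol : ∀ f ∈ F, IsPolicy f) (hent : EntropyCondition c p F) {n : ℕ} (hn : 1 ≤ n)
    {u b b' v r₀ L : ℝ} (hu : 0 ≤ u) (hb : 0 < b) (hb0 : 0 < b')
    (hb' : ∀ x : ℝ, 0 ≤ x → x ≤ u → x ≤ b → x ≤ b')
    (hgd : ∀ᵐ ω ∂μ, ∀ t, 1 ≤ t → t ≤ n → IsDesign u (g t ω)) (hv : 0 < v) (hr0 : 0 < r₀)
    (hL : Real.exp (-L) ≤ 1 / 2) {J : ℕ} (hJ : 1 ≤ 4 * (r₀ * 4 ^ J)) :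
    ∃ bad : Set Ω, μ bad ≤ ENNReal.ofReal (2 * Real.exp (-L)) ∧ ∀ ω ∉ bad, ∀ f ∈ F,
      ∑ t ∈ Finset.Icc 1 n, weightMean PW f (g t ω) ≤ n * (K ^ 2 * v) →
      n * risk PW η f - ∑ t ∈ Finset.Icc 1 n, isLoss (g t ω) f (W t ω) (A t ω) (Y t ω)
        ≤ n * r₀ + n * v / b + ∑ i ∈ Finset.range (J + 1),
          (2 * √(n * chainWidth r₀ i * v * chainLevel c p r₀ L J i)
            + chainLevel c p r₀ L J i * chainWidth r₀ i * b') := by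
  classical
  have hL0 : 0 < L := by
    by_contra hneg
    have : 1 ≤ Real.exp (-L) := Real.one_le_exp (by linarith)
    linarith
  have hn0 : (0 : ℝ) < n := by exact_mod_cast hn
  have hKr : (0 : ℝ) < K := by exact_mod_cast hK
  have hρ : ∀ i : ℕ, 0 < r₀ * 4 ^ i := fun i => by positivity
  choose T₀ hT₀ hT₀card using fun i => hent.exists_isLowerNet hpol (hρ i)
  -- Past the coarsest level the net is {0}, so every chain ends at the zero function, whose
  -- compensated sum vanishes.
  let T : ℕ → Finset (ActionFn d K) := fun i => if i ≤ J then T₀ i else {fun _ _ => 0}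
  have hTsub : ∀ i, ∀ f ∈ T i, IsSubPolicy f := by
    intro i f hf
    by_cases h : i ≤ J
    · rw [show T i = T₀ i from if_pos h] at hf
      exact (hT₀ i).isSubPolicy f hf
    · rw [show T i = {fun _ _ => 0} from if_neg h, Finset.mem_singleton] at hf
      rw [hf]
      exact isSubPolicy_zero
  let H : ℕ → ℝ := fun i => c * (4 / (r₀ * 4 ^ i)) ^ p
  have hH0 : ∀ i, 0 ≤ H i := fun i => by positivity
  have hHmono : ∀ i, H (i + 1) ≤ H i := by
    intro i
    refine mul_le_mul_of_nonneg_left (Real.rpow_le_rpow (by positivity) ?_ hp.le) hc.le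
    refine div_le_div_of_nonneg_left (by norm_num) (hρ i) ?_
    rw [pow_succ]
    have := hρ i
    nlinarith
  have hcard : ∀ i, i ≤ J → ((T i).card : ℝ) ≤ Real.exp (H i) := by
    intro i h
    rw [show T i = T₀ i from if_pos h]
    exact hT₀card i
  have hcard' : ∀ i, ((T (i + 1)).card : ℝ) ≤ Real.exp (H i) := by
    intro i
    by_cases h : i + 1 ≤ J
    · exact (hcard _ h).trans (Real.exp_le_exp.2 (hHmono i))
    · rw [show T (i + 1) = {fun _ _ => 0} from if_neg h]
      simpa using hH0 i
  let P : ℕ → Finset (ActionFn d K × ActionFn d K) := fun i =>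
    (T i ×ˢ T (i + 1)).filter fun q => ∀ a w, |q.1 a w - q.2 a w| ≤ chainWidth r₀ i
  have hw0 : ∀ i, 0 < chainWidth r₀ i := fun i => by
    have := hρ i
    unfold chainWidth; positivity
  have hs0 : ∀ i, 0 < chainLevel c p r₀ L J i := fun i => by
    have := hρ i
    unfold chainLevel; positivity
  -- The membership is placed inside the existential so that the exceptional sets can be chosen for
  -- all pairs; irrelevant pairs get the empty set.
  have hlink : ∀ (i : ℕ) (q : ActionFn d K × ActionFn d K), ∃ bad : Set Ω, q ∈ P i →
      (μ bad ≤ ENNReal.ofReal (Real.exp (-chainLevel c p r₀ L J i)) ∧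
      ∀ ω ∉ bad, ∀ f, IsSubPolicy f → (∀ a w, |q.1 a w - q.2 a w| ≤ f a w) →
      ∑ t ∈ Finset.Icc 1 n, weightMean PW f (g t ω) ≤ n * (K ^ 2 * v) →
      truncDev PW η g W A Y b n (fun a w => q.1 a w - q.2 a w) ω
        ≤ 2 * √(n * chainWidth r₀ i * v * chainLevel c p r₀ L J i)
          + chainLevel c p r₀ L J i * chainWidth r₀ i * b') := by
    intro i q
    by_cases hq : q ∈ P i
    · obtain ⟨hq1, hq2⟩ := Finset.mem_filter.1 hq
      have h1 := hTsub i _ (Finset.mem_product.1 hq1).1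
      have h2 := hTsub _ _ (Finset.mem_product.1 hq1).2
      obtain ⟨bad, h3⟩ := hB.link hη hη01 hg hgp hK hn hu hb0 hb' hgd hv (hw0 i) (hs0 i)
        (h := fun a w => q.1 a w - q.2 a w)
        (fun a => (h1.measurable a).sub (h2.measurable a)) hq2
      exact ⟨bad, fun _ => h3⟩
    · exact ⟨∅, fun h => absurd h hq⟩
  choose bad hbad using hlink
  obtain ⟨N, hN1, hN2⟩ : ∃ N : Set Ω, μ N = 0 ∧
      ∀ ω ∉ N, ∀ t, 1 ≤ t → t ≤ n → IsDesign u (g t ω) :=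
    ⟨_, ae_iff.1 hgd, fun ω hω => not_not.1 hω⟩
  refine ⟨(⋃ i ∈ Finset.range (J + 1), ⋃ q ∈ P i, bad i q) ∪ N, ?_, ?_⟩
  · have h1 : ∀ i ∈ Finset.range (J + 1), μ (⋃ q ∈ P i, bad i q)
        ≤ ENNReal.ofReal (Real.exp (-((((J - i : ℕ) : ℝ) + 1) * L))) := by
      intro i hi
      have hiJ : i ≤ J := Nat.lt_succ_iff.1 (Finset.mem_range.1 hi)
      refine (measure_biUnion_finset_le _ _).trans
        ((Finset.sum_le_sum fun q hq => (hbad i q hq).1).trans ?_)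
      rw [Finset.sum_const, nsmul_eq_mul, ← ENNReal.ofReal_natCast,
        ← ENNReal.ofReal_mul (Nat.cast_nonneg _)]
      refine ENNReal.ofReal_le_ofReal ?_
      have h2 : ((P i).card : ℝ) ≤ Real.exp (H i) * Real.exp (H i) := by
        calc ((P i).card : ℝ) ≤ ((T i ×ˢ T (i + 1)).card : ℝ) := by
              exact_mod_cast Finset.card_filter_le _ _
          _ = ((T i).card : ℝ) * (T (i + 1)).card := by
              rw [Finset.card_product]; push_cast; ring
          _ ≤ _ := mul_le_mul (hcard i hiJ) (hcard' i) (by positivity) (by positivity)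
      calc ((P i).card : ℝ) * Real.exp (-chainLevel c p r₀ L J i)
          ≤ Real.exp (H i) * Real.exp (H i) * Real.exp (-chainLevel c p r₀ L J i) := by gcongr
        _ = _ := by
            rw [← Real.exp_add, ← Real.exp_add]
            congr 1
            simp only [chainLevel, H]
            ring
    refine (measure_union_le _ _).trans ?_
    rw [hN1, add_zero]
    refine (measure_biUnion_finset_le _ _).trans ((Finset.sum_le_sum h1).trans ?_)
    rw [← ENNReal.ofReal_sum_of_nonneg fun _ _ => (Real.exp_pos _).le]
    exact ENNReal.ofReal_le_ofReal (sum_exp_neg_levels_le hL J)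
  · intro ω hω f hf hwt
    rw [Set.mem_union, not_or] at hω
    have hdes := hN2 ω hω.2
    have hfp := hpol f hf
    choose e₀ he₀T he₀ using fun i => (hT₀ i).approx f hf
    let e : ℕ → ActionFn d K := fun i => if i ≤ J then e₀ i else fun _ _ => 0
    have heT : ∀ i, e i ∈ T i := by
      intro i
      by_cases h : i ≤ J
      · rw [show T i = T₀ i from if_pos h, show e i = e₀ i from if_pos h]; exact he₀T i
      · rw [show T i = {fun _ _ => 0} from if_neg h, show e i = fun _ _ => 0 from if_neg h]
        exact Finset.mem_singleton_self _
    have hes : ∀ i, IsSubPolicy (e i) := fun i => hTsub i _ (heT i)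
    have hele : ∀ i a w, e i a w ≤ f a w := by
      intro i a w
      by_cases h : i ≤ J
      · rw [show e i = e₀ i from if_pos h]; exact (he₀ i a w).1
      · rw [show e i = fun _ _ => 0 from if_neg h]; exact hfp.nonneg a w
    have hege : ∀ i, i ≤ J → ∀ a w, f a w ≤ e i a w + r₀ * 4 ^ i := by
      intro i h a w
      rw [show e i = e₀ i from if_pos h]; exact (he₀ i a w).2
    have hege' : ∀ i a w, f a w ≤ e (i + 1) a w + 4 * (r₀ * 4 ^ i) ∨ J < i := by
      intro i a w
      rcases lt_trichotomy i J with h | h | h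
      · left
        have := hege (i + 1) h a w
        rw [pow_succ] at this
        linarith
      -- At i = J the next element is 0, and f ≤ 1 ≤ 4 r₀ 4^J makes it an admissible approximation.
      · left
        have h1 := hfp.isSubPolicy.le_one a w
        have h2 := (hes (i + 1)).nonneg a w
        rw [h]
        linarith [(hes (J + 1)).nonneg a w]
      · exact Or.inr h
    -- Both functions lie between 0 and f; this ties the variance of every link to the weight of f.
    have hdiff : ∀ i a w, |e i a w - e (i + 1) a w| ≤ f a w := by
      intro i a w
      have h1 := (hes i).nonneg a w
      have h2 := (hes (i + 1)).nonneg a w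
      have h3 := hele i a w
      have h4 := hele (i + 1) a w
      rw [abs_le]; constructor <;> linarith
    have hPmem : ∀ i ∈ Finset.range (J + 1), (e i, e (i + 1)) ∈ P i := by
      intro i hi
      have hiJ : i ≤ J := Nat.lt_succ_iff.1 (Finset.mem_range.1 hi)
      refine Finset.mem_filter.2 ⟨Finset.mk_mem_product (heT i) (heT (i + 1)), fun a w => ?_⟩
      have h1 := hege i hiJ a w
      have h2 := (hege' i a w).resolve_right (by omega)
      have h3 := hele i a w
      have h4 := hele (i + 1) a w
      have h5 := hρ i
      rw [abs_le, chainWidth]; constructor <;> linarith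
    have hsum : truncDev PW η g W A Y b n (e 0) ω ≤ ∑ i ∈ Finset.range (J + 1),
        (2 * √(n * chainWidth r₀ i * v * chainLevel c p r₀ L J i)
            + chainLevel c p r₀ L J i * chainWidth r₀ i * b') := by
      -- Telescoping from the finest approximation e 0 to e (J + 1) = 0.
      have htel : truncDev PW η g W A Y b n (e 0) ω = ∑ i ∈ Finset.range (J + 1),
          truncDev PW η g W A Y b n (fun a w => e i a w - e (i + 1) a w) ω := by
        have hz : e (J + 1) = fun _ _ => 0 := if_neg (by omega)
        rw [Finset.sum_congr rfl fun i _ => truncDev_sub hη hη01 hu hdes (hes i) (hes (i + 1)),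
          Finset.sum_range_sub', hz, truncDev_zero, sub_zero]
      rw [htel]
      refine Finset.sum_le_sum fun i hi => ?_
      refine (hbad i _ (hPmem i hi)).2 ω (fun hmem => hω.1 ?_) f hfp.isSubPolicy (hdiff i) hwt
      exact Set.mem_iUnion₂.2 ⟨i, hi, Set.mem_iUnion₂.2 ⟨_, hPmem i hi, hmem⟩⟩
    have hrisk : risk PW η f ≤ risk PW η (e 0) + r₀ :=
      risk_le_add_of_le hK hη hη01 (hes 0) hfp.isSubPolicy
        (fun a w => by simpa using hege 0 (Nat.zero_le J) a w) hr0.le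
    have hbias : n * risk PW η (e 0) ≤ ∑ t ∈ Finset.Icc 1 n,
        obsMean PW η (g t ω) (truncLoss b (g t ω) (e 0)) + n * v / b := by
      calc n * risk PW η (e 0) = ∑ t ∈ Finset.Icc 1 n, risk PW η (e 0) := by simp
        _ ≤ ∑ t ∈ Finset.Icc 1 n, (obsMean PW η (g t ω) (truncLoss b (g t ω) (e 0))
              + 1 / ((K : ℝ) ^ 2 * b) * weightMean PW f (g t ω)) :=
            Finset.sum_le_sum fun t ht => by
              obtain ⟨ht1, ht2⟩ := Finset.mem_Icc.1 ht
              exact risk_le_obsMean_truncLoss_add hK hη hη01 (hdes t ht1 ht2) hu hb (hes 0)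
                hfp.isSubPolicy (hele 0)
        _ = ∑ t ∈ Finset.Icc 1 n, obsMean PW η (g t ω) (truncLoss b (g t ω) (e 0))
              + 1 / ((K : ℝ) ^ 2 * b) * ∑ t ∈ Finset.Icc 1 n, weightMean PW f (g t ω) := by
            rw [Finset.sum_add_distrib, Finset.mul_sum]
        _ ≤ ∑ t ∈ Finset.Icc 1 n, obsMean PW η (g t ω) (truncLoss b (g t ω) (e 0))
              + 1 / ((K : ℝ) ^ 2 * b) * (n * (K ^ 2 * v)) := by gcongr
        _ = _ := by
            congr 1
            field_simp
    have hloss : ∑ t ∈ Finset.Icc 1 n, truncLoss b (g t ω) (e 0) (A t ω) (Y t ω) (W t ω)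
        ≤ ∑ t ∈ Finset.Icc 1 n, isLoss (g t ω) f (W t ω) (A t ω) (Y t ω) :=
      Finset.sum_le_sum fun t ht => by
        obtain ⟨ht1, ht2⟩ := Finset.mem_Icc.1 ht
        exact truncLoss_le_isLoss (hdes t ht1 ht2) hfp.nonneg (hele 0)
          (hB.binary_Y t ht1 ω) _ _
    have hdev : truncDev PW η g W A Y b n (e 0) ω
        = ∑ t ∈ Finset.Icc 1 n, obsMean PW η (g t ω) (truncLoss b (g t ω) (e 0))
          - ∑ t ∈ Finset.Icc 1 n, truncLoss b (g t ω) (e 0) (A t ω) (Y t ω) (W t ω) := by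
      unfold truncDev
      rw [Finset.sum_sub_distrib]
    have hrisk' := mul_le_mul_of_nonneg_left hrisk hn0.le
    linarith

/-- An upper deviation bound for the importance weighted empirical risk of one policy. -/
theorem IsBandit.upper_deviation [IsProbabilityMeasure μ] [IsProbabilityMeasure PW]
    (hB : IsBandit μ PW η g W A Y)
    (hη : ∀ a, Measurable (η a)) (hη01 : ∀ a w, 0 ≤ η a w ∧ η a w ≤ 1)
    (hg : ∀ t, 1 ≤ t → ∀ a, Measurable[(history W A Y (t - 1)).prod inferInstance]
      (fun z : Ω × Context d => g t z.1 a z.2))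
    (hgp : ∀ t, 1 ≤ t → ∀ᵐ ω ∂μ, IsPolicy (g t ω)) (hK : 0 < K) {n : ℕ} (hn : 1 ≤ n)
    {u v L : ℝ} (hu : 0 < u)
    (hgd : ∀ᵐ ω ∂μ, ∀ t, 1 ≤ t → t ≤ n → IsDesign u (g t ω)) (hv : 0 < v) (hL : 0 < L)
    {f : ActionFn d K} (hf : IsPolicy f) :
    ∃ bad : Set Ω, μ bad ≤ ENNReal.ofReal (Real.exp (-L)) ∧ ∀ ω ∉ bad,
      ∑ t ∈ Finset.Icc 1 n, weightMean PW f (g t ω) ≤ n * (K ^ 2 * v) →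
      ∑ t ∈ Finset.Icc 1 n, isLoss (g t ω) f (W t ω) (A t ω) (Y t ω) - n * risk PW η f
        ≤ 2 * √(n * v * L) + L * u := by
  -- The opposite tail comes from the function -f with radius 1; truncation at u is void because no
  -- weight exceeds u.
  obtain ⟨bad, hbad, hgood⟩ := hB.link hη hη01 hg hgp hK hn hu.le (b := u) (b' := u) hu
    (fun x _ h _ => h) hgd hv zero_lt_one hL (h := fun a w => -f a w)
    (fun a => (hf.measurable a).neg) (fun a w => by
      rw [abs_neg, abs_of_nonneg (hf.nonneg a w)]; exact hf.isSubPolicy.le_one a w)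
  obtain ⟨N, hN1, hN2⟩ : ∃ N : Set Ω, μ N = 0 ∧
      ∀ ω ∉ N, ∀ t, 1 ≤ t → t ≤ n → IsDesign u (g t ω) :=
    ⟨_, ae_iff.1 hgd, fun ω hω => not_not.1 hω⟩
  refine ⟨bad ∪ N, (measure_union_le _ _).trans (by rw [hN1, add_zero]; exact hbad), ?_⟩
  intro ω hω hw
  rw [Set.mem_union, not_or] at hω
  have hdes := hN2 ω hω.2
  have h1 := hgood ω hω.1 f hf.isSubPolicy (fun a w => by
    rw [abs_neg, abs_of_nonneg (hf.nonneg a w)]) hw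
  have h2 : truncDev PW η g W A Y u n (fun a w => -f a w) ω
      = ∑ t ∈ Finset.Icc 1 n, isLoss (g t ω) f (W t ω) (A t ω) (Y t ω) - n * risk PW η f := by
    have : (n : ℝ) * risk PW η f = ∑ t ∈ Finset.Icc 1 n, risk PW η f := by simp
    rw [this, ← Finset.sum_sub_distrib]
    refine Finset.sum_congr rfl fun t ht => ?_
    obtain ⟨ht1, ht2⟩ := Finset.mem_Icc.1 ht
    have hd := hdes t ht1 ht2
    have e1 : ∀ a y w, truncLoss u (g t ω) (fun a w => -f a w) a y w
        = -isLoss (g t ω) f w a y := by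
      intro a y w
      unfold truncLoss isLoss
      rw [if_pos (hd.weight_le a w)]
      ring
    have e2 : obsMean PW η (g t ω) (truncLoss u (g t ω) fun a w => -f a w)
        = -risk PW η f := by
      unfold obsMean risk
      rw [← integral_neg]
      congr 1
      funext w
      rw [← Finset.sum_neg_distrib]
      refine Finset.sum_congr rfl fun a _ => ?_
      have := (hd.pos a w).ne'
      rw [e1, e1]
      unfold isLoss
      field_simp
      ring
    rw [e1, e2]
    ring
  rw [h2] at h1
  simpa using h1

/-- The deviation between the rewards and the values of the designs. -/
theorem IsBandit.reward_deviation [IsProbabilityMeasure μ] [IsProbabilityMeasure PW]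
    (hB : IsBandit μ PW η g W A Y)
    (hη : ∀ a, Measurable (η a)) (hη01 : ∀ a w, 0 ≤ η a w ∧ η a w ≤ 1)
    (hg : ∀ t, 1 ≤ t → ∀ a, Measurable[(history W A Y (t - 1)).prod inferInstance]
      (fun z : Ω × Context d => g t z.1 a z.2))
    (hgp : ∀ t, 1 ≤ t → ∀ᵐ ω ∂μ, IsPolicy (g t ω)) {n : ℕ} (hn : 1 ≤ n) {L : ℝ} (hL : 0 < L) :
    ∃ bad : Set Ω, μ bad ≤ ENNReal.ofReal (Real.exp (-L)) ∧ ∀ ω ∉ bad,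
      ∑ t ∈ Finset.Icc 1 n, (value PW η (g t ω) - Y t ω) ≤ 2 * √(n * L) := by
  have hn0 : (0 : ℝ) < n := by exact_mod_cast hn
  -- With this l both l n and L/l equal √(nL), which gives the constant 3/2.
  set l := √(L / n) with hl
  have hl0 : 0 < l := Real.sqrt_pos.2 (by positivity)
  have hb := hB.bernstein hη hη01 hg hgp n (φ := fun _ _ _ y _ => y)
    (fun t _ _ _ => measurable_const) (C := 1) (l := l) (κ := 1 / 2) hl0
    (fun _ _ _ => Filter.Eventually.of_forall fun ω a y w hy => by
      rcases hy with h | h <;> simp [h])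
    (fun _ _ _ => Filter.Eventually.of_forall fun ω a y w hy => by
      have hy0 : 0 ≤ y := by rcases hy with h | h <;> simp [h]
      have := exp_neg_le_of_nonneg (x := l * y) (by positivity)
      nlinarith) L
  have hall : ∀ᵐ ω ∂μ, ∀ t, 1 ≤ t → IsPolicy (g t ω) := by
    rw [ae_all_iff]
    intro t
    by_cases ht : 1 ≤ t
    · filter_upwards [hgp t ht] with ω h _ using h
    · exact Filter.Eventually.of_forall fun ω h => absurd h ht
  obtain ⟨N, hN1, hN2⟩ : ∃ N : Set Ω, μ N = 0 ∧ ∀ ω ∉ N, ∀ t, 1 ≤ t → IsPolicy (g t ω) :=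
    ⟨_, ae_iff.1 hall, fun ω hω => not_not.1 hω⟩
  have hle := (measure_union_le _ N).trans (add_le_add hb hN1.le)
  refine ⟨_, hle.trans_eq (add_zero _), ?_⟩
  intro ω hω
  rw [Set.mem_union, not_or] at hω
  have h1 := hω.1
  rw [Set.mem_ofPred_eq, not_lt] at h1
  have hpol := hN2 ω hω.2
  have e1 : ∀ t, obsMean PW η (g t ω) (fun _ y _ => y) = value PW η (g t ω) := by
    intro t
    unfold obsMean value
    congr 1
    funext w
    exact Finset.sum_congr rfl fun a _ => by ring
  have e2 : ∀ t ∈ Finset.Icc 1 n, obsMean PW η (g t ω) (fun _ y _ => y ^ 2) ≤ 1 := by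
    intro t ht
    have hp := hpol t (Finset.mem_Icc.1 ht).1
    have hi := integrable_obsMean (PW := PW) (φ := fun _ y _ => y ^ 2) (C := 1) hη hη01 hp
      (fun _ _ => measurable_const) (fun a y w hy => by rcases hy with h | h <;> simp [h])
    calc obsMean PW η (g t ω) (fun _ y _ => y ^ 2) ≤ ∫ _, (1 : ℝ) ∂PW := by
          refine integral_mono hi (integrable_const _) fun w => ?_
          refine (le_abs_self _).trans (hp.abs_sum_le fun a => ?_)
          exact abs_reward_mean_le (hη01 a w) (by norm_num) (by norm_num)
      _ = 1 := by simp
  have e3 : ∑ t ∈ Finset.Icc 1 n, obsMean PW η (g t ω) (fun _ y _ => y ^ 2) ≤ n := by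
    refine (Finset.sum_le_sum e2).trans ?_
    simp
  have hln : l * n = √(n * L) := by
    rw [hl, show (n : ℝ) * L = L / n * n ^ 2 by field_simp, Real.sqrt_mul (by positivity),
      Real.sqrt_sq hn0.le]
  have hLl : L / l = √(n * L) := by
    rw [div_eq_iff hl0.ne', ← hln, mul_right_comm, hl, Real.mul_self_sqrt (by positivity)]
    field_simp
  calc ∑ t ∈ Finset.Icc 1 n, (value PW η (g t ω) - Y t ω)
      = ∑ t ∈ Finset.Icc 1 n, (obsMean PW η (g t ω) (fun _ y _ => y) - Y t ω) :=
        Finset.sum_congr rfl fun t _ => by rw [e1]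
    _ ≤ 1 / 2 * l * ∑ t ∈ Finset.Icc 1 n, obsMean PW η (g t ω) (fun _ y _ => y ^ 2) + L / l := h1
    _ ≤ 1 / 2 * l * n + L / l := by gcongr
    _ = 3 / 2 * √(n * L) := by rw [hLl, mul_assoc, hln]; ring
    _ ≤ _ := by
        have := Real.sqrt_nonneg (n * L)
        linarith

end Chain

/-! ### Summation over the radii of a chain and choice of the truncation level -/

theorem sqrt_add_le_add {x y : ℝ} (hx : 0 ≤ x) (hy : 0 ≤ y) : √(x + y) ≤ √x + √y := by
  refine Real.sqrt_le_iff.2 ⟨by positivity, ?_⟩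
  nlinarith [Real.sq_sqrt hx, Real.sq_sqrt hy, mul_nonneg (Real.sqrt_nonneg x) (Real.sqrt_nonneg y)]

theorem pow_rpow_comm {x : ℝ} (hx : 0 ≤ x) (k : ℕ) (y : ℝ) : (x ^ k) ^ y = (x ^ y) ^ k := by
  rw [← Real.rpow_natCast, ← Real.rpow_mul hx, mul_comm, Real.rpow_mul hx, Real.rpow_natCast]

theorem geom_sum_le_inv {q : ℝ} (hq0 : 0 ≤ q) (hq1 : q < 1) (m : ℕ) :
    ∑ k ∈ Finset.range m, q ^ k ≤ (1 - q)⁻¹ := by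
  rw [← tsum_geometric_of_lt_one hq0 hq1]
  exact (summable_geometric_of_lt_one hq0 hq1).sum_le_tsum _ fun _ _ => pow_nonneg hq0 _

theorem sum_half_pow_mul_le (m : ℕ) :
    ∑ k ∈ Finset.range m, (1 / 2 : ℝ) ^ k * (1 + k / 2) ≤ 3 := by
  have h : ∑ k ∈ Finset.range m, (1 / 2 : ℝ) ^ k * (1 + k / 2) = 3 - (m + 3) * (1 / 2) ^ m := by
    induction m with
    | zero => norm_num
    | succ m ih => rw [Finset.sum_range_succ, ih, pow_succ]; push_cast; ring
  rw [h]
  have : 0 ≤ ((m : ℝ) + 3) * (1 / 2) ^ m := by positivity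
  linarith

theorem sqrt_succ_mul_quarter_pow_le (k : ℕ) :
    √(((k : ℝ) + 1) * (1 / 4) ^ k) ≤ (1 / 2) ^ k * (1 + k / 2) := by
  refine Real.sqrt_le_iff.2 ⟨by positivity, ?_⟩
  rw [mul_pow, ← pow_mul, mul_comm k 2, pow_mul, show ((1 : ℝ) / 2) ^ 2 = 1 / 4 by norm_num,
    mul_comm]
  gcongr
  nlinarith [sq_nonneg (k : ℝ)]

theorem succ_mul_quarter_pow_le (k : ℕ) : ((k : ℝ) + 1) * (1 / 4) ^ k ≤ (1 / 2) ^ k := by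
  have h1 : (k : ℝ) + 1 ≤ 2 ^ k := by
    exact_mod_cast Nat.succ_le_of_lt (Nat.lt_two_pow_self (n := k))
  calc ((k : ℝ) + 1) * (1 / 4) ^ k ≤ 2 ^ k * (1 / 4) ^ k := by gcongr
    _ = (1 / 2) ^ k := by rw [← mul_pow]; norm_num

/-- Sums over a finite chain, counted from its coarse end. -/
theorem sum_chain_reflect_le {a : ℕ → ℝ} {b : ℕ → ℝ} {C : ℝ} {J : ℕ}
    (h : ∀ i, i ≤ J → a i ≤ b (J - i)) (hb : ∑ k ∈ Finset.range (J + 1), b k ≤ C) :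
    ∑ i ∈ Finset.range (J + 1), a i ≤ C := by
  refine le_trans ?_ hb
  rw [← Finset.sum_range_reflect b]
  refine Finset.sum_le_sum fun i hi => ?_
  have : i ≤ J := Nat.lt_succ_iff.1 (Finset.mem_range.1 hi)
  simpa using h i this

theorem chain_radius_le {r₀ : ℝ} {J : ℕ} (hJ : r₀ * 4 ^ J ≤ 1) {i : ℕ}
    (hi : i ≤ J) : r₀ * 4 ^ i ≤ (1 / 4) ^ (J - i) := by
  have h1 : (4 : ℝ) ^ J = 4 ^ i * 4 ^ (J - i) := by rw [← pow_add]; congr 1; omega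
  rw [h1] at hJ
  rw [one_div, inv_pow, ← one_div, le_div_iff₀ (by positivity)]
  linarith

section ChainSum

variable {c p r₀ L n v u b b' Q : ℝ} {J : ℕ}

/-- Width times level splits into an entropy part 8·4^p c ρ^(1-p) and a confidence part 4(J-i+1)ρL,
where ρ = r₀4^i. The entropy parts are summed through Q, using that a sum of squares is at most the
square of the sum. The confidence parts decay geometrically away from the coarse end. In the linear
terms b' is replaced by b in the entropy part, where b is still to be optimised, and by u in the
confidence part. -/
theorem chain_sum_le (hc : 0 < c) (hr0 : 0 < r₀) (hL : 0 ≤ L)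
    (hn : 0 ≤ n) (hv : 0 ≤ v) (hb0 : 0 ≤ b') (hbb : b' ≤ b) (hbu : b' ≤ u)
    (hJ : r₀ * 4 ^ J ≤ 1)
    (hQ : ∑ i ∈ Finset.range (J + 1), √((r₀ * 4 ^ i) ^ (1 - p)) ≤ Q) :
    ∑ i ∈ Finset.range (J + 1), (2 * √(n * chainWidth r₀ i * v * chainLevel c p r₀ L J i)
        + chainLevel c p r₀ L J i * chainWidth r₀ i * b')
      ≤ 2 * √(8 * 4 ^ p * c * n * v) * Q + 12 * √(n * v * L) + 8 * 4 ^ p * c * b * Q ^ 2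
        + 8 * (L * u) := by
  have hρ : ∀ i : ℕ, 0 < r₀ * 4 ^ i := fun i => by positivity
  have hent : ∀ i : ℕ, chainWidth r₀ i * (2 * (c * (4 / (r₀ * 4 ^ i)) ^ p))
      = 8 * 4 ^ p * c * (r₀ * 4 ^ i) ^ (1 - p) := by
    intro i
    rw [chainWidth, Real.div_rpow (by norm_num) (hρ i).le, Real.rpow_sub (hρ i), Real.rpow_one]
    field_simp
    norm_num
  have hlev : ∀ i : ℕ, chainWidth r₀ i * chainLevel c p r₀ L J i
      = 8 * 4 ^ p * c * (r₀ * 4 ^ i) ^ (1 - p)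
        + 4 * ((((J - i : ℕ) : ℝ) + 1) * (r₀ * 4 ^ i)) * L := by
    intro i
    rw [chainLevel, mul_add, hent, chainWidth]
    ring
  have hrat : ∀ i, i ≤ J → (((J - i : ℕ) : ℝ) + 1) * (r₀ * 4 ^ i)
      ≤ (((J - i : ℕ) : ℝ) + 1) * (1 / 4) ^ (J - i) := fun i hi =>
    mul_le_mul_of_nonneg_left (chain_radius_le hJ hi) (by positivity)
  have hS1 : ∑ i ∈ Finset.range (J + 1), √((((J - i : ℕ) : ℝ) + 1) * (r₀ * 4 ^ i)) ≤ 3 :=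
    sum_chain_reflect_le (b := fun k => (1 / 2) ^ k * (1 + k / 2))
      (fun i hi => (Real.sqrt_le_sqrt (hrat i hi)).trans (sqrt_succ_mul_quarter_pow_le _))
      (sum_half_pow_mul_le _)
  have hS2 : ∑ i ∈ Finset.range (J + 1), (((J - i : ℕ) : ℝ) + 1) * (r₀ * 4 ^ i) ≤ 2 :=
    sum_chain_reflect_le (b := fun k => (1 / 2) ^ k)
      (fun i hi => (hrat i hi).trans (succ_mul_quarter_pow_le _)) (sum_geometric_two_le _)
  have hQ2 : ∑ i ∈ Finset.range (J + 1), (r₀ * 4 ^ i) ^ (1 - p) ≤ Q ^ 2 := by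
    calc ∑ i ∈ Finset.range (J + 1), (r₀ * 4 ^ i) ^ (1 - p)
        = ∑ i ∈ Finset.range (J + 1), √((r₀ * 4 ^ i) ^ (1 - p)) ^ 2 :=
          Finset.sum_congr rfl fun i _ => (Real.sq_sqrt (by positivity)).symm
      _ ≤ (∑ i ∈ Finset.range (J + 1), √((r₀ * 4 ^ i) ^ (1 - p))) ^ 2 :=
          Finset.sum_sq_le_sq_sum_of_nonneg fun _ _ => Real.sqrt_nonneg _
      _ ≤ Q ^ 2 := pow_le_pow_left₀ (Finset.sum_nonneg fun _ _ => Real.sqrt_nonneg _) hQ 2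
  have hterm : ∀ i : ℕ, 2 * √(n * chainWidth r₀ i * v * chainLevel c p r₀ L J i)
        + chainLevel c p r₀ L J i * chainWidth r₀ i * b'
      ≤ 2 * √(8 * 4 ^ p * c * n * v) * √((r₀ * 4 ^ i) ^ (1 - p))
        + 4 * √(n * v * L) * √((((J - i : ℕ) : ℝ) + 1) * (r₀ * 4 ^ i))
        + 8 * 4 ^ p * c * b * (r₀ * 4 ^ i) ^ (1 - p)
        + 4 * (L * u) * ((((J - i : ℕ) : ℝ) + 1) * (r₀ * 4 ^ i)) := by
    intro i
    have h1 : √(n * chainWidth r₀ i * v * chainLevel c p r₀ L J i)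
        ≤ √(8 * 4 ^ p * c * n * v) * √((r₀ * 4 ^ i) ^ (1 - p))
          + 2 * (√(n * v * L) * √((((J - i : ℕ) : ℝ) + 1) * (r₀ * 4 ^ i))) := by
      rw [show n * chainWidth r₀ i * v * chainLevel c p r₀ L J i
        = n * v * (chainWidth r₀ i * chainLevel c p r₀ L J i) by ring, hlev,
        ← Real.sqrt_mul (by positivity), ← Real.sqrt_mul (by positivity)]
      refine (Real.sqrt_le_sqrt (le_of_eq ?_)).trans
        ((sqrt_add_le_add (x := 8 * 4 ^ p * c * n * v * (r₀ * 4 ^ i) ^ (1 - p))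
        (y := 2 ^ 2 * (n * v * L * ((((J - i : ℕ) : ℝ) + 1) * (r₀ * 4 ^ i))))
        (by positivity) (by positivity)).trans ?_)
      · ring
      · rw [Real.sqrt_mul (by positivity) (n * v * L * ((((J - i : ℕ) : ℝ) + 1) * (r₀ * 4 ^ i))),
          Real.sqrt_sq (by norm_num)]
    have h2 : chainLevel c p r₀ L J i * chainWidth r₀ i * b'
        ≤ 8 * 4 ^ p * c * b * (r₀ * 4 ^ i) ^ (1 - p)
        + 4 * (L * u) * ((((J - i : ℕ) : ℝ) + 1) * (r₀ * 4 ^ i)) := by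
      rw [mul_comm (chainLevel c p r₀ L J i), hlev, add_mul]
      have e1 : 8 * 4 ^ p * c * (r₀ * 4 ^ i) ^ (1 - p) * b'
          ≤ 8 * 4 ^ p * c * (r₀ * 4 ^ i) ^ (1 - p) * b := by gcongr
      have e2 : 4 * ((((J - i : ℕ) : ℝ) + 1) * (r₀ * 4 ^ i)) * L * b'
          ≤ 4 * ((((J - i : ℕ) : ℝ) + 1) * (r₀ * 4 ^ i)) * L * u := by gcongr
      linarith
    linarith
  refine (Finset.sum_le_sum fun i _ => hterm i).trans ?_
  simp only [Finset.sum_add_distrib, ← Finset.mul_sum]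
  have f1 : 2 * √(8 * 4 ^ p * c * n * v)
      * ∑ i ∈ Finset.range (J + 1), √((r₀ * 4 ^ i) ^ (1 - p))
      ≤ 2 * √(8 * 4 ^ p * c * n * v) * Q := by gcongr
  have f2 : 4 * √(n * v * L)
      * ∑ i ∈ Finset.range (J + 1), √((((J - i : ℕ) : ℝ) + 1) * (r₀ * 4 ^ i))
      ≤ 4 * √(n * v * L) * 3 := by gcongr
  have hb : 0 ≤ b := hb0.trans hbb
  have hu : 0 ≤ u := hb0.trans hbu
  have f3 : 8 * 4 ^ p * c * b * ∑ i ∈ Finset.range (J + 1), (r₀ * 4 ^ i) ^ (1 - p)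
      ≤ 8 * 4 ^ p * c * b * Q ^ 2 := by gcongr
  have f4 : 4 * (L * u) * ∑ i ∈ Finset.range (J + 1), (((J - i : ℕ) : ℝ) + 1) * (r₀ * 4 ^ i)
      ≤ 4 * (L * u) * 2 := by gcongr
  linarith

/-- The chaining bound at the best truncation level. -/
theorem exists_truncation (hc : 0 < c) (hr0 : 0 < r₀) (hL : 0 ≤ L)
    (hn : 0 < n) (hv : 0 < v) (hu : 0 < u) (hJ : r₀ * 4 ^ J ≤ 1) (hQ0 : 0 < Q)
    (hQ : ∑ i ∈ Finset.range (J + 1), √((r₀ * 4 ^ i) ^ (1 - p)) ≤ Q) :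
    ∃ b : ℝ, 0 < b ∧ n * r₀ + n * v / b + ∑ i ∈ Finset.range (J + 1),
          (2 * √(n * chainWidth r₀ i * v * chainLevel c p r₀ L J i)
            + chainLevel c p r₀ L J i * chainWidth r₀ i * min b u)
      ≤ n * r₀ + 4 * √(8 * 4 ^ p * c * n * v) * Q + 12 * √(n * v * L) + 8 * (L * u) := by
  set M := 8 * 4 ^ p * c with hM
  have hM0 : 0 < M := by positivity
  set z := √(M * n * v) with hz
  have hz0 : 0 < z := Real.sqrt_pos.2 (by positivity)
  have hzz : z * z = M * n * v := Real.mul_self_sqrt (by positivity)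
  -- This b equalises the truncation bias n v/b and the linear entropy term M b Q²; both become z Q,
  -- and with the 2 z Q already present the total is 4 z Q.
  refine ⟨z / (M * Q), by positivity, ?_⟩
  have h := chain_sum_le (c := c) (p := p) (b := z / (M * Q)) (b' := min (z / (M * Q)) u) hc hr0
    hL hn.le hv.le (le_min (by positivity) hu.le) (min_le_left _ _) (min_le_right _ _) hJ hQ
  have e1 : n * v / (z / (M * Q)) = z * Q := by
    rw [div_div_eq_mul_div, div_eq_iff hz0.ne']
    linear_combination -Q * hzz
  have e2 : M * (z / (M * Q)) * Q ^ 2 = z * Q := by field_simp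
  rw [e1]
  rw [← hM, ← hz, e2] at h
  linarith

/-- For p < 1 the coarse radii dominate: counted from that end the terms are at most q^k with q =
2^(-(1-p)), and Bernoulli's inequality gives 1 - q ≥ (1-p)/2. -/
theorem sum_sqrt_radius_le_of_lt_one (hp1 : p < 1) (hp : 0 < p) (hr0 : 0 < r₀)
    (hJ : r₀ * 4 ^ J ≤ 1) :
    ∑ i ∈ Finset.range (J + 1), √((r₀ * 4 ^ i) ^ (1 - p)) ≤ 2 / (1 - p) := by
  set q : ℝ := (1 / 2) ^ (1 - p) with hq
  have hq0 : 0 < q := by positivity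
  have hx : 0 < 1 - p := by linarith
  have hq1 : q ≤ 1 - (1 - p) / 2 := by
    have := rpow_one_add_le_one_add_mul_self (s := -1 / 2) (p := 1 - p) (by norm_num) hx.le
      (by linarith)
    rw [show (1 : ℝ) + -1 / 2 = 1 / 2 by norm_num] at this
    linarith
  refine sum_chain_reflect_le (b := fun k => q ^ k) (fun i hi => ?_) ?_
  · refine Real.sqrt_le_iff.2 ⟨by positivity, ?_⟩
    calc (r₀ * 4 ^ i) ^ (1 - p) ≤ ((1 / 4 : ℝ) ^ (J - i)) ^ (1 - p) :=
          Real.rpow_le_rpow (by positivity) (chain_radius_le hJ hi) hx.le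
      _ = (q ^ (J - i)) ^ 2 := by
          rw [pow_rpow_comm (by norm_num), ← pow_mul, mul_comm _ 2, pow_mul, hq,
            ← pow_rpow_comm (x := 1 / 2) (by norm_num) 2]
          norm_num
  · have h1 : ∑ k ∈ Finset.range (J + 1), q ^ k ≤ (1 - q)⁻¹ :=
      geom_sum_le_inv hq0.le (by linarith) _
    calc _ ≤ (1 - q)⁻¹ := h1
      _ ≤ ((1 - p) / 2)⁻¹ := inv_anti₀ (by positivity) (by linarith)
      _ = 2 / (1 - p) := inv_div _ _

/-- For p > 1 the finest radius dominates, and the terms form a geometric progression of ratio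
2^(-(p-1)). -/
theorem sum_sqrt_radius_le_of_one_lt (hp1 : 1 < p) (hr0 : 0 < r₀) :
    ∑ i ∈ Finset.range (J + 1), √((r₀ * 4 ^ i) ^ (1 - p))
      ≤ √(r₀ ^ (1 - p)) / (1 - (1 / 2) ^ (p - 1)) := by
  set q : ℝ := (1 / 2) ^ (p - 1) with hq
  have hq0 : 0 < q := by positivity
  have hq1 : q < 1 := Real.rpow_lt_one (by norm_num) (by norm_num) (by linarith)
  have h1 : ∀ i : ℕ, √((r₀ * 4 ^ i) ^ (1 - p)) = √(r₀ ^ (1 - p)) * q ^ i := by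
    intro i
    rw [Real.mul_rpow hr0.le (by positivity), Real.sqrt_mul (by positivity)]
    congr 1
    rw [Real.sqrt_eq_iff_eq_sq (by positivity) (by positivity)]
    rw [pow_rpow_comm (by norm_num), ← pow_mul, mul_comm _ 2, pow_mul, hq,
      ← pow_rpow_comm (x := 1 / 2) (by norm_num) 2, show (4 : ℝ) = ((1 / 2) ^ 2)⁻¹ by norm_num,
      Real.inv_rpow (by norm_num), ← Real.rpow_neg (by norm_num), neg_sub]
  simp_rw [h1]
  rw [← Finset.mul_sum, div_eq_mul_inv]
  gcongr
  exact geom_sum_le_inv hq0.le hq1 _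

end ChainSum

/-! ### Comparison of the chaining bound with the threshold a_n -/

section Numeric

theorem exists_chain_length {r₀ : ℝ} (h0 : 0 < r₀) (h1 : r₀ ≤ 1) :
    ∃ J : ℕ, 1 ≤ 4 * (r₀ * 4 ^ J) ∧ r₀ * 4 ^ J ≤ 1 := by
  obtain ⟨J, hJ1, hJ2⟩ := exists_nat_pow_near (x := 1 / r₀) (y := (4 : ℝ))
    ((one_le_div h0).2 h1) (by norm_num)
  rw [le_div_iff₀ h0] at hJ1
  rw [div_lt_iff₀ h0, pow_succ] at hJ2
  exact ⟨J, by linarith, by linarith⟩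

theorem one_add_half_le_two_rpow {x : ℝ} (hx : 0 ≤ x) : 1 + x / 2 ≤ (2 : ℝ) ^ x := by
  have h := Real.add_one_le_exp (Real.log 2 * x)
  rw [Real.exp_mul, Real.exp_log (by norm_num)] at h
  have := Real.log_two_gt_d9
  nlinarith

theorem pow_three_le_four_rpow {x : ℝ} (hx : 0 ≤ x) : x ^ 3 ≤ 27 * (4 : ℝ) ^ x := by
  have h := one_add_half_le_two_rpow (x := 2 * x / 3) (by positivity)
  have h2 : ((2 : ℝ) ^ (2 * x / 3)) ^ 3 = 4 ^ x := by
    rw [← Real.rpow_natCast, ← Real.rpow_mul (by norm_num),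
      show (4 : ℝ) = 2 ^ (2 : ℝ) by norm_num, ← Real.rpow_mul (by norm_num)]
    congr 1
    push_cast
    ring
  have h3 : (x / 3) ^ 3 ≤ ((2 : ℝ) ^ (2 * x / 3)) ^ 3 :=
    pow_le_pow_left₀ (by positivity) (by linarith) 3
  rw [h2] at h3
  nlinarith

variable {c p u N L v vb : ℝ}

/-- Here N = u², so u√(L/N) = √L and v dominates the variance bound vb. With finest radius 1/(2u)
the entropy terms contribute 48 against 381/2, and the square roots 12 + 2 plus the bias u/2 against
111/2. The linear terms give 8 + 1 = 9, matched exactly by (9/2)√v since √v ≥ 2. -/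
theorem chain_bound_of_lt_one (hc : 0 < c) (hp : 0 < p) (hp1 : p < 1) (hu : 1 ≤ u) (hN : N = u ^ 2)
    (hL : 2 ≤ L) (hv : 4 + 64 * √c + 32 * √L ≤ v) (hvb : vb = 18 + 31 * √c + 2 * u * √(L / N)) :
    ∃ (r₀ b : ℝ) (J : ℕ), 0 < r₀ ∧ 0 < b ∧ 1 ≤ 4 * (r₀ * 4 ^ J) ∧
      N * r₀ + N * vb / b + ∑ i ∈ Finset.range (J + 1),
          (2 * √(N * chainWidth r₀ i * vb * chainLevel c p r₀ L J i)
            + chainLevel c p r₀ L J i * chainWidth r₀ i * min b u)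
        + (2 * √(N * vb * L) + L * u)
      ≤ N * (3 / 2 * (√v * (127 * √c / (1 - p) / u + 37 * √(L / N) + 3 * L * u / N))) := by
  have hu0 : 0 < u := by linarith
  have hN0 : 0 < N := by rw [hN]; positivity
  have hsL : 1 ≤ √L := Real.one_le_sqrt.2 (by linarith)
  have hsc : 0 ≤ √c := Real.sqrt_nonneg c
  have hLN : √(L / N) = √L / u := by rw [Real.sqrt_div (by linarith), hN, Real.sqrt_sq hu0.le]
  rw [hLN] at hvb ⊢
  have hvb' : vb = 18 + 31 * √c + 2 * √L := by rw [hvb]; field_simp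
  have hvbv : vb ≤ v := by rw [hvb']; linarith
  have hvb0 : 0 < vb := by rw [hvb']; positivity
  have hv0 : 0 < v := by linarith
  have hsv : 2 ≤ √v := Real.le_sqrt_of_sq_le (by nlinarith)
  have hr0 : 0 < 1 / (2 * u) := by positivity
  obtain ⟨J, hJ1, hJ2⟩ := exists_chain_length hr0 (by rw [div_le_one (by positivity)]; linarith)
  have hx : 0 < 1 - p := by linarith
  obtain ⟨b, hb, h⟩ := exists_truncation hc hr0 (by linarith : (0 : ℝ) ≤ L) hN0 hvb0 hu0 hJ2
    (Q := 2 / (1 - p)) (by positivity) (sum_sqrt_radius_le_of_lt_one hp1 hp hr0 hJ2)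
  refine ⟨_, b, J, hr0, hb, hJ1, ?_⟩
  have e1 : √(N * vb * L) ≤ u * (√v * √L) := by
    calc √(N * vb * L) ≤ √(u ^ 2 * (v * L)) := by
          apply Real.sqrt_le_sqrt; rw [hN, mul_assoc]; gcongr
      _ = u * (√v * √L) := by
          rw [Real.sqrt_mul (by positivity), Real.sqrt_sq hu0.le, Real.sqrt_mul hv0.le]
  have e2 : √(8 * 4 ^ p * c * N * vb) ≤ 6 * (√c * (u * √v)) := by
    have h4 : (4 : ℝ) ^ p ≤ 4 := by
      conv_rhs => rw [← Real.rpow_one 4]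
      exact Real.rpow_le_rpow_of_exponent_le (by norm_num) hp1.le
    refine Real.sqrt_le_iff.2 ⟨by positivity, ?_⟩
    have : (6 * (√c * (u * √v))) ^ 2 = 36 * c * u ^ 2 * v := by
      rw [mul_pow, mul_pow, mul_pow, Real.sq_sqrt hc.le, Real.sq_sqrt hv0.le]; ring
    rw [this, hN]
    gcongr
    linarith
  have e3 : 4 * √(8 * 4 ^ p * c * N * vb) * (2 / (1 - p))
      ≤ 4 * (6 * (√c * (u * √v))) * (2 / (1 - p)) := by gcongr
  have e4 : N * (3 / 2 * (√v * (127 * √c / (1 - p) / u + 37 * (√L / u) + 3 * L * u / N)))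
      = 381 / 2 * (√c * (u * √v) / (1 - p)) + 111 / 2 * (u * (√v * √L))
        + 9 / 2 * (√v * (L * u)) := by
    rw [hN]; field_simp; ring
  have e5 : N * (1 / (2 * u)) = u / 2 := by rw [hN]; field_simp
  have e6 : 4 * (6 * (√c * (u * √v))) * (2 / (1 - p)) = 48 * (√c * (u * √v) / (1 - p)) := by ring
  have e7 : 0 ≤ √c * (u * √v) / (1 - p) := by positivity
  have e8 : 2 * (L * u) ≤ √v * (L * u) := by gcongr
  have e9 : u ≤ u * (√v * √L) := by
    refine le_mul_of_one_le_right hu0.le ?_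
    nlinarith
  rw [e4]
  rw [e5] at h ⊢
  rw [e6] at e3
  linarith

/-- The dominant entropy term for p > 1, with T = 2^(p-1), w = u^(p-1), x = p - 1, N = u²w² and
finest radius 2/u, for which r₀^(1-p) = w/T. The constant is 160 = 4·√(32·50). -/
theorem chain_factor_le {T w x y : ℝ} (hT : 1 < T) (hw : 0 < w) (hx : 0 < x) (hc : 0 < c)
    (hu : 0 < u) (hv : 0 < v) (hvb : 0 < vb) (hy : y = x / (1 - 1 / T))
    (h : vb * y ^ 2 ≤ 50 * v * w) :
    4 * √(8 * (4 * T ^ 2) * c * (u ^ 2 * w ^ 2) * vb) * (√(w / T) / (1 - 1 / T))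
      ≤ 160 * (u * w ^ 2 * (√v * (√c * √T / x))) := by
  have hT0 : 0 < T := by linarith
  have h1T : 0 < 1 - 1 / T := by rw [sub_pos, div_lt_one hT0]; exact hT
  have hy0 : 0 < y := by rw [hy]; positivity
  have e0 : 1 - 1 / T = x / y := by rw [hy]; field_simp
  have e1 : √(8 * (4 * T ^ 2) * c * (u ^ 2 * w ^ 2) * vb) * √(w / T) * y
      = u * w * √(32 * T * c * w * (vb * y ^ 2)) := by
    rw [← Real.sqrt_mul (by positivity), ← Real.sqrt_sq hy0.le, ← Real.sqrt_mul (by positivity),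
      Real.sqrt_sq hy0.le]
    conv_rhs => rw [← Real.sqrt_sq (by positivity : 0 ≤ u * w), ← Real.sqrt_mul (by positivity)]
    congr 1
    field_simp
    ring
  have e2 : √(32 * T * c * w * (vb * y ^ 2)) ≤ 40 * (w * (√v * (√c * √T))) := by
    refine Real.sqrt_le_iff.2 ⟨by positivity, ?_⟩
    calc 32 * T * c * w * (vb * y ^ 2) ≤ 32 * T * c * w * (50 * v * w) := by gcongr
      _ = 1600 * (w ^ 2 * (v * (c * T))) := by ring
      _ = (40 * (w * (√v * (√c * √T)))) ^ 2 := by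
        rw [mul_pow, mul_pow, mul_pow, mul_pow, Real.sq_sqrt hv.le, Real.sq_sqrt hc.le,
          Real.sq_sqrt hT0.le]
        ring
  calc 4 * √(8 * (4 * T ^ 2) * c * (u ^ 2 * w ^ 2) * vb) * (√(w / T) / (1 - 1 / T))
      = 4 / x * (√(8 * (4 * T ^ 2) * c * (u ^ 2 * w ^ 2) * vb) * √(w / T) * y) := by
        rw [e0]; field_simp
    _ ≤ 4 / x * (u * w * (40 * (w * (√v * (√c * √T))))) := by rw [e1]; gcongr
    _ = 160 * (u * w ^ 2 * (√v * (√c * √T / x))) := by field_simp; ring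

/-- For p > 1 the variance bound vb need not lie below v, because of its term 31√c; it is compared
after multiplication by u^(p-1). Let y be the squared quantity. For p < 2, y ≤ 2, and the c₁' part
of v gives √c ≲ v u^(p-1). For p > 2, y ≤ 2(p-1), and √c ≲ u(p-1) reduces the claim to a cubic in
p-1 bounded by 4^(p-1). -/
theorem chain_variance_le (hp1 : 1 < p) (hc : 0 < c) (hu : 4 ≤ u) (hv4 : 4 ≤ v)
    (hvb : vb ≤ 18 + 31 * √c + v / 16)
    (hlt : p < 2 → 128 * √c ≤ v * u ^ (p - 1)) (hgt : 2 < p → 508 * √c ≤ u * (p - 1))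
    (hp2 : p ≠ 2) :
    vb * ((p - 1) / (1 - 1 / 2 ^ (p - 1))) ^ 2 ≤ 50 * v * u ^ (p - 1) := by
  set x := p - 1 with hx
  have hx0 : 0 < x := by linarith
  set T : ℝ := 2 ^ x with hT
  have hT1 : 1 + x / 2 ≤ T := one_add_half_le_two_rpow hx0.le
  have hT0 : 0 < T := by linarith
  have h1T : 0 < 1 - 1 / T := by rw [sub_pos, div_lt_one hT0]; linarith
  set y := x / (1 - 1 / T) with hy
  have hy0 : 0 < y := by positivity
  set w := u ^ x with hw
  have hw0 : 0 < w := Real.rpow_pos_of_pos (by linarith) _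
  have h4T : (4 : ℝ) ^ x = T ^ 2 := by
    rw [show (4 : ℝ) = 2 ^ 2 by norm_num, pow_rpow_comm (by norm_num)]
  have hTw : T ^ 2 ≤ w := by
    rw [← h4T]; exact Real.rpow_le_rpow (by norm_num) hu hx0.le
  have hyT : y ≤ 2 * T := by
    rw [hy, div_le_iff₀ h1T]
    have : 2 * T * (1 - 1 / T) = 2 * T - 2 := by field_simp
    linarith
  have hy2 : y ^ 2 ≤ 4 * w := by
    have := pow_le_pow_left₀ hy0.le hyT 2
    rw [mul_pow] at this
    linarith
  have hsc : 0 < √c := Real.sqrt_pos.2 hc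
  have hmain : 31 * √c * y ^ 2 ≤ 31 * v * w := by
    rcases lt_or_gt_of_ne hp2 with h | h
    · have hq := rpow_one_add_le_one_add_mul_self (s := -1 / 2) (p := x) (by norm_num) hx0.le
        (by linarith)
      rw [show (1 : ℝ) + -1 / 2 = 1 / 2 by norm_num, Real.div_rpow (by norm_num) (by norm_num),
        Real.one_rpow, ← hT] at hq
      have hy' : y ≤ 2 := by
        rw [hy, div_le_iff₀ h1T]; linarith
      have := hlt h
      have h4 : y ^ 2 ≤ 4 := by nlinarith
      have h5 := mul_le_mul_of_nonneg_left h4 hsc.le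
      linarith
    · have hxx : 1 < x := by linarith
      have hT2 : 2 ≤ T := by
        rw [hT]; conv_lhs => rw [← Real.rpow_one 2]
        exact Real.rpow_le_rpow_of_exponent_le (by norm_num) hxx.le
      have hy' : y ≤ 2 * x := by
        rw [hy, div_le_iff₀ h1T]
        have : 1 / T ≤ 1 / 2 := one_div_le_one_div_of_le (by norm_num) hT2
        nlinarith
      have hc' := hgt h
      have hwu : u * (4 : ℝ) ^ (x - 1) ≤ w := by
        rw [hw, show x = 1 + (x - 1) by ring, Real.rpow_add (by linarith), Real.rpow_one]
        gcongr
        rw [add_sub_cancel_left]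
        exact Real.rpow_le_rpow (by norm_num) hu (by linarith)
      have h4 : (4 : ℝ) ^ (x - 1) = 4 ^ x / 4 := by
        rw [Real.rpow_sub (by norm_num), Real.rpow_one]
      have hx3 := pow_three_le_four_rpow hx0.le
      have hux : u * x ^ 3 ≤ 108 * w := by
        rw [h4] at hwu
        have h1 := mul_le_mul_of_nonneg_left hx3 (by linarith : 0 ≤ u)
        linarith
      have hyx : y ^ 2 ≤ 4 * x ^ 2 := by
        have := pow_le_pow_left₀ hy0.le hy' 2
        rw [mul_pow] at this
        linarith
      calc 31 * √c * y ^ 2 ≤ 31 * √c * (4 * x ^ 2) := by gcongr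
        _ ≤ 31 * (u * x / 508) * (4 * x ^ 2) := by gcongr; linarith
        _ = 31 * 4 / 508 * (u * x ^ 3) := by ring
        _ ≤ 31 * 4 / 508 * (108 * w) := by gcongr
        _ ≤ 31 * v * w := by linarith [mul_le_mul_of_nonneg_right hv4 hw0.le]
  calc vb * y ^ 2 ≤ (18 + 31 * √c + v / 16) * y ^ 2 := by gcongr
    _ = (18 + v / 16) * y ^ 2 + 31 * √c * y ^ 2 := by ring
    _ ≤ (18 + v / 16) * (4 * w) + 31 * v * w := by gcongr
    _ ≤ 50 * v * w := by linarith [mul_le_mul_of_nonneg_right hv4 hw0.le]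

/-- The term 31√c S² of the variance is absorbed by the cross term of (3S + √c/(2u))², because v ≥
32uS. -/
theorem sqrt_variance_le {S : ℝ} (hN : 0 < N) (hc : 0 < c) (hu : 1 ≤ u) (hL : 2 ≤ L)
    (hS : S = √(L / N)) (hv4 : 4 ≤ v) (hvS : 32 * (u * S) ≤ v) (hvb : vb ≤ 18 + 31 * √c + v / 16) :
    √(N * vb * L) ≤ N * (√v * (3 * S + √c / (2 * u))) := by
  have hS0 : 0 ≤ S := hS ▸ Real.sqrt_nonneg _
  have hSS : L = S ^ 2 * N := by
    rw [hS, Real.sq_sqrt (by positivity)]; field_simp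
  have hsc : 0 ≤ √c := Real.sqrt_nonneg c
  refine Real.sqrt_le_iff.2 ⟨by positivity, ?_⟩
  rw [mul_pow, mul_pow, Real.sq_sqrt (by linarith)]
  have h1 : vb * S ^ 2 ≤ v * (3 * S + √c / (2 * u)) ^ 2 := by
    have e : √c * S ^ 2 * 31 ≤ v * (3 * S * (√c / u)) := by
      have : v * (3 * S * (√c / u)) = 3 * (S * √c) * (v / u) := by ring
      rw [this]
      have : 32 * S ≤ v / u := by rw [le_div_iff₀ (by linarith)]; linarith
      linarith [mul_le_mul_of_nonneg_left this (mul_nonneg hS0 hsc), mul_nonneg (mul_nonneg hS0 hS0) hsc]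
    calc vb * S ^ 2 ≤ (18 + 31 * √c + v / 16) * S ^ 2 := by gcongr
      _ ≤ 9 * v * S ^ 2 + v * (3 * S * (√c / u)) := by
        linarith [mul_le_mul_of_nonneg_right hv4 (sq_nonneg S), sq_nonneg S]
      _ ≤ 9 * v * S ^ 2 + v * (3 * S * (√c / u)) + v * (√c / (2 * u)) ^ 2 := by
        have : 0 ≤ v * (√c / (2 * u)) ^ 2 := by positivity
        linarith
      _ = v * (3 * S + √c / (2 * u)) ^ 2 := by field_simp; ring
  calc N * vb * L = N ^ 2 * (vb * S ^ 2) := by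
        rw [hSS]; ring
    _ ≤ N ^ 2 * (v * (3 * S + √c / (2 * u)) ^ 2) := by gcongr

set_option maxHeartbeats 800000 in
-- Let R be the bracket multiplied by √v on the right. If R ≥ 1/k, the trivial bound N/k is enough.
-- Otherwise R < 1/k ≤ 1/2 forces u > 4 + 508m, so u is large relative to the entropy constant and a
-- chain with finest radius 2/u works.
theorem chain_bound_of_one_lt {k : ℝ} (hc : 0 < c) (hp1 : 1 < p) (hp2 : p ≠ 2) (hk : 2 ≤ k)
    (hu : 1 ≤ u) (hN : N = u ^ 2 * (u ^ (p - 1)) ^ 2) (hL : 2 ≤ L) (hv4 : 4 ≤ v)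
    (hvS : 32 * (u * √(L / N)) ≤ v) (hlt : p < 2 → 128 * √c ≤ v * u ^ (p - 1))
    (hvb : vb = 18 + 31 * √c + 2 * u * √(L / N)) :
    ∃ (r₀ b : ℝ) (J : ℕ), 0 < r₀ ∧ 0 < b ∧ 1 ≤ 4 * (r₀ * 4 ^ J) ∧
      min (N * (1 / k)) (N * r₀ + N * vb / b + ∑ i ∈ Finset.range (J + 1),
          (2 * √(N * chainWidth r₀ i * vb * chainLevel c p r₀ L J i)
            + chainLevel c p r₀ L J i * chainWidth r₀ i * min b u))
        + (2 * √(N * vb * L) + L * u)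
      ≤ N * (3 / 2 * (√v * ((1 + 127 * √c * 2 ^ ((p - 1) / 2) / (p - 1)) / u + 37 * √(L / N)
          + 3 * L * u / N))) := by
  have hu0 : 0 < u := by linarith
  set x := p - 1 with hx
  have hx0 : 0 < x := by linarith
  set w := u ^ x with hw
  have hw0 : 0 < w := Real.rpow_pos_of_pos hu0 _
  have hN0 : 0 < N := by rw [hN]; positivity
  set S := √(L / N) with hS
  have hS0 : 0 ≤ S := Real.sqrt_nonneg _
  have hsc : 0 < √c := Real.sqrt_pos.2 hc
  have hvb0 : 0 < vb := by rw [hvb]; positivity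
  have hvb' : vb ≤ 18 + 31 * √c + v / 16 := by rw [hvb]; linarith
  have hv0 : 0 < v := by linarith
  have hsv : 2 ≤ √v := Real.le_sqrt_of_sq_le (by linarith)
  set T : ℝ := 2 ^ x with hT
  have hT1 : 1 + x / 2 ≤ T := one_add_half_le_two_rpow hx0.le
  have hT0 : 0 < T := by linarith
  have hsT : (2 : ℝ) ^ (x / 2) = √T := by
    rw [Real.sqrt_eq_rpow, hT, ← Real.rpow_mul (by norm_num)]; congr 1; ring
  rw [hsT]
  set m := √c * √T / x with hm
  have hm0 : 0 < m := by positivity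
  have hcm : √c ≤ 4 * m := by
    have h4 := one_add_half_le_two_rpow (x := x / 2) (by positivity)
    rw [hsT] at h4
    rw [hm, mul_div_assoc', le_div_iff₀ hx0]
    have h5 : x ≤ 4 * √T := by linarith
    linarith [mul_le_mul_of_nonneg_left h5 hsc.le]
  rw [show 127 * √c * √T / x = 127 * m by rw [hm]; ring]
  have hD := sqrt_variance_le hN0 hc hu hL hS hv4 hvS hvb'
  have hLu : 2 * (L * u) ≤ √v * (L * u) := by gcongr
  set R := √v * ((1 + 127 * m) / u + 37 * S + 3 * L * u / N) with hR
  have hNR : N * R = N * √v / u + 127 * (N * √v * m / u) + 37 * (N * √v * S)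
      + 3 * (√v * (L * u)) := by rw [hR]; field_simp
  have hD' : √(N * vb * L) ≤ 3 * (N * √v * S) + 2 * (N * √v * m / u) := by
    refine hD.trans ?_
    have : √c / (2 * u) ≤ 2 * (m / u) := by
      rw [div_le_iff₀ (by positivity)]; field_simp; linarith
    calc N * (√v * (3 * S + √c / (2 * u))) ≤ N * (√v * (3 * S + 2 * (m / u))) := by gcongr
      _ = _ := by ring
  have p1 : 0 < N * √v / u := by positivity
  have p2 : 0 < N * √v * m / u := by positivity
  have p3 : 0 ≤ N * √v * S := by positivity
  have p4 : 0 ≤ √v * (L * u) := by positivity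
  by_cases hcase : 1 / k ≤ R
  · obtain ⟨J, hJ1, -⟩ := exists_chain_length one_pos le_rfl
    refine ⟨1, 1, J, one_pos, one_pos, hJ1, ?_⟩
    have h1 : N * (1 / k) ≤ N * R := by gcongr
    refine (add_le_add_left ((min_le_left _ _).trans h1) _).trans ?_
    linarith
  · push Not at hcase
    have hku : 2 * (2 * ((1 + 127 * m) / u)) < 1 := by
      have h1 : √v * ((1 + 127 * m) / u) ≤ R := by
        rw [hR]; gcongr
        have : 0 ≤ 3 * L * u / N := by positivity
        linarith
      have h2 : 1 / k ≤ 1 / 2 := one_div_le_one_div_of_le (by norm_num) hk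
      have h3 : 2 * ((1 + 127 * m) / u) ≤ √v * ((1 + 127 * m) / u) := by gcongr
      linarith
    have hum : 4 + 508 * m < u := by
      have : 2 * (2 * ((1 + 127 * m) / u)) = (4 + 508 * m) / u := by ring
      rwa [this, div_lt_one hu0] at hku
    -- The bias 2N/u is at most N√v/u, the share of the summand 1 in c₁. The entropy terms then
    -- total 160 + 14·2 = 188, below (3/2)·127.
    have hr0 : 0 < 2 / u := by positivity
    obtain ⟨J, hJ1, hJ2⟩ := exists_chain_length hr0 (by rw [div_le_one hu0]; linarith)
    have h1T : 0 < 1 - 1 / T := by rw [sub_pos, div_lt_one hT0]; linarith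
    have hQ := sum_sqrt_radius_le_of_one_lt (J := J) hp1 hr0
    have hr : (2 / u) ^ (1 - p) = w / T := by
      rw [show 1 - p = -x by rw [hx]; ring, Real.rpow_neg hr0.le, Real.div_rpow (by norm_num) hu0.le,
        inv_div]
    have h12 : (1 / 2 : ℝ) ^ (p - 1) = 1 / T := by
      rw [Real.div_rpow (by norm_num) (by norm_num), Real.one_rpow]
    rw [hr, h12] at hQ
    rw [← hr] at hQ
    obtain ⟨b, hb, h⟩ := exists_truncation hc hr0 (by linarith : (0 : ℝ) ≤ L) hN0 hvb0 hu0 hJ2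
      (by rw [hr]; positivity) hQ
    refine ⟨_, b, J, hr0, hb, hJ1, (add_le_add_left ((min_le_right _ _).trans h) _).trans ?_⟩
    have hvar := chain_variance_le hp1 hc (by linarith : 4 ≤ u) hv4 hvb' hlt (fun hp => by
      have h1 : 1 ≤ √T := Real.one_le_sqrt.2 (by linarith)
      have h2 : √c ≤ m * x := by
        rw [hm, div_mul_cancel₀ _ hx0.ne']; exact le_mul_of_one_le_right hsc.le h1
      have h3 := mul_le_mul_of_nonneg_right (by linarith : 508 * m ≤ u) hx0.le
      linarith) hp2
    have hfac := chain_factor_le (by linarith : 1 < T) hw0 hx0 hc hu0 hv0 hvb0 rfl hvar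
    have h4p : (4 : ℝ) ^ p = 4 * T ^ 2 := by
      rw [show p = 1 + x by rw [hx]; ring, Real.rpow_add (by norm_num), Real.rpow_one,
        show (4 : ℝ) ^ x = T ^ 2 by
          rw [show (4 : ℝ) = 2 ^ 2 by norm_num, pow_rpow_comm (by norm_num)]]
    rw [hr, h4p]
    have hfac' : 4 * √(8 * (4 * T ^ 2) * c * N * vb) * (√(w / T) / (1 - 1 / T))
        ≤ 160 * (N * √v * m / u) := by
      rw [hN]
      refine hfac.trans (le_of_eq ?_)
      rw [← hm]
      congr 1
      rw [eq_div_iff hu0.ne']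
      ring
    have h2u : N * (2 / u) ≤ N * √v / u := by
      rw [mul_div_assoc']; gcongr
    linarith

variable {K n : ℕ} {ε : ℝ}

theorem aTerm_ge {δ : ℝ} (hδ : δ = delta p n) (hδ0 : 0 < δ) (v : ℝ) :
    √v * (c₁ c p / δ⁻¹ + 37 * √(logTerm ε n / n) + 3 * logTerm ε n * δ⁻¹ / n)
      ≤ aTerm c p ε δ v n := by
  rw [aTerm, ← inv_delta, ← hδ, Real.sqrt_div' _ (Nat.cast_nonneg n)]
  have h : 0 ≤ 1 / (δ * (n : ℝ)) * (3 * Real.log 2) := by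
    have := Real.log_nonneg (one_le_two (α := ℝ))
    positivity
  have h2 : 3 * logTerm ε n * δ⁻¹ / n = 1 / (δ * (n : ℝ)) * (3 * logTerm ε n) := by
    rw [one_div, mul_inv]; ring
  have h3 : 37 * (√(logTerm ε n) / √(n : ℝ)) = 37 / √(n : ℝ) * √(logTerm ε n) := by ring
  rw [h2, h3, mul_add (1 / (δ * (n : ℝ)))]
  gcongr
  linarith

theorem vTerm_ge (hL : 0 ≤ logTerm ε n) {δ : ℝ} (hδ0 : 0 < δ) :
    2 * (K : ℝ) + δ⁻¹ * (c₁' c p / (n : ℝ) ^ (min (1 / 2) (1 / p))) + 32 * (δ⁻¹ * √(logTerm ε n / n))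
      ≤ vTerm K c p ε δ n := by
  rw [vTerm, Real.sqrt_div' _ (Nat.cast_nonneg n)]
  have h : 0 ≤ δ⁻¹ * (16 * Real.log 2 / (n : ℝ) + 16 / (n : ℝ) * logTerm ε n) := by
    have := Real.log_nonneg (one_le_two (α := ℝ))
    positivity
  linarith [show δ⁻¹ * (32 / √(n : ℝ) * √(logTerm ε n)) = 32 * (δ⁻¹ * (√(logTerm ε n) / √n)) by ring,
    h]

theorem c₁'_nonneg : 0 ≤ c₁' c p := by
  have := Real.sqrt_nonneg c
  rw [c₁']
  split_ifs with h
  · have : 0 < 1 - p / 2 := by linarith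
    positivity
  · have : 0 ≤ p / 2 - 1 := by linarith
    positivity

/-- The two regimes of p with u = 1/δ_n. The entropy constant inside v_n is used through c₁' ≥ 64√c
for p < 1 and c₁' ≥ 128√c for 1 < p < 2; for p > 2 no lower bound on c₁' beyond nonnegativity is
required. The minimum with n/K anticipates R ≤ 1/K. -/
theorem exists_chain_bound (hK : 2 ≤ K) (hc : 0 < c) (hp : 0 < p) (hp1 : p ≠ 1) (hp2 : p ≠ 2)
    (hn : 1 ≤ n) (hL : 2 ≤ logTerm ε n)
    (hvb : vb = 18 + 31 * √c + 2 * (delta p n)⁻¹ * √(logTerm ε n / n)) :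
    ∃ (r₀ b : ℝ) (J : ℕ), 0 < r₀ ∧ 0 < b ∧ 1 ≤ 4 * (r₀ * 4 ^ J) ∧
      min (n * (1 / (K : ℝ))) (n * r₀ + n * vb / b + ∑ i ∈ Finset.range (J + 1),
          (2 * √(n * chainWidth r₀ i * vb * chainLevel c p r₀ (logTerm ε n) J i)
            + chainLevel c p r₀ (logTerm ε n) J i * chainWidth r₀ i * min b (delta p n)⁻¹))
        + (2 * √(n * vb * logTerm ε n) + logTerm ε n * (delta p n)⁻¹)
      ≤ n * (3 / 2 * aTerm c p ε (delta p n) (vTerm K c p ε (delta p n) n) n) := by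
  have hδ0 := delta_pos (p := p) hn
  have hu := one_le_inv_delta hp hn
  have hn0 : (0 : ℝ) < n := by exact_mod_cast hn
  have hK' : (2 : ℝ) ≤ K := by exact_mod_cast hK
  have hL0 : 0 ≤ logTerm ε n := by linarith
  have hc' : 0 ≤ c₁' c p := c₁'_nonneg
  have ha := aTerm_ge (c := c) (ε := ε) (n := n) (p := p) rfl hδ0 (vTerm K c p ε (delta p n) n)
  have hv := vTerm_ge (K := K) (c := c) (p := p) hL0 hδ0
  set v := vTerm K c p ε (delta p n) n
  have ha' := mul_le_mul_of_nonneg_left (mul_le_mul_of_nonneg_left ha (by norm_num : (0 : ℝ) ≤ 3 / 2))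
    hn0.le
  set u := (delta p n)⁻¹ with hu_def
  have hu0 : 0 < u := by linarith
  set L := logTerm ε n
  have hS0 := Real.sqrt_nonneg (L / n)
  rcases lt_or_gt_of_ne hp1 with h | h
  · have hN := (inv_delta_sq_of_lt_one (n := n) hp h.le).symm
    have hsn : √(n : ℝ) = u := by rw [hN, Real.sqrt_sq (by positivity)]
    have hmin : (n : ℝ) ^ (min (1 / 2) (1 / p)) = u := by
      rw [min_eq_left (one_div_le_one_div_of_le hp (by linarith)), ← Real.sqrt_eq_rpow, hsn]
    have hc64 : 64 * √c ≤ c₁' c p := by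
      rw [c₁', if_pos (by linarith)]
      exact le_div_self (by positivity) (by linarith) (by linarith)
    rw [hmin, mul_div_cancel₀ _ hu0.ne', Real.sqrt_div' _ hn0.le, hsn,
      mul_div_cancel₀ _ hu0.ne'] at hv
    obtain ⟨r₀, b, J, h1, h2, h3, h4⟩ := chain_bound_of_lt_one hc hp h hu hN hL
      (v := v) (by linarith) hvb
    rw [c₁, if_pos h] at ha'
    refine ⟨r₀, b, J, h1, h2, h3, le_trans ?_ (h4.trans ha')⟩
    gcongr
    exact min_le_right _ _
  · have hN : (n : ℝ) = u ^ 2 * (u ^ (p - 1)) ^ 2 := by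
      have h1 : u * u ^ (p - 1) = u ^ p := by
        rw [Real.rpow_sub_one hu0.ne', mul_div_cancel₀ _ hu0.ne']
      rw [← mul_pow, h1, ← inv_delta_rpow_of_one_le h.le, ← hu_def,
        mul_comm 2 p, Real.rpow_mul hu0.le, Real.rpow_two]
    have hcn : 0 ≤ u * (c₁' c p / (n : ℝ) ^ (min (1 / 2) (1 / p))) := by positivity
    obtain ⟨r₀, b, J, h1, h2, h3, h4⟩ := chain_bound_of_one_lt hc h hp2 hK' hu hN hL
      (v := v) (by nlinarith) (by linarith) (fun h2 => by
        have hw : 0 < u ^ (p - 1) := Real.rpow_pos_of_pos hu0 _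
        have hmin : (n : ℝ) ^ (min (1 / 2) (1 / p)) = u * u ^ (p - 1) := by
          rw [min_eq_left (one_div_le_one_div_of_le hp h2.le), ← Real.sqrt_eq_rpow, hN, ← mul_pow,
            Real.sqrt_sq (by positivity)]
        have hc128 : 128 * √c ≤ c₁' c p := by
          rw [c₁', if_pos h2, le_div_iff₀ (by linarith)]
          nlinarith [Real.sqrt_nonneg c]
        have : c₁' c p / u ^ (p - 1) ≤ v := by
          rw [hmin, ← div_div, mul_div_assoc', mul_div_cancel₀ _ hu0.ne'] at hv
          nlinarith
        rw [div_le_iff₀ hw] at this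
        linarith) hvb
    rw [c₁, if_neg (by linarith)] at ha'
    exact ⟨r₀, b, J, h1, h2, h3, h4.trans ha'⟩

end Numeric

/-! ### Mixtures with the uniform design, value and risk -/

section Designs

variable {d K : ℕ} {PW : Measure (Context d)} {η f g : ActionFn d K} {δ u : ℝ}

theorem isDesign_mix (hK : 0 < K) (hδ : 0 < δ) (hδ1 : δ ≤ 1) (hu : δ⁻¹ ≤ u) (hg : IsPolicy g) :
    IsDesign u (mix δ g) where
  isPolicy := hg.mix hK hδ.le hδ1
  pos a w := lt_of_lt_of_le (by positivity) (le_mix hδ1 hg.nonneg a w)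
  weight_le a w := by
    have hK' : (0 : ℝ) < K := by exact_mod_cast hK
    calc 1 / (K : ℝ) / mix δ g a w ≤ 1 / (K : ℝ) / (δ / K) :=
          div_le_div_of_nonneg_left (by positivity) (by positivity) (le_mix hδ1 hg.nonneg a w)
      _ = δ⁻¹ := by field_simp
      _ ≤ u := hu

theorem weightMean_mix (f g : ActionFn d K) :
    weightMean PW f (mix δ g) = ∫ w, invWeight δ 0 f g w ∂PW := by
  simp only [weightMean, invWeight, add_zero]

theorem isLoss_nonneg (hg : IsDesign u g) (hf : IsPolicy f) (a : Fin K) (w : Context d) {y : ℝ}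
    (hy : y = 0 ∨ y = 1) : 0 ≤ isLoss g f w a y := by
  have h1 := (hg.pos a w).le
  have h2 := hf.nonneg a w
  have h3 : 0 ≤ 1 - y := by rcases hy with h | h <;> simp [h]
  unfold isLoss
  positivity

theorem value_eq_one_sub_risk [IsProbabilityMeasure PW] (hK : 0 < K) (hη : ∀ a, Measurable (η a))
    (hη01 : ∀ a w, 0 ≤ η a w ∧ η a w ≤ 1) (hf : IsPolicy f) :
    value PW η f = 1 - K * risk PW η f := by
  have hK' : (0 : ℝ) < K := by exact_mod_cast hK
  have h1 : ∀ w, ∑ a, η a w * f a w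
      = 1 - K * ∑ a, (1 / (K : ℝ)) * (f a w * (1 - η a w)) := by
    intro w
    calc ∑ a, η a w * f a w
        = ∑ a, (f a w - K * ((1 / (K : ℝ)) * (f a w * (1 - η a w)))) :=
          Finset.sum_congr rfl fun a _ => by field_simp; ring
      _ = _ := by rw [Finset.sum_sub_distrib, hf.sum_eq_one, Finset.mul_sum]
  unfold value risk
  simp_rw [h1]
  rw [integral_sub (integrable_const _)
    ((integrable_risk hη hη01 hf.isSubPolicy).const_mul _), integral_const_mul]
  simp

theorem risk_nonneg (hη01 : ∀ a w, 0 ≤ η a w ∧ η a w ≤ 1) (hf : IsPolicy f) :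
    0 ≤ risk PW η f :=
  integral_nonneg fun w => Finset.sum_nonneg fun a _ => mul_nonneg (by positivity)
    (mul_nonneg (hf.nonneg a w) (sub_nonneg.2 (hη01 a w).2))

theorem value_nonneg (hη01 : ∀ a w, 0 ≤ η a w ∧ η a w ≤ 1) (hf : IsPolicy f) :
    0 ≤ value PW η f :=
  integral_nonneg fun w => Finset.sum_nonneg fun a _ => mul_nonneg (hη01 a w).1 (hf.nonneg a w)

theorem risk_le_one_div [IsProbabilityMeasure PW] (hK : 0 < K) (hη : ∀ a, Measurable (η a))
    (hη01 : ∀ a w, 0 ≤ η a w ∧ η a w ≤ 1) (hf : IsPolicy f) : risk PW η f ≤ 1 / K := by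
  have hK' : (0 : ℝ) < K := by exact_mod_cast hK
  have h := value_nonneg (PW := PW) hη01 hf
  rw [value_eq_one_sub_risk hK hη hη01 hf] at h
  rw [le_div_iff₀ hK']
  linarith

theorem integrable_value [IsFiniteMeasure PW] (hη : ∀ a, Measurable (η a))
    (hη01 : ∀ a w, 0 ≤ η a w ∧ η a w ≤ 1) (hf : IsPolicy f) :
    Integrable (fun w => ∑ a, η a w * f a w) PW := by
  refine integrable_of_bounds (Finset.measurable_sum _ fun a _ => (hη a).mul (hf.measurable a))
    (C := 1) (fun w => Finset.sum_nonneg fun a _ => mul_nonneg (hη01 a w).1 (hf.nonneg a w))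
    fun w => ?_
  rw [← hf.sum_eq_one w]
  exact Finset.sum_le_sum fun a _ => mul_le_of_le_one_left (hf.nonneg a w) (hη01 a w).2

/-- The value lost by a mixture with the uniform design. -/
theorem value_sub_value_mix_le [IsProbabilityMeasure PW] (hK : 0 < K)
    (hη : ∀ a, Measurable (η a)) (hη01 : ∀ a w, 0 ≤ η a w ∧ η a w ≤ 1) (hδ : 0 ≤ δ) (hδ1 : δ ≤ 1)
    (hf : IsPolicy f) (hg : IsPolicy g) :
    value PW η f - value PW η (mix δ g) ≤ δ + (1 - δ) * (K * (risk PW η g - risk PW η f)) := by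
  have h1 : (1 - δ) * value PW η g ≤ value PW η (mix δ g) := by
    unfold value
    rw [← integral_const_mul]
    refine integral_mono ((integrable_value hη hη01 hg).const_mul _)
      (integrable_value hη hη01 (hg.mix hK hδ hδ1)) fun w => ?_
    change (1 - δ) * ∑ a, η a w * g a w ≤ ∑ a, η a w * mix δ g a w
    rw [Finset.mul_sum]
    refine Finset.sum_le_sum fun a _ => ?_
    have : 0 ≤ η a w * (δ * (1 / (K : ℝ))) := mul_nonneg (hη01 a w).1 (by positivity)
    simp only [mix]
    linarith
  have hf1 := value_eq_one_sub_risk (PW := PW) hK hη hη01 hf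
  have hg1 := value_eq_one_sub_risk (PW := PW) hK hη hη01 hg
  have hr : 0 ≤ δ * (K * risk PW η f) := by
    have := risk_nonneg (PW := PW) hη01 hf
    positivity
  rw [hg1] at h1
  rw [hf1]
  linarith

end Designs

/-! ### The deviation events at one time -/

section Events

variable {d K : ℕ} {Ω : Type*} [MeasurableSpace Ω] {μ : Measure Ω} {PW : Measure (Context d)}
  {η : ActionFn d K} {gt : ℕ → Ω → ActionFn d K} {W : ℕ → Ω → Context d} {A : ℕ → Ω → Fin K}
  {Y : ℕ → Ω → ℝ} {F : Set (ActionFn d K)} {c p ε : ℝ} {fstar : ActionFn d K}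

/-- The bound on the mean conditional variance of the importance weighted losses, over `K ^ 2`. -/
noncomputable def varBound (c p ε : ℝ) (n : ℕ) : ℝ :=
  18 + 31 * √c + 2 * (delta p n)⁻¹ * √(logTerm ε n / n)

theorem varBound_pos {n : ℕ} (hn : 1 ≤ n) : 0 < varBound c p ε n := by
  have := delta_pos (p := p) hn
  unfold varBound
  positivity

/-- The deviation inequalities at time `n` along one trajectory. -/
structure GoodAt (PW : Measure (Context d)) (η : ActionFn d K) (F : Set (ActionFn d K))
    (c p ε : ℝ) (fstar : ActionFn d K) (gt : ℕ → ActionFn d K) (w : ℕ → Context d) (a : ℕ → Fin K)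
    (y : ℕ → ℝ) (n : ℕ) : Prop where
  weight : ∀ f ∈ F, ∀ h ∈ F,
    ((n : ℝ) - 1)⁻¹ * ∑ t ∈ Finset.Icc 1 (n - 1), invWeight (delta p n) 0 f h (w t) ≤ 2 * K →
    weightMean PW f (mix (delta p n) h)
      ≤ K ^ 2 * (18 + 31 * √c + (delta p n)⁻¹ * √(logTerm ε n / n))
  risk_dev : ∀ f ∈ F,
    ∑ t ∈ Finset.Icc 1 n, weightMean PW f (mix (delta p t) (gt t))
      ≤ n * (K ^ 2 * varBound c p ε n) →
    ∑ t ∈ Finset.Icc 1 n, weightMean PW fstar (mix (delta p t) (gt t))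
      ≤ n * (K ^ 2 * varBound c p ε n) →
    (n * risk PW η f - ∑ t ∈ Finset.Icc 1 n, isLoss (mix (delta p t) (gt t)) f (w t) (a t) (y t))
      + (∑ t ∈ Finset.Icc 1 n, isLoss (mix (delta p t) (gt t)) fstar (w t) (a t) (y t)
        - n * risk PW η fstar)
      ≤ n * (3 / 2 * aTerm c p ε (delta p n) (vTerm K c p ε (delta p n) n) n)
  reward : ∑ t ∈ Finset.Icc 1 n, (value PW η (mix (delta p t) (gt t)) - y t)
    ≤ 2 * √(n * logTerm ε n)

/-- The budget is 1 + 2 + 1 + 1 = 5 times exp(-L): transfer of the weights, chaining over F, upper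
deviation of f*, and rewards. -/
theorem IsBandit.exists_goodAt [IsProbabilityMeasure μ] [IsProbabilityMeasure PW]
    (hB : IsBandit μ PW η (fun t ω => mix (delta p t) (gt t ω)) W A Y)
    (hη : ∀ a, Measurable (η a)) (hη01 : ∀ a w, 0 ≤ η a w ∧ η a w ≤ 1)
    (hg : ∀ t, 1 ≤ t → ∀ a, Measurable[(history W A Y (t - 1)).prod inferInstance]
      (fun z : Ω × Context d => gt t z.1 a z.2))
    (hgp : ∀ t, 1 ≤ t → ∀ᵐ ω ∂μ, IsPolicy (gt t ω)) (hK : 2 ≤ K) (hc : 0 < c) (hp : 0 < p)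
    (hp1 : p ≠ 1) (hp2 : p ≠ 2) (hpol : ∀ f ∈ F, IsPolicy f) (hent : EntropyCondition c p F)
    (hfs : fstar ∈ F) {n : ℕ} (hn : 1 ≤ n) (hL : 2 ≤ logTerm ε n) :
    ∃ bad : Set Ω, μ bad ≤ ENNReal.ofReal (5 * Real.exp (-logTerm ε n)) ∧ ∀ ω ∉ bad,
      GoodAt PW η F c p ε fstar (fun t => gt t ω) (fun t => W t ω) (fun t => A t ω)
        (fun t => Y t ω) n := by
  have hK0 : 0 < K := by omega
  have hn0 : (0 : ℝ) < n := by exact_mod_cast hn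
  have hmix : ∀ t, 1 ≤ t → ∀ a, Measurable[(history W A Y (t - 1)).prod inferInstance]
      (fun z : Ω × Context d => mix (delta p t) (gt t z.1) a z.2) := fun t ht a =>
    Measurable.const_add (Measurable.const_mul (hg t ht a) _) _
  have hmixp : ∀ t, 1 ≤ t → ∀ᵐ ω ∂μ, IsPolicy (mix (delta p t) (gt t ω)) := fun t ht => by
    filter_upwards [hgp t ht] with ω h
    exact h.mix hK0 (delta_pos ht).le (delta_le_one hp ht)
  have hgd : ∀ᵐ ω ∂μ, ∀ t, 1 ≤ t → t ≤ n →
      IsDesign (delta p n)⁻¹ (mix (delta p t) (gt t ω)) := by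
    rw [ae_all_iff]
    intro t
    by_cases ht : 1 ≤ t
    · filter_upwards [hgp t ht] with ω h _ htn
      exact isDesign_mix hK0 (delta_pos ht) (delta_le_one hp ht) (inv_delta_mono hp htn) h
    · exact Filter.Eventually.of_forall fun ω h => absurd h ht
  obtain ⟨r₀, b, J, hr0, hb, hJ, hbound⟩ := exists_chain_bound (vb := varBound c p ε n) hK hc hp
    hp1 hp2 hn hL rfl
  have hvb := varBound_pos (c := c) (p := p) (ε := ε) hn
  have hu0 : 0 < (delta p n)⁻¹ := inv_pos.2 (delta_pos hn)
  have hexp : Real.exp (-logTerm ε n) ≤ 1 / 2 := by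
    have h1 := Real.add_one_le_exp (logTerm ε n)
    rw [Real.exp_neg, one_div]
    exact inv_anti₀ (by norm_num) (by linarith)
  obtain ⟨B1, hB1, h1⟩ := hB.uniform_invWeight_delta hη hη01 hmix hmixp hK hc hp hpol hent hn
    (by linarith : 0 ≤ logTerm ε n)
  obtain ⟨B2, hB2, h2⟩ := hB.chaining hη hη01 hmix hmixp hK0 hc hp hpol hent hn hu0.le hb
    (lt_min hb hu0) (fun x _ hxu hxb => le_min hxb hxu) hgd hvb hr0 hexp hJ
  obtain ⟨B3, hB3, h3⟩ := hB.upper_deviation hη hη01 hmix hmixp hK0 hn hu0 hgd hvb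
    (by linarith : 0 < logTerm ε n) (hpol _ hfs)
  obtain ⟨B4, hB4, h4⟩ := hB.reward_deviation hη hη01 hmix hmixp hn
    (by linarith : 0 < logTerm ε n)
  obtain ⟨N, hN, hN2⟩ : ∃ N : Set Ω, μ N = 0 ∧ ∀ ω ∉ N, ∀ t, 1 ≤ t → t ≤ n →
      IsDesign (delta p n)⁻¹ (mix (delta p t) (gt t ω)) :=
    ⟨_, ae_iff.1 hgd, fun ω hω => not_not.1 hω⟩
  refine ⟨B1 ∪ (B2 ∪ (B3 ∪ (B4 ∪ N))), ?_, fun ω hω => ?_⟩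
  · have he := Real.exp_nonneg (-logTerm ε n)
    calc μ (B1 ∪ (B2 ∪ (B3 ∪ (B4 ∪ N))))
        ≤ μ B1 + (μ B2 + (μ B3 + (μ B4 + μ N))) :=
          (measure_union_le _ _).trans (add_le_add_right ((measure_union_le _ _).trans
            (add_le_add_right ((measure_union_le _ _).trans
              (add_le_add_right (measure_union_le _ _) _)) _)) _)
      _ ≤ ENNReal.ofReal (Real.exp (-logTerm ε n)) + (ENNReal.ofReal (2 * Real.exp (-logTerm ε n))
          + (ENNReal.ofReal (Real.exp (-logTerm ε n))
            + (ENNReal.ofReal (Real.exp (-logTerm ε n)) + 0))) := by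
          rw [hN]; gcongr
      _ = ENNReal.ofReal (5 * Real.exp (-logTerm ε n)) := by
          rw [add_zero, ← ENNReal.ofReal_add he he, ← ENNReal.ofReal_add (by positivity)
            (by positivity), ← ENNReal.ofReal_add he (by positivity)]
          congr 1
          ring
  · simp only [Set.mem_union, not_or] at hω
    obtain ⟨o1, o2, o3, o4, o5⟩ := hω
    refine ⟨fun f hf h hh hs => ?_, fun f hf hs hs' => ?_, h4 ω o4⟩
    · rw [weightMean_mix]
      exact h1 ω o1 f hf h hh hs
    · have e2 := h2 ω o2 f hf hs
      have e3 := h3 ω o3 hs'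
      -- The first entry of the minimum holds because empirical losses are nonnegative and the risk
      -- is at most 1/K.
      refine le_trans (add_le_add (le_min ?_ e2) e3) hbound
      have hr := risk_le_one_div (PW := PW) hK0 hη hη01 (hpol f hf)
      have hs0 : 0 ≤ ∑ t ∈ Finset.Icc 1 n,
          isLoss (mix (delta p t) (gt t ω)) f (W t ω) (A t ω) (Y t ω) :=
        Finset.sum_nonneg fun t ht => by
          obtain ⟨ht1, ht2⟩ := Finset.mem_Icc.1 ht
          exact isLoss_nonneg (hN2 ω o5 t ht1 ht2) (hpol f hf) _ _ (hB.binary_Y t ht1 ω)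
      have := mul_le_mul_of_nonneg_left hr hn0.le
      linarith

end Events

/-! ### The confidence levels L_n and the union bound over time -/

section LogTerm

variable {ε : ℝ} {m n : ℕ}

theorem logTerm_arg_pos (hε : 0 < ε) (hn : 1 ≤ n) : 0 < (n : ℝ) * ((n : ℝ) + 1) / ε := by
  have : (0 : ℝ) < n := by exact_mod_cast hn
  positivity

theorem logTerm_mono (hε : 0 < ε) (hm : 1 ≤ m) (hmn : m ≤ n) : logTerm ε m ≤ logTerm ε n := by
  have : (m : ℝ) ≤ n := by exact_mod_cast hmn
  exact Real.log_le_log (logTerm_arg_pos hε hm) (by gcongr)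

theorem two_le_logTerm (hε : 0 < ε) (hε7 : ε ≤ 1 / 7) (hn : 1 ≤ n) : 2 ≤ logTerm ε n := by
  have hn' : (1 : ℝ) ≤ n := by exact_mod_cast hn
  rw [logTerm, Real.le_log_iff_exp_le (logTerm_arg_pos hε hn), le_div_iff₀ hε]
  have h1 := Real.exp_one_lt_d9
  have h2 : Real.exp 2 = Real.exp 1 * Real.exp 1 := by rw [← Real.exp_add]; norm_num
  have h3 := Real.exp_pos 1
  have h4 : Real.exp 2 ≤ 14 := by rw [h2]; nlinarith
  calc Real.exp 2 * ε ≤ 14 * (1 / 7) := by gcongr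
    _ ≤ n * (n + 1) := by nlinarith

theorem exp_neg_logTerm (hε : 0 < ε) (hn : 1 ≤ n) :
    Real.exp (-logTerm ε n) = ε * (1 / ((n : ℝ) * (n + 1))) := by
  rw [Real.exp_neg, logTerm, Real.exp_log (logTerm_arg_pos hε hn), inv_div, mul_one_div]

theorem sum_one_div_mul_succ_le (m : ℕ) :
    ∑ i ∈ Finset.range m, 1 / (((i + 1 : ℕ) : ℝ) * (((i + 1 : ℕ) : ℝ) + 1)) ≤ 1 := by
  have h : ∑ i ∈ Finset.range m, 1 / (((i + 1 : ℕ) : ℝ) * (((i + 1 : ℕ) : ℝ) + 1))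
      = 1 - 1 / ((m : ℝ) + 1) := by
    induction m with
    | zero => simp
    | succ m ih =>
      rw [Finset.sum_range_succ, ih]
      push_cast
      field_simp
      ring
  rw [h]
  have : 0 ≤ 1 / ((m : ℝ) + 1) := by positivity
  linarith

/-- A union bound over all times. -/
theorem exists_null_of_forall_time {Ω : Type*} [MeasurableSpace Ω] {μ : Measure Ω}
    {P : ℕ → Ω → Prop} {C : ℝ} (hC : 0 ≤ C) (hε : 0 < ε)
    (h : ∀ n, 1 ≤ n → ∃ bad : Set Ω, μ bad ≤ ENNReal.ofReal (C * Real.exp (-logTerm ε n)) ∧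
      ∀ ω ∉ bad, P n ω) :
    ∃ bad : Set Ω, μ bad ≤ ENNReal.ofReal (C * ε) ∧ ∀ ω ∉ bad, ∀ n, 1 ≤ n → P n ω := by
  choose B hB1 hB2 using fun n : ℕ => h (n + 1) (Nat.le_add_left 1 n)
  refine ⟨⋃ n, B n, (measure_iUnion_le _).trans ?_, fun ω hω n hn => ?_⟩
  · refine ENNReal.tsum_le_of_sum_range_le fun m => ?_
    calc ∑ i ∈ Finset.range m, μ (B i)
        ≤ ∑ i ∈ Finset.range m, ENNReal.ofReal
          (C * ε * (1 / (((i + 1 : ℕ) : ℝ) * (((i + 1 : ℕ) : ℝ) + 1)))) :=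
          Finset.sum_le_sum fun i _ => by
            rw [mul_assoc, ← exp_neg_logTerm hε (Nat.le_add_left 1 i)]
            exact hB1 i
      _ = ENNReal.ofReal (C * ε *
          ∑ i ∈ Finset.range m, 1 / (((i + 1 : ℕ) : ℝ) * (((i + 1 : ℕ) : ℝ) + 1))) := by
          rw [Finset.mul_sum, ENNReal.ofReal_sum_of_nonneg fun i _ => by positivity]
      _ ≤ ENNReal.ofReal (C * ε) := ENNReal.ofReal_le_ofReal
          (mul_le_of_le_one_right (by positivity) (sum_one_div_mul_succ_le m))
  · obtain ⟨k, rfl⟩ : ∃ k, n = k + 1 := ⟨n - 1, by omega⟩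
    exact hB2 k ω fun hk => hω (Set.mem_iUnion.2 ⟨k, hk⟩)

/-- Passing from n to n+1 multiplies the argument of the logarithm by 1 + 2/n, so L grows by at most
2/n; since L_n ≥ 2, the quotient by n does not increase. -/
theorem logTerm_succ_div_le (hε : 0 < ε) (hε7 : ε ≤ 1 / 7) (hn : 1 ≤ n) :
    logTerm ε (n + 1) / ((n + 1 : ℕ) : ℝ) ≤ logTerm ε n / n := by
  have hn0 : (0 : ℝ) < n := by exact_mod_cast hn
  have h2 := two_le_logTerm hε hε7 hn
  have h1 : logTerm ε (n + 1) ≤ logTerm ε n + 2 / n := by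
    have e : ((n + 1 : ℕ) : ℝ) * (((n + 1 : ℕ) : ℝ) + 1) / ε
        = (n : ℝ) * ((n : ℝ) + 1) / ε * (2 / n + 1) := by
      push_cast; field_simp; ring
    rw [logTerm, logTerm, e, Real.log_mul (logTerm_arg_pos hε hn).ne' (by positivity)]
    have := Real.log_le_sub_one_of_pos (show (0 : ℝ) < 2 / n + 1 by positivity)
    linarith
  rw [div_le_div_iff₀ (by positivity) hn0]
  have h3 : logTerm ε (n + 1) * n ≤ (logTerm ε n + 2 / n) * n := by gcongr
  have h4 : (logTerm ε n + 2 / n) * n = logTerm ε n * n + 2 := by field_simp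
  push_cast
  linarith

theorem logTerm_div_antitone (hε : 0 < ε) (hε7 : ε ≤ 1 / 7) (hm : 1 ≤ m) (hmn : m ≤ n) :
    logTerm ε n / n ≤ logTerm ε m / m := by
  induction n, hmn using Nat.le_induction with
  | base => exact le_rfl
  | succ n hn ih => exact (logTerm_succ_div_le hε hε7 (hm.trans hn)).trans ih

/-- The left side is n√(L_n/n), and each √(L_t/t) with t ≤ n is at least as large. This allows the
reward fluctuations to be charged to the sum of the thresholds. -/
theorem sqrt_mul_logTerm_le_sum (hε : 0 < ε) (hε7 : ε ≤ 1 / 7) (hn : 1 ≤ n) :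
    √(n * logTerm ε n) ≤ ∑ t ∈ Finset.Icc 1 n, √(logTerm ε t / t) := by
  have hn0 : (0 : ℝ) < n := by exact_mod_cast hn
  have h1 : √(n * logTerm ε n) = ∑ t ∈ Finset.Icc 1 n, √(logTerm ε n / n) := by
    rw [Finset.sum_const, Nat.card_Icc, add_tsub_cancel_right, nsmul_eq_mul]
    nth_rewrite 2 [← Real.sqrt_sq hn0.le]
    rw [← Real.sqrt_mul (by positivity)]
    congr 1
    field_simp
  rw [h1]
  refine Finset.sum_le_sum fun t ht => Real.sqrt_le_sqrt ?_
  obtain ⟨ht1, ht2⟩ := Finset.mem_Icc.1 ht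
  exact logTerm_div_antitone hε hε7 ht1 ht2

end LogTerm

/-! ### Lower bounds for the thresholds and averaging of the weight bounds -/

section Thresholds

variable {c p ε : ℝ} {K n : ℕ}

theorem c₁_nonneg : 0 ≤ c₁ c p := by
  have := Real.sqrt_nonneg c
  rw [c₁]
  split_ifs with h
  · have : 0 < 1 - p := by linarith
    positivity
  · have : 0 ≤ p - 1 := by linarith
    positivity

theorem four_le_vTerm (hK : 2 ≤ K) (hn : 1 ≤ n) (hL : 0 ≤ logTerm ε n) :
    4 ≤ vTerm K c p ε (delta p n) n := by
  have hδ := delta_pos (p := p) hn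
  have h := vTerm_ge (K := K) (c := c) (p := p) hL hδ
  have hK' : (2 : ℝ) ≤ K := by exact_mod_cast hK
  have h1 : 0 ≤ (delta p n)⁻¹ * (c₁' c p / (n : ℝ) ^ (min (1 / 2) (1 / p))) := by
    have := c₁'_nonneg (c := c) (p := p)
    positivity
  have h2 : 0 ≤ (delta p n)⁻¹ * √(logTerm ε n / n) := by positivity
  linarith

theorem sqrt_logTerm_div_le_aTerm (hK : 2 ≤ K) (hn : 1 ≤ n) (hL : 0 ≤ logTerm ε n) :
    74 * √(logTerm ε n / n) ≤ aTerm c p ε (delta p n) (vTerm K c p ε (delta p n) n) n := by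
  have hδ := delta_pos (p := p) hn
  refine le_trans ?_ (aTerm_ge rfl hδ _)
  have hv : 2 ≤ √(vTerm K c p ε (delta p n) n) :=
    Real.le_sqrt_of_sq_le (by linarith [four_le_vTerm (c := c) (p := p) hK hn hL])
  have h1 : 0 ≤ c₁ c p / (delta p n)⁻¹ := by
    have := c₁_nonneg (c := c) (p := p)
    positivity
  have h2 : 0 ≤ 3 * logTerm ε n * (delta p n)⁻¹ / n := by positivity
  calc 74 * √(logTerm ε n / n) = 2 * (37 * √(logTerm ε n / n)) := by ring
    _ ≤ 2 * (c₁ c p / (delta p n)⁻¹ + 37 * √(logTerm ε n / n)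
      + 3 * logTerm ε n * (delta p n)⁻¹ / n) := by linarith
    _ ≤ _ := by gcongr

theorem two_mul_aTerm_le_xThreshold (hn : 1 ≤ n) (hL : 0 ≤ logTerm ε n) :
    2 * aTerm c p ε (delta p n) (vTerm K c p ε (delta p n) n) n ≤ xThreshold K c p ε n := by
  have hδ := delta_pos (p := p) hn
  have : 0 ≤ bTerm ε (delta p n) (vTerm K c p ε (delta p n) n) n := by
    unfold bTerm
    positivity
  unfold xThreshold
  linarith

theorem sum_inv_sqrt_le (n : ℕ) : ∑ t ∈ Finset.Icc 1 n, 1 / √(t : ℝ) ≤ 2 * √(n : ℝ) := by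
  induction n with
  | zero => simp
  | succ n ih =>
    rw [Finset.sum_Icc_succ_top (by omega)]
    have h0 : (0 : ℝ) < ((n + 1 : ℕ) : ℝ) := by positivity
    have h1 : 0 < √((n + 1 : ℕ) : ℝ) := Real.sqrt_pos.2 h0
    have h2 := Real.sq_sqrt h0.le
    have h3 := Real.sq_sqrt (Nat.cast_nonneg (α := ℝ) n)
    have h4 : 1 / √((n + 1 : ℕ) : ℝ) ≤ 2 * (√((n + 1 : ℕ) : ℝ) - √(n : ℝ)) := by
      rw [div_le_iff₀ h1]
      push_cast at h2 ⊢
      nlinarith [sq_nonneg (√((n : ℝ) + 1) - √(n : ℝ))]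
    linarith

/-- Both 1/δ_t and L_t are nondecreasing, and the sum of 1/√t is at most 2√n; this is the source of
the factor 2 in `varBound`. -/
theorem sum_weight_bound_le (hp : 0 < p) (hε : 0 < ε) (hn : 1 ≤ n) :
    ∑ t ∈ Finset.Icc 1 n, ((K : ℝ) ^ 2 * (18 + 31 * √c + (delta p t)⁻¹ * √(logTerm ε t / t)))
      ≤ n * (K ^ 2 * varBound c p ε n) := by
  have hn0 : (0 : ℝ) < n := by exact_mod_cast hn
  have hu := inv_pos.2 (delta_pos (p := p) hn)
  have h1 : ∀ t ∈ Finset.Icc 1 n, (delta p t)⁻¹ * √(logTerm ε t / t)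
      ≤ (delta p n)⁻¹ * √(logTerm ε n) * (1 / √(t : ℝ)) := fun t ht => by
    obtain ⟨ht1, ht2⟩ := Finset.mem_Icc.1 ht
    rw [Real.sqrt_div' _ (Nat.cast_nonneg t), mul_assoc, mul_one_div]
    have := inv_delta_mono hp ht2
    have := logTerm_mono hε ht1 ht2
    gcongr
  have h2 : ∑ t ∈ Finset.Icc 1 n, (delta p t)⁻¹ * √(logTerm ε t / t)
      ≤ n * (2 * (delta p n)⁻¹ * √(logTerm ε n / n)) := by
    calc ∑ t ∈ Finset.Icc 1 n, (delta p t)⁻¹ * √(logTerm ε t / t)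
        ≤ (delta p n)⁻¹ * √(logTerm ε n) * (2 * √(n : ℝ)) := by
          refine (Finset.sum_le_sum h1).trans ?_
          rw [← Finset.mul_sum]
          gcongr
          exact sum_inv_sqrt_le n
      _ = n * (2 * (delta p n)⁻¹ * √(logTerm ε n / n)) := by
          rw [Real.sqrt_div' _ hn0.le]
          field_simp
          rw [Real.sq_sqrt hn0.le]
  rw [← Finset.mul_sum, Finset.sum_add_distrib, Finset.sum_const, Nat.card_Icc,
    add_tsub_cancel_right, nsmul_eq_mul, varBound]
  linarith [mul_le_mul_of_nonneg_left h2 (sq_nonneg (K : ℝ))]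

end Thresholds

/-! ### The deterministic elimination argument along a good trajectory -/

section Elimination

variable {d K : ℕ} {PW : Measure (Context d)} {η : ActionFn d K} {gt : ℕ → ActionFn d K}
  {w : ℕ → Context d} {a : ℕ → Fin K} {y : ℕ → ℝ} {F : Set (ActionFn d K)} {c p ε : ℝ}
  {fstar : ActionFn d K} {x : ℕ → ℝ} {R : ℕ → ActionFn d K → ℝ}

theorem mem_candidates_succ {t : ℕ} (ht : 1 ≤ t) {f : ActionFn d K} :
    f ∈ candidates F x R (t + 1) ↔ f ∈ candidates F x R t ∧
      ∀ h ∈ candidates F x R t, R t f ≤ R t h + x t := by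
  obtain ⟨k, rfl⟩ : ∃ k, t = k + 1 := ⟨t - 1, by omega⟩
  exact Iff.rfl

theorem candidates_antitone {s t : ℕ} (hs : 1 ≤ s) (hst : s ≤ t) :
    candidates F x R t ⊆ candidates F x R s := by
  induction t, hst using Nat.le_induction with
  | base => exact subset_rfl
  | succ t ht ih => exact fun f hf => ih ((mem_candidates_succ (hs.trans ht)).1 hf).1

theorem candidates_subset {t : ℕ} (ht : 1 ≤ t) : candidates F x R t ⊆ F :=
  candidates_antitone le_rfl ht

/-- A trajectory of the algorithm along which all deviation inequalities hold. -/
structure GoodPath (PW : Measure (Context d)) (η : ActionFn d K) (F : Set (ActionFn d K))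
    (c p ε : ℝ) (fstar : ActionFn d K) (gt : ℕ → ActionFn d K) (w : ℕ → Context d) (a : ℕ → Fin K)
    (y : ℕ → ℝ) : Prop where
  good : ∀ n, 1 ≤ n → GoodAt PW η F c p ε fstar gt w a y n
  mem : ∀ t, 1 ≤ t → gt t ∈ candidates F (xThreshold K c p ε)
    (empRisk (fun τ => mix (delta p τ) (gt τ)) w a y) t
  search : ∀ t, 1 ≤ t → ∀ f ∈ candidates F (xThreshold K c p ε)
    (empRisk (fun τ => mix (delta p τ) (gt τ)) w a y) t,
    ((t : ℝ) - 1)⁻¹ * ∑ τ ∈ Finset.Icc 1 (t - 1), invWeight (delta p t) 0 f (gt t) (w τ) ≤ 2 * K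

/-- The candidate sets are nested, so a survivor of time n met the search constraint at every t ≤ n.
-/
theorem GoodPath.sum_weightMean_le (hP : GoodPath PW η F c p ε fstar gt w a y) (hp : 0 < p)
    (hε : 0 < ε) {n : ℕ} (hn : 1 ≤ n) {f : ActionFn d K}
    (hf : f ∈ candidates F (xThreshold K c p ε)
      (empRisk (fun τ => mix (delta p τ) (gt τ)) w a y) n) :
    ∑ t ∈ Finset.Icc 1 n, weightMean PW f (mix (delta p t) (gt t))
      ≤ n * (K ^ 2 * varBound c p ε n) := by
  refine (Finset.sum_le_sum fun t ht => ?_).trans (sum_weight_bound_le hp hε hn)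
  obtain ⟨ht1, ht2⟩ := Finset.mem_Icc.1 ht
  exact (hP.good t ht1).weight f (candidates_subset hn hf) (gt t)
    (candidates_subset ht1 (hP.mem t ht1)) (hP.search t ht1 f (candidates_antitone ht1 ht2 hf))

/-- The deviation (3/2) a_n is at most (3/4) x_n, as x_n ≥ 2 a_n. Both policies must still be
candidates, since the variance bound holds only for survivors. -/
theorem GoodPath.risk_sub_le (hP : GoodPath PW η F c p ε fstar gt w a y) (hp : 0 < p)
    (hε : 0 < ε) (hε7 : ε ≤ 1 / 7) {n : ℕ} (hn : 1 ≤ n) {f : ActionFn d K}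
    (hf : f ∈ candidates F (xThreshold K c p ε)
      (empRisk (fun τ => mix (delta p τ) (gt τ)) w a y) n)
    (hfs : fstar ∈ candidates F (xThreshold K c p ε)
      (empRisk (fun τ => mix (delta p τ) (gt τ)) w a y) n) :
    (risk PW η f - risk PW η fstar)
      - (empRisk (fun τ => mix (delta p τ) (gt τ)) w a y n f
        - empRisk (fun τ => mix (delta p τ) (gt τ)) w a y n fstar)
      ≤ 3 / 4 * xThreshold K c p ε n := by
  have hn0 : (0 : ℝ) < n := by exact_mod_cast hn
  have h := (hP.good n hn).risk_dev f (candidates_subset hn hf)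
    (hP.sum_weightMean_le hp hε hn hf) (hP.sum_weightMean_le hp hε hn hfs)
  have hx := two_mul_aTerm_le_xThreshold (K := K) (c := c) (p := p) hn
    (by linarith [two_le_logTerm hε hε7 hn] : 0 ≤ logTerm ε n)
  refine le_of_mul_le_mul_left ?_ hn0
  have e : ∀ g : ActionFn d K, (n : ℝ) * empRisk (fun τ => mix (delta p τ) (gt τ)) w a y n g
      = ∑ t ∈ Finset.Icc 1 n, isLoss (mix (delta p t) (gt t)) g (w t) (a t) (y t) := fun g =>
    mul_inv_cancel_left₀ hn0.ne' _
  calc _ = _ := by rw [mul_sub, mul_sub, mul_sub, e, e]; ring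
    _ ≤ _ := h
    _ ≤ n * (3 / 4 * xThreshold K c p ε n) := mul_le_mul_of_nonneg_left (by linarith) hn0.le

/-- Since f* has the smaller true risk, its empirical risk exceeds that of any surviving competitor
by at most (3/4) x_n ≤ x_n. -/
theorem GoodPath.fstar_mem (hP : GoodPath PW η F c p ε fstar gt w a y) (hp : 0 < p)
    (hK : 2 ≤ K) (hε : 0 < ε) (hε7 : ε ≤ 1 / 7) (hfs : fstar ∈ F)
    (hmin : ∀ f ∈ F, risk PW η fstar ≤ risk PW η f) {n : ℕ} (hn : 1 ≤ n) :
    fstar ∈ candidates F (xThreshold K c p ε)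
      (empRisk (fun τ => mix (delta p τ) (gt τ)) w a y) n := by
  induction n, hn using Nat.le_induction with
  | base => exact hfs
  | succ n hn ih =>
    refine (mem_candidates_succ hn).2 ⟨ih, fun h hh => ?_⟩
    have h1 := hP.risk_sub_le hp hε hε7 hn hh ih
    have h2 := hmin h (candidates_subset hn hh)
    have hL : 0 ≤ logTerm ε n := by linarith [two_le_logTerm hε hε7 hn]
    have h3 := two_mul_aTerm_le_xThreshold (K := K) (c := c) (p := p) hn hL
    have h4 := sqrt_logTerm_div_le_aTerm (K := K) (c := c) (p := p) hK hn hL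
    have h5 := Real.sqrt_nonneg (logTerm ε n / n)
    linarith

/-- The elimination rule, compared with the surviving f*, allows an empirical excess x_n; the
deviation adds (3/4) x_n. -/
theorem GoodPath.risk_succ_le (hP : GoodPath PW η F c p ε fstar gt w a y) (hp : 0 < p)
    (hK : 2 ≤ K) (hε : 0 < ε) (hε7 : ε ≤ 1 / 7) (hfs : fstar ∈ F)
    (hmin : ∀ f ∈ F, risk PW η fstar ≤ risk PW η f) {n : ℕ} (hn : 1 ≤ n) :
    risk PW η (gt (n + 1)) - risk PW η fstar ≤ 7 / 4 * xThreshold K c p ε n := by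
  have hf := (mem_candidates_succ hn).1 (hP.mem (n + 1) (by omega))
  have hs := hP.fstar_mem hp hK hε hε7 hfs hmin hn
  have h1 := hP.risk_sub_le hp hε hε7 hn hf.1 hs
  have h2 := hf.2 fstar hs
  linarith

theorem GoodPath.sum_value_le [IsProbabilityMeasure PW] (hη : ∀ a, Measurable (η a))
    (hη01 : ∀ a w, 0 ≤ η a w ∧ η a w ≤ 1) (hpol : ∀ f ∈ F, IsPolicy f)
    (hP : GoodPath PW η F c p ε fstar gt w a y) (hp : 0 < p)
    (hK : 2 ≤ K) (hε : 0 < ε) (hε7 : ε ≤ 1 / 7) (hfs : fstar ∈ F)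
    (hmin : ∀ f ∈ F, risk PW η fstar ≤ risk PW η f) (n : ℕ) :
    ∑ t ∈ Finset.Icc 1 (n + 1), (value PW η fstar - value PW η (mix (delta p t) (gt t)))
      ≤ ∑ t ∈ Finset.Icc 1 (n + 1), delta p t
        + 7 / 4 * K * ∑ t ∈ Finset.Icc 1 n, xThreshold K c p ε t := by
  have hK0 : 0 < K := by omega
  have hstep : ∀ t, 1 ≤ t → value PW η fstar - value PW η (mix (delta p t) (gt t))
      ≤ delta p t + (1 - delta p t) * (K * (risk PW η (gt t) - risk PW η fstar)) := fun t ht =>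
    value_sub_value_mix_le hK0 hη hη01 (delta_pos ht).le (delta_le_one hp ht) (hpol _ hfs)
      (hpol _ (candidates_subset ht (hP.mem t ht)))
  induction n with
  | zero =>
    -- The first round plays the uniform design, so the uncontrolled risk of the first candidate has
    -- weight 1 - δ_1 = 0. This is why the sum of thresholds stops one round earlier.
    have h1 : delta p 1 = 1 := by simp [delta]
    have := hstep 1 le_rfl
    simp only [h1, sub_self, zero_mul] at this
    simpa [h1] using this
  | succ n ih =>
    have e : ∀ (m : ℕ) (f : ℕ → ℝ), ∑ t ∈ Finset.Icc 1 (m + 1), f t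
        = ∑ t ∈ Finset.Icc 1 m, f t + f (m + 1) := fun m f =>
      Finset.sum_Icc_succ_top (by omega) f
    rw [e (n + 1), e (n + 1), e n fun t => xThreshold K c p ε t]
    have h1 := hstep (n + 1 + 1) (by omega)
    have h2 := hP.risk_succ_le hp hK hε hε7 hfs hmin (n := n + 1) (by omega)
    have h3 := hmin _ (candidates_subset (by omega) (hP.mem (n + 1 + 1) (by omega)))
    have h4 : (1 - delta p (n + 1 + 1)) * (K * (risk PW η (gt (n + 1 + 1)) - risk PW η fstar))
        ≤ K * (risk PW η (gt (n + 1 + 1)) - risk PW η fstar) :=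
      mul_le_of_le_one_left (mul_nonneg (Nat.cast_nonneg K) (by linarith))
        (by linarith [delta_pos (p := p) (show 1 ≤ n + 1 + 1 by omega)])
    have h5 : (K : ℝ) * (risk PW η (gt (n + 1 + 1)) - risk PW η fstar)
        ≤ K * (7 / 4 * xThreshold K c p ε (n + 1)) := by gcongr
    linarith

theorem GoodPath.regret_le [IsProbabilityMeasure PW] (hη : ∀ a, Measurable (η a))
    (hη01 : ∀ a w, 0 ≤ η a w ∧ η a w ≤ 1) (hpol : ∀ f ∈ F, IsPolicy f)
    (hP : GoodPath PW η F c p ε fstar gt w a y) (hp : 0 < p)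
    (hK : 2 ≤ K) (hε : 0 < ε) (hε7 : ε ≤ 1 / 7) (hfs : fstar ∈ F)
    (hmin : ∀ f ∈ F, risk PW η fstar ≤ risk PW η f) {n : ℕ} (hn : 1 ≤ n) :
    ∑ t ∈ Finset.Icc 1 n, (value PW η fstar - y t) ≤ regretBound K c p ε n := by
  have hK' : (2 : ℝ) ≤ K := by exact_mod_cast hK
  have hx : ∀ t ∈ Finset.Icc 1 n, 148 * √(logTerm ε t / t) ≤ xThreshold K c p ε t := fun t ht => by
    have ht1 := (Finset.mem_Icc.1 ht).1
    have hL : 0 ≤ logTerm ε t := by linarith [two_le_logTerm hε hε7 ht1]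
    linarith [two_mul_aTerm_le_xThreshold (K := K) (c := c) (p := p) ht1 hL,
      sqrt_logTerm_div_le_aTerm (K := K) (c := c) (p := p) hK ht1 hL]
  have hsum : 148 * √(n * logTerm ε n) ≤ ∑ t ∈ Finset.Icc 1 n, xThreshold K c p ε t :=
    (mul_le_mul_of_nonneg_left (sqrt_mul_logTerm_le_sum hε hε7 hn) (by norm_num)).trans
      (by rw [Finset.mul_sum]; exact Finset.sum_le_sum hx)
  have hr := (hP.good n hn).reward
  have hlast : 0 ≤ xThreshold K c p ε n :=
    le_trans (by positivity) (hx n (Finset.mem_Icc.2 ⟨hn, le_rfl⟩))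
  obtain ⟨m, rfl⟩ : ∃ m, n = m + 1 := ⟨n - 1, by omega⟩
  have hv := hP.sum_value_le hη hη01 hpol hp hK hε hε7 hfs hmin m
  have hsplit : ∑ t ∈ Finset.Icc 1 (m + 1), (value PW η fstar - y t)
      = ∑ t ∈ Finset.Icc 1 (m + 1), (value PW η fstar - value PW η (mix (delta p t) (gt t)))
        + ∑ t ∈ Finset.Icc 1 (m + 1), (value PW η (mix (delta p t) (gt t)) - y t) := by
    rw [← Finset.sum_add_distrib]
    exact Finset.sum_congr rfl fun t _ => (sub_add_sub_cancel _ _ _).symm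
  have hle : ∑ t ∈ Finset.Icc 1 m, xThreshold K c p ε t
      ≤ ∑ t ∈ Finset.Icc 1 (m + 1), xThreshold K c p ε t := by
    rw [Finset.sum_Icc_succ_top (by omega)]
    linarith
  rw [hsplit, regretBound]
  set X := ∑ t ∈ Finset.Icc 1 (m + 1), xThreshold K c p ε t
  have h1 : 7 / 4 * (K : ℝ) * ∑ t ∈ Finset.Icc 1 m, xThreshold K c p ε t ≤ 7 / 4 * (K : ℝ) * X := by
    gcongr
  have h3 := Real.sqrt_nonneg (((m + 1 : ℕ) : ℝ) * Real.log (1 / ε))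
  have h4 := Real.sqrt_nonneg (((m + 1 : ℕ) : ℝ) * logTerm ε (m + 1))
  -- The slack (1/4) K X is at least X/2, hence at least 74√(nL_n), well above the 2√(nL_n) needed
  -- for the rewards.
  have h2 : 2 * X ≤ K * X := mul_le_mul_of_nonneg_right hK' (by linarith)
  linarith

end Elimination

/-! ### The regret bound with high probability -/

theorem exists_null_of_ae {Ω : Type*} [MeasurableSpace Ω] {μ : Measure Ω} {P : Ω → Prop}
    (h : ∀ᵐ ω ∂μ, P ω) : ∃ N : Set Ω, μ N = 0 ∧ ∀ ω ∉ N, P ω :=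
  ⟨_, ae_iff.1 h, fun _ hω => not_not.1 hω⟩

/-- The regret bound holds with probability at least `1 - 7 ε`. -/
theorem IsGPERun.regret_le {d K : ℕ} {Ω : Type*} [MeasurableSpace Ω] {μ : Measure Ω}
    [IsProbabilityMeasure μ] {PW : Measure (Context d)} [IsProbabilityMeasure PW]
    {η : ActionFn d K} {F : Set (ActionFn d K)} {c p ε : ℝ} {fstar : ActionFn d K}
    {gt : ℕ → Ω → ActionFn d K} {W : ℕ → Ω → Context d} {A : ℕ → Ω → Fin K} {Y : ℕ → Ω → ℝ}
    (hrun : IsGPERun μ PW η F (delta p) (xThreshold K c p ε) gt W A Y)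
    (hη : ∀ a, Measurable (η a)) (hη01 : ∀ a w, 0 ≤ η a w ∧ η a w ≤ 1) (hK : 2 ≤ K)
    (hc : 0 < c) (hp : 0 < p) (hp1 : p ≠ 1) (hp2 : p ≠ 2) (hpol : ∀ f ∈ F, IsPolicy f)
    (hent : EntropyCondition c p F) (hfs : fstar ∈ F)
    (hmin : ∀ f ∈ F, risk PW η fstar ≤ risk PW η f) (hε : 0 < ε) :
    ENNReal.ofReal (1 - 7 * ε) ≤ μ {ω | ∀ t : ℕ, 1 ≤ t →
      ∑ τ ∈ Finset.Icc 1 t, (value PW η fstar - Y τ ω) ≤ regretBound K c p ε t} := by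
  -- For ε > 1/7 the claimed probability is negative and truncates to 0; otherwise L_n ≥ 2 at all
  -- times.
  rcases lt_or_ge (1 / 7) ε with h7 | h7
  · rw [ENNReal.ofReal_of_nonpos (by linarith)]
    exact zero_le
  have hgp : ∀ t, 1 ≤ t → ∀ᵐ ω ∂μ, IsPolicy (gt t ω) := fun t ht => by
    filter_upwards [hrun.search t ht] with ω h
    exact hpol _ (candidates_subset ht h.1)
  obtain ⟨B, hB, hBP⟩ := exists_null_of_forall_time (μ := μ) (C := 5) (by norm_num) hε
    fun n hn => hrun.bandit.exists_goodAt hη hη01 hrun.measurable_gt hgp hK hc hp hp1 hp2 hpol hent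
      hfs hn (two_le_logTerm hε h7 hn)
  have hsearch : ∀ᵐ ω ∂μ, ∀ t, 1 ≤ t → gt t ω ∈ candidates F (xThreshold K c p ε)
      (empRisk (fun τ => mix (delta p τ) (gt τ ω)) (fun τ => W τ ω) (fun τ => A τ ω)
        (fun τ => Y τ ω)) t ∧
      ∀ f ∈ candidates F (xThreshold K c p ε)
      (empRisk (fun τ => mix (delta p τ) (gt τ ω)) (fun τ => W τ ω) (fun τ => A τ ω)
        (fun τ => Y τ ω)) t, ((t : ℝ) - 1)⁻¹ * ∑ τ ∈ Finset.Icc 1 (t - 1),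
          ∑ a, f a (W τ ω) / mix (delta p t) (gt t ω) a (W τ ω) ≤ 2 * (K : ℝ) := by
    rw [ae_all_iff]
    intro t
    by_cases ht : 1 ≤ t
    · filter_upwards [hrun.search t ht] with ω h _ using h
    · exact Filter.Eventually.of_forall fun ω h => absurd h ht
  obtain ⟨N, hN, hNP⟩ := exists_null_of_ae hsearch
  set G := {ω | ∀ t : ℕ, 1 ≤ t →
    ∑ τ ∈ Finset.Icc 1 t, (value PW η fstar - Y τ ω) ≤ regretBound K c p ε t}
  -- Covering the whole space and using subadditivity of the outer measure avoids any measurability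
  -- of these sets.
  have hsub : Set.univ ⊆ G ∪ (B ∪ N) := by
    intro ω _
    by_cases hω : ω ∈ B ∪ N
    · exact Or.inr hω
    · rw [Set.mem_union, not_or] at hω
      refine Or.inl fun t ht => GoodPath.regret_le (gt := fun t => gt t ω) (w := fun t => W t ω)
        (a := fun t => A t ω) (y := fun t => Y t ω) hη hη01 hpol
        ⟨hBP ω hω.1, fun s hs => (hNP ω hω.2 s hs).1, fun s hs f hf => ?_⟩ hp hK hε h7 hfs hmin ht
      simpa only [invWeight, add_zero] using (hNP ω hω.2 s hs).2 f hf
  have h1 : 1 ≤ μ G + ENNReal.ofReal (5 * ε) := by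
    calc 1 = μ Set.univ := measure_univ.symm
      _ ≤ μ G + (μ B + μ N) := (measure_mono hsub).trans ((measure_union_le _ _).trans
          (add_le_add_right (measure_union_le _ _) _))
      _ ≤ μ G + ENNReal.ofReal (5 * ε) := by rw [hN, add_zero]; gcongr
  calc ENNReal.ofReal (1 - 7 * ε) ≤ ENNReal.ofReal (1 - 5 * ε) :=
        ENNReal.ofReal_le_ofReal (by linarith)
    _ = 1 - ENNReal.ofReal (5 * ε) := by
        rw [ENNReal.ofReal_sub _ (by positivity), ENNReal.ofReal_one]
    _ ≤ μ G := tsub_le_iff_right.2 h1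

/-! ### Growth of the regret bound -/

section Growth

variable {c p ε M : ℝ} {K m n : ℕ}

/-- Because the exponent of δ is at most 1/2 in absolute value, √t δ_t is nondecreasing; sums of δ_t
thus reduce to sums of 1/√t. -/
theorem delta_le_inv_sqrt_mul (hmn : m ≤ n) (hm : 1 ≤ m) :
    delta p m ≤ n * delta p n / √(n : ℝ) * (1 / √(m : ℝ)) := by
  have h : ∀ k : ℕ, 1 ≤ k → k * delta p k / √(k : ℝ)
      = (k : ℝ) ^ (1 / 2 - min (1 / 2) (1 / (2 * p))) := fun k hk => by
    have hk0 : (0 : ℝ) < k := by exact_mod_cast hk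
    rw [delta, Real.sqrt_eq_rpow, show 1 / 2 - min (1 / 2) (1 / (2 * p))
      = 1 + -(min (1 / 2) (1 / (2 * p))) - 1 / 2 by ring, Real.rpow_sub hk0, Real.rpow_add hk0,
      Real.rpow_one]
  have hm0 : (0 : ℝ) < m := by exact_mod_cast hm
  rw [h n (hm.trans hmn)]
  calc delta p m = m * delta p m / √(m : ℝ) * (1 / √(m : ℝ)) := by
        field_simp
        rw [Real.sq_sqrt hm0.le]
    _ ≤ _ := by
        rw [h m hm]
        gcongr
        exact sub_nonneg.2 (min_le_left _ _)

theorem sum_delta_le (hn : 1 ≤ n) :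
    ∑ t ∈ Finset.Icc 1 n, delta p t ≤ 2 * (n * delta p n) := by
  have hn0 : (0 : ℝ) < n := by exact_mod_cast hn
  have hδ := delta_pos (p := p) hn
  calc ∑ t ∈ Finset.Icc 1 n, delta p t
      ≤ ∑ t ∈ Finset.Icc 1 n, n * delta p n / √(n : ℝ) * (1 / √(t : ℝ)) :=
        Finset.sum_le_sum fun t ht =>
          delta_le_inv_sqrt_mul (Finset.mem_Icc.1 ht).2 (Finset.mem_Icc.1 ht).1
    _ ≤ n * delta p n / √(n : ℝ) * (2 * √(n : ℝ)) := by
        rw [← Finset.mul_sum]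
        gcongr
        exact sum_inv_sqrt_le n
    _ = 2 * (n * delta p n) := by field_simp

theorem inv_sqrt_le_delta (hn : 1 ≤ n) : 1 / √(n : ℝ) ≤ delta p n := by
  rw [one_div, ← inv_inv (delta p n)]
  exact inv_anti₀ (inv_pos.2 (delta_pos hn)) (inv_delta_le_sqrt hn)

theorem inv_delta_div_le_delta (hn : 1 ≤ n) : 1 / (delta p n * n) ≤ delta p n := by
  have hn0 : (0 : ℝ) < n := by exact_mod_cast hn
  have hδ := delta_pos (p := p) hn
  have h := inv_delta_sq_le (p := p) hn
  rw [inv_pow, inv_le_comm₀ (by positivity) hn0] at h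
  rw [div_le_iff₀ (by positivity), ← mul_assoc, ← sq]
  calc (1 : ℝ) = (n : ℝ)⁻¹ * n := (inv_mul_cancel₀ hn0.ne').symm
    _ ≤ _ := by gcongr

theorem inv_delta_div_rpow_le_one (hp : 0 < p) (hn : 1 ≤ n) :
    (delta p n)⁻¹ / (n : ℝ) ^ (min (1 / 2) (1 / p)) ≤ 1 := by
  have hn0 : (1 : ℝ) ≤ n := by exact_mod_cast hn
  rw [div_le_one (by positivity), inv_delta]
  refine Real.rpow_le_rpow_of_exponent_le hn0 (min_le_min le_rfl ?_)
  exact one_div_le_one_div_of_le hp (by linarith)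

theorem log_two_le_one : Real.log 2 ≤ 1 := by linarith [Real.log_two_lt_d9]

/-- Dividing by δ_n does no harm: each quotient of 1/δ_n by n^(1/2 ∧ 1/p), √n or n is at most 1. The
constant is 64 = 32 + 16 + 16. -/
theorem vTerm_le (hp : 0 < p) (hn : 1 ≤ n) (hM : 1 ≤ M) (hLM : logTerm ε n ≤ M) :
    vTerm K c p ε (delta p n) n ≤ (2 * K + c₁' c p + 64) * M := by
  have hn0 : (0 : ℝ) < n := by exact_mod_cast hn
  have hδ := delta_pos (p := p) hn
  have hc' := c₁'_nonneg (c := c) (p := p)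
  have hsM : √M ≤ M := Real.sqrt_le_iff.2 ⟨by linarith, by nlinarith⟩
  have hsL : √(logTerm ε n) ≤ M := (Real.sqrt_le_sqrt hLM).trans hsM
  have h1 := mul_le_mul_of_nonneg_left (inv_delta_div_rpow_le_one hp hn) hc'
  have h2 : (delta p n)⁻¹ * (1 / √(n : ℝ)) ≤ 1 := by
    have := mul_le_mul_of_nonneg_left (inv_sqrt_le_delta (p := p) hn) (inv_pos.2 hδ).le
    rwa [inv_mul_cancel₀ hδ.ne'] at this
  have h3 : (delta p n)⁻¹ * (1 / (n : ℝ)) ≤ 1 := by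
    have := inv_delta_div_le_delta (p := p) hn
    rw [one_div, mul_inv] at this
    rw [one_div]
    exact this.trans (delta_le_one hp hn)
  have h4 : (delta p n)⁻¹ * (1 / √(n : ℝ)) * √(logTerm ε n) ≤ 1 * M := by gcongr
  have h5 : (delta p n)⁻¹ * (1 / (n : ℝ)) * Real.log 2 ≤ 1 * 1 := by
    have := log_two_le_one
    have := Real.log_nonneg (one_le_two (α := ℝ))
    gcongr
  have h6 : (delta p n)⁻¹ * (1 / (n : ℝ)) * logTerm ε n ≤ 1 * M :=
    (mul_le_mul_of_nonneg_left hLM (by positivity)).trans (by gcongr)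
  have h7 : (2 * K + c₁' c p) * 1 ≤ (2 * K + c₁' c p) * M := by gcongr
  calc vTerm K c p ε (delta p n) n
      = 2 * K + c₁' c p * ((delta p n)⁻¹ / (n : ℝ) ^ (min (1 / 2) (1 / p)))
        + 32 * ((delta p n)⁻¹ * (1 / √(n : ℝ)) * √(logTerm ε n))
        + 16 * ((delta p n)⁻¹ * (1 / (n : ℝ)) * Real.log 2)
        + 16 * ((delta p n)⁻¹ * (1 / (n : ℝ)) * logTerm ε n) := by unfold vTerm; ring
    _ ≤ _ := by linarith

/-- The growth of the elimination thresholds. -/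
theorem xThreshold_le {V : ℝ} (hV : V = 2 * K + c₁' c p + 64) (hp : 0 < p) (hn : 1 ≤ n)
    (hM : 1 ≤ M) (hL : 0 ≤ logTerm ε n) (hLM : logTerm ε n ≤ M) :
    xThreshold K c p ε n ≤ 2 * (√V * (c₁ c p + 45) + 2) * (delta p n * (M * √M)) := by
  have hn0 : (0 : ℝ) < n := by exact_mod_cast hn
  have hδ := delta_pos (p := p) hn
  have hc1 := c₁_nonneg (c := c) (p := p)
  have hc' := c₁'_nonneg (c := c) (p := p)
  have hV0 : 0 < V := by rw [hV]; positivity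
  have hM0 : 0 < M := by linarith
  have hsM1 : 1 ≤ √M := Real.one_le_sqrt.2 hM
  have hsM : √M ≤ M := Real.sqrt_le_iff.2 ⟨by linarith, by nlinarith⟩
  have hsL : √(logTerm ε n) ≤ M := (Real.sqrt_le_sqrt hLM).trans hsM
  have hv : vTerm K c p ε (delta p n) n ≤ V * M := hV ▸ vTerm_le hp hn hM hLM
  set v := vTerm K c p ε (delta p n) n
  have hsv : √v ≤ √V * √M := (Real.sqrt_le_sqrt hv).trans_eq (Real.sqrt_mul hV0.le M)
  have h1 := inv_sqrt_le_delta (p := p) hn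
  have h2 := inv_delta_div_le_delta (p := p) hn
  have h2' : 0 ≤ 1 / (delta p n * n) := by positivity
  have ha : aTerm c p ε (delta p n) v n ≤ √V * √M * ((c₁ c p + 43) * (delta p n * M)) := by
    have e1 : c₁ c p / (n : ℝ) ^ (min (1 / 2) (1 / (2 * p))) ≤ c₁ c p * (delta p n * M) := by
      rw [← inv_delta, div_inv_eq_mul]
      gcongr
      exact le_mul_of_one_le_right hδ.le hM
    have e2 : 37 / √(n : ℝ) * √(logTerm ε n) ≤ 37 * (delta p n * M) := by
      calc 37 / √(n : ℝ) * √(logTerm ε n) = 37 * (1 / √(n : ℝ) * √(logTerm ε n)) := by ring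
        _ ≤ _ := by gcongr
    have e3 : 1 / (delta p n * (n : ℝ)) * (3 * Real.log 2 + 3 * logTerm ε n)
        ≤ delta p n * (6 * M) := by
      have := log_two_le_one
      exact (mul_le_mul_of_nonneg_left
        (show 3 * Real.log 2 + 3 * logTerm ε n ≤ 6 * M by linarith) h2').trans (by gcongr)
    have := Real.log_nonneg (one_le_two (α := ℝ))
    unfold aTerm
    exact mul_le_mul hsv (by linarith) (by positivity) (by positivity)
  have hb : bTerm ε (delta p n) v n ≤ 2 * (√V * (delta p n * M)) + 2 * (delta p n * M) := by
    have e1 : √(v / (n : ℝ) * logTerm ε n) ≤ √V * (delta p n * M) := by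
      calc √(v / (n : ℝ) * logTerm ε n) ≤ √(V * M ^ 2 / n) := by
            apply Real.sqrt_le_sqrt
            calc v / (n : ℝ) * logTerm ε n ≤ V * M / n * M := by gcongr
              _ = V * M ^ 2 / n := by ring
        _ = √V * (1 / √(n : ℝ) * M) := by
            rw [Real.sqrt_div (by positivity), Real.sqrt_mul hV0.le, Real.sqrt_sq hM0.le]
            ring
        _ ≤ _ := by gcongr
    have e2 : 1 / (delta p n * (n : ℝ)) * logTerm ε n ≤ delta p n * M :=
      (mul_le_mul_of_nonneg_left hLM h2').trans (by gcongr)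
    unfold bTerm
    linarith [show 2 / (delta p n * (n : ℝ)) * logTerm ε n
      = 2 * (1 / (delta p n * (n : ℝ)) * logTerm ε n) by ring]
  have h3 : √V * (delta p n * M) * 1 ≤ √V * (delta p n * M) * √M := by gcongr
  have h4 : delta p n * M * 1 ≤ delta p n * M * √M := by gcongr
  unfold xThreshold
  linarith

/-- The number M = 2 log(n/ε) dominates every L_t with t ≤ n, so x_t is a constant times δ_t
M^{3/2}: one factor M from the terms of a_t, and √M from √v_t. Summing the δ_t gives the rate n δ_n,
common to both regimes of p. -/
theorem regretBound_le_mul_delta (hp : 0 < p) : ∃ C : ℝ, ∀ ε : ℝ, 0 < ε → ε ≤ 1 / 2 →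
    ∀ n : ℕ, 1 ≤ n →
      regretBound K c p ε n ≤ C * (n * delta p n * Real.log ((n : ℝ) / ε) ^ (3 / 2 : ℝ)) := by
  set X := 2 * (√(2 * K + c₁' c p + 64) * (c₁ c p + 45) + 2) with hX
  have hX0 : 0 ≤ X := by
    have := c₁_nonneg (c := c) (p := p)
    positivity
  refine ⟨(4 * K * X + 3) * 2 ^ (3 / 2 : ℝ), fun ε hε hε2 n hn => ?_⟩
  have hn1 : (1 : ℝ) ≤ n := by exact_mod_cast hn
  have hn0 : (0 : ℝ) < n := by linarith
  have hδ := delta_pos (p := p) hn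
  set ℓ := Real.log ((n : ℝ) / ε) with hℓ
  have h2ε : 2 ≤ 1 / ε := by rw [le_div_iff₀ hε]; linarith
  have hεn : 1 / ε ≤ n / ε := by gcongr
  have hℓ1 : Real.log (1 / ε) ≤ ℓ := Real.log_le_log (by positivity) hεn
  have hℓ2 : 1 / 2 ≤ ℓ := by
    have h1 : Real.log 2 ≤ ℓ := Real.log_le_log (by norm_num) (h2ε.trans hεn)
    linarith [Real.log_two_gt_d9]
  have hM : 1 ≤ 2 * ℓ := by linarith
  have hM0 : 0 < 2 * ℓ := by linarith
  have hL : ∀ t ∈ Finset.Icc 1 n, 0 ≤ logTerm ε t ∧ logTerm ε t ≤ 2 * ℓ := fun t ht => by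
    obtain ⟨ht1, ht2⟩ := Finset.mem_Icc.1 ht
    have ht0 : (1 : ℝ) ≤ t := by exact_mod_cast ht1
    constructor
    · refine Real.log_nonneg ?_
      rw [one_le_div hε]
      nlinarith
    · refine (logTerm_mono hε ht1 ht2).trans ?_
      have h1 : 2 * ℓ = Real.log (((n : ℝ) / ε) ^ 2) := by rw [Real.log_pow]; norm_num [hℓ]
      rw [h1]
      refine Real.log_le_log (logTerm_arg_pos hε hn) ?_
      calc (n : ℝ) * (n + 1) / ε = n * (n + 1) * 1 / ε := by rw [mul_one]
        -- The assumption ε ≤ 1/2 is used as 1 ≤ 1/(2ε), and n + 1 ≤ 2n.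
        _ ≤ n * (2 * n) * (1 / (2 * ε)) / ε := by
            have : 1 ≤ 1 / (2 * ε) := by rw [le_div_iff₀ (by positivity)]; linarith
            gcongr
            linarith
        _ = ((n : ℝ) / ε) ^ 2 := by field_simp
  have hpow : 2 * ℓ * √(2 * ℓ) = 2 ^ (3 / 2 : ℝ) * ℓ ^ (3 / 2 : ℝ) := by
    rw [← Real.mul_rpow (by norm_num) (by linarith), Real.sqrt_eq_rpow,
      show (3 / 2 : ℝ) = 1 + 1 / 2 by norm_num, Real.rpow_add hM0, Real.rpow_one]
  set Z := 2 * ℓ * √(2 * ℓ) with hZ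
  have hsM : 1 ≤ √(2 * ℓ) := Real.one_le_sqrt.2 hM
  have hZ1 : 1 ≤ Z := by nlinarith
  have hsqrt : √(2 * ℓ) ≤ Z := le_mul_of_one_le_left (Real.sqrt_nonneg _) hM
  have hnδ : √(n : ℝ) ≤ n * delta p n := by
    have h := mul_le_mul_of_nonneg_left (inv_sqrt_le_delta (p := p) hn) hn0.le
    rwa [mul_one_div, Real.div_sqrt] at h
  have hsum := sum_delta_le (p := p) hn
  have e1 : √(n * Real.log (1 / ε)) ≤ n * delta p n * Z := by
    rw [Real.sqrt_mul hn0.le]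
    have : √(Real.log (1 / ε)) ≤ Z := (Real.sqrt_le_sqrt (by linarith)).trans hsqrt
    gcongr
  have e2 : ∑ t ∈ Finset.Icc 1 n, xThreshold K c p ε t ≤ X * Z * (2 * (n * delta p n)) := by
    calc ∑ t ∈ Finset.Icc 1 n, xThreshold K c p ε t
        ≤ ∑ t ∈ Finset.Icc 1 n, X * Z * delta p t := Finset.sum_le_sum fun t ht => by
          have := xThreshold_le (c := c) (K := K) rfl hp (Finset.mem_Icc.1 ht).1 hM (hL t ht).1
            (hL t ht).2
          rw [← hX, ← hZ] at this
          linarith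
      _ ≤ X * Z * (2 * (n * delta p n)) := by
          rw [← Finset.mul_sum]
          gcongr
  have e3 : n * delta p n * 1 ≤ n * delta p n * Z := by gcongr
  have e4 : 2 * (K : ℝ) * ∑ t ∈ Finset.Icc 1 n, xThreshold K c p ε t
      ≤ 2 * K * (X * Z * (2 * (n * delta p n))) := by gcongr
  calc regretBound K c p ε n ≤ (4 * K * X + 3) * (n * delta p n * Z) := by
        unfold regretBound
        linarith
    _ = _ := by rw [hpow]; ring

theorem mul_delta_of_lt_one (hp : 0 < p) (hp1 : p ≤ 1) (hn : 1 ≤ n) :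
    n * delta p n = √(n : ℝ) := by
  have hn0 : (0 : ℝ) < n := by exact_mod_cast hn
  rw [← inv_inv (delta p n), ← Real.sqrt_sq (inv_nonneg.2 (delta_pos hn).le),
    inv_delta_sq_of_lt_one hp hp1, ← div_eq_mul_inv, Real.div_sqrt]

theorem mul_delta_of_one_le (hp1 : 1 ≤ p) (hn : 1 ≤ n) :
    n * delta p n = (n : ℝ) ^ ((p - 1 / 2) / p) := by
  have hn0 : (0 : ℝ) < n := by exact_mod_cast hn
  rw [← inv_inv (delta p n), inv_delta_of_one_le hp1, ← Real.rpow_neg hn0.le]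
  nth_rewrite 1 [← Real.rpow_one (n : ℝ)]
  rw [← Real.rpow_add hn0]
  congr 1
  field_simp
  ring

end Growth

end GPE

theorem mainTheorem1 (K : ℕ) (hK : 2 ≤ K) (c p : ℝ) (hc : 0 < c) (hp : 0 < p)
    (hp1 : p ≠ 1) (hp2 : p ≠ 2) :
    (∀ (d : ℕ) (PW : Measure (GPE.Context d)) (_ : IsProbabilityMeasure PW)
      (η : GPE.ActionFn d K) (_ : ∀ a, Measurable (η a))
      (_ : ∀ a w, 0 ≤ η a w ∧ η a w ≤ 1)
      (F : Set (GPE.ActionFn d K)) (_ : ∀ f ∈ F, GPE.IsPolicy f)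
      (_ : GPE.EntropyCondition c p F)
      (fstar : GPE.ActionFn d K) (_ : fstar ∈ F)
      (_ : ∀ f ∈ F, GPE.risk PW η fstar ≤ GPE.risk PW η f)
      (ε : ℝ) (_ : 0 < ε)
      (Ω : Type*) (_ : MeasurableSpace Ω) (μ : Measure Ω) (_ : IsProbabilityMeasure μ)
      (gt : ℕ → Ω → GPE.ActionFn d K) (W : ℕ → Ω → GPE.Context d) (A : ℕ → Ω → Fin K)
      (Y : ℕ → Ω → ℝ)
      (_ : GPE.IsGPERun μ PW η F (GPE.delta p) (GPE.xThreshold K c p ε) gt W A Y),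
      ENNReal.ofReal (1 - 7 * ε) ≤
        μ {ω | ∀ t : ℕ, 1 ≤ t →
          ∑ τ ∈ Finset.Icc 1 t, (GPE.value PW η fstar - Y τ ω) ≤ GPE.regretBound K c p ε t}) ∧
    (p < 1 → ∃ C : ℝ, ∀ ε : ℝ, 0 < ε → ε ≤ 1 / 2 → ∀ t : ℕ, 1 ≤ t →
      GPE.regretBound K c p ε t ≤
        C * (√(t : ℝ) * Real.log ((t : ℝ) / ε) ^ (3 / 2 : ℝ))) ∧
    (1 < p → ∃ C : ℝ, ∀ ε : ℝ, 0 < ε → ε ≤ 1 / 2 → ∀ t : ℕ, 1 ≤ t →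
      GPE.regretBound K c p ε t ≤
        C * ((t : ℝ) ^ ((p - 1 / 2) / p) * Real.log ((t : ℝ) / ε) ^ (3 / 2 : ℝ))) := by
  refine ⟨?_, fun h => ?_, fun h => ?_⟩
  · intro d PW _ η hη hη01 F hpol hent fstar hfs hmin ε hε Ω _ μ _ gt W A Y hrun
    exact hrun.regret_le hη hη01 hK hc hp hp1 hp2 hpol hent hfs hmin hε
  · obtain ⟨C, hC⟩ := GPE.regretBound_le_mul_delta (c := c) (K := K) hp
    refine ⟨C, fun ε hε hε2 t ht => ?_⟩
    rw [← GPE.mul_delta_of_lt_one hp h.le ht]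
    exact hC ε hε hε2 t ht
  · obtain ⟨C, hC⟩ := GPE.regretBound_le_mul_delta (c := c) (K := K) hp
    refine ⟨C, fun ε hε hε2 t ht => ?_⟩
    rw [← GPE.mul_delta_of_one_le h.le ht]
    exact hC ε hε hε2 t ht
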